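/- Let $N$ be a lattice of rank $n$ and $N_{\mathbb R}=N\otimes\mathbb R$. A tropical cycle of codimension $c$ in $N_{\mathbb R}$ is a finite polyhedral complex with rational slopes, pure of codimension $c$ (the complex without cells is allowed: the zero cycle), together with a rational multiplicity $m_X(\sigma)$ for each facet $\sigma$, such that for every ridge $\tau$ one has $$\sum_{\sigma\supset\tau} m_X(\sigma)\,v_{\sigma/\tau}\in \operatorname{span}(N_\tau).$$ Here the sum is over the facets $\sigma$ containing $\tau$, $N_\sigma\subset N$ is the sublattice of vectors parallel to the affine span of $\sigma$, and $v_{\sigma/\tau}\in N$ lies in the link of $\sigma$ at $\tau$ and generates $N_\sigma$ together with $N_\tau$. Two cycles of the same codimension are considered equal if, after common refinement with some complete rational polyhedral complex, they have the same facets of non-zero multiplicity, with the same multiplicities. For tropical cycles $X,Y$ and a cell $\gamma$ of the common refinement $\{\sigma\cap\tau:\sigma\in X,\ \tau\in Y\}$ with $\operatorname{codim}\gamma=\operatorname{codim}X+\operatorname{codim}Y$, let $m_{X\cdot Y}(\gamma)$ be the value, for generic $v\in N_{\mathbb R}$, of $$\sum_{(\sigma,\tau)} m_X(\sigma)\,m_Y(\tau)\,[N:N_\sigma+N_\tau],$$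 the sum being over the pairs of facets $\sigma\in X$, $\tau\in Y$ containing $\gamma$ with $v\in\operatorname{link}_\gamma\sigma-\operatorname{link}_\gamma\tau$. The stable intersection $X\cdot Y$ is the weighted complex of codimension $\operatorname{codim}X+\operatorname{codim}Y$ whose facets are those $\gamma$ for which the cycle $\operatorname{link}_\gamma X-\operatorname{link}_\gamma Y$ has support $N_{\mathbb R}$ (that is, for which the sum above is non-zero for a dense set of $v$), with multiplicities $m_{X\cdot Y}(\gamma)$. **Theorem.** Stable intersection of tropical cycles is associative: for any three tropical cycles $X,Y,Z$ in $N_{\mathbb R}$, the stable intersections $X\cdot Y$ and $Y\cdot Z$ are again tropical cycles, and $$(X\cdot Y)\cdot Z = X\cdot(Y\cdot Z).$$ -/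

import Mathlib

open scoped Pointwise

namespace Trop

/-- Nonempty faces of a convex set: nonempty convex extreme subsets.  On polyhedra these are exactly
the usual nonempty faces (the polyhedron itself included). -/
def IsFace {V : Type*} [AddCommGroup V] [Module ℝ V] (P F : Set V) : Prop :=
  F.Nonempty ∧ Convex ℝ F ∧ IsExtreme ℝ P F

/-- A face of `P ∩ Q` is an intersection of a face of `P` with a face of `Q`; this is the face of
`P` used for it. -/
def faceHull {V : Type*} [AddCommGroup V] [Module ℝ V] (P F : Set V) : Set V :=
  {y | y ∈ P ∧ ∃ x ∈ F, ∃ ε : ℝ, 0 < ε ∧ x + ε • (x - y) ∈ P}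

theorem shrink_mem {V : Type*} [AddCommGroup V] [Module ℝ V] {P : Set V} (hP : Convex ℝ P)
    {x d : V} (hx : x ∈ P) {ε δ : ℝ} (hδ : 0 < δ) (hδε : δ ≤ ε) (h : x + ε • d ∈ P) :
    x + δ • d ∈ P := by
  have hε : 0 < ε := lt_of_lt_of_le hδ hδε
  have h1 : δ / ε ≤ 1 := (div_le_one hε).2 hδε
  have := hP hx h (a := 1 - δ / ε) (b := δ / ε) (by linarith) (by positivity) (by ring)
  convert this using 1
  have e : δ = δ / ε * ε := by field_simp
  nth_rewrite 1 [e]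
  module

theorem isFace_faceHull {V : Type*} [AddCommGroup V] [Module ℝ V] {P F : Set V}
    (hP : Convex ℝ P) (hFP : F ⊆ P) (hF : Convex ℝ F) (hne : F.Nonempty) :
    IsFace P (faceHull P F) := by
  refine ⟨?_, ?_, ?_⟩
  · obtain ⟨x, hx⟩ := hne
    exact ⟨x, hFP hx, x, hx, 1, one_pos, by simpa using hFP hx⟩
  · rintro y ⟨hy, x, hx, ε, hε, hm⟩ y' ⟨hy', x', hx', ε', hε', hm'⟩ a b ha hb hab
    refine ⟨hP hy hy' ha hb hab, a • x + b • x', hF hx hx' ha hb hab, min ε ε',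
      lt_min hε hε', ?_⟩
    have h1 := shrink_mem hP (hFP hx) (lt_min hε hε') (min_le_left _ _) hm
    have h2 := shrink_mem hP (hFP hx') (lt_min hε hε') (min_le_right _ _) hm'
    convert hP h1 h2 ha hb hab using 1
    module
  · refine ⟨fun y hy => hy.1, ?_⟩
    rintro y₁ hy₁ y₂ hy₂ z ⟨-, x, hx, ε, hε, hm⟩ ⟨a, b, ha, hb, hab, rfl⟩
    refine ⟨hy₁, x, hx, ε * a / (1 + ε * b), by positivity, ?_⟩
    have hD : 0 < 1 + ε * b := by positivity
    have := hP hm hy₂ (a := 1 / (1 + ε * b)) (b := ε * b / (1 + ε * b)) (by positivity)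
      (by positivity) (by field_simp)
    convert this using 1
    have ha' : a = 1 - b := by linarith
    subst ha'
    match_scalars <;> field_simp <;> ring

theorem face_inter_eq {V : Type*} [AddCommGroup V] [Module ℝ V] {P Q F : Set V}
    (hP : Convex ℝ P) (hQ : Convex ℝ Q) (hF : IsFace (P ∩ Q) F) :
    F = faceHull P F ∩ faceHull Q F := by
  obtain ⟨-, hc, hs, he⟩ := hF
  apply Set.Subset.antisymm
  · intro y hy
    exact ⟨⟨(hs hy).1, y, hy, 1, one_pos, by simpa using (hs hy).1⟩,
      ⟨(hs hy).2, y, hy, 1, one_pos, by simpa using (hs hy).2⟩⟩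
  · have key : ∀ {R : Set V}, Convex ℝ R → ∀ {x x' y : V} {ε : ℝ}, x' ∈ R → 0 < ε →
        x + ε • (x - y) ∈ R → ((1 / 2 : ℝ) • x + (1 / 2 : ℝ) • x') +
          (ε / (2 + ε)) • (((1 / 2 : ℝ) • x + (1 / 2 : ℝ) • x') - y) ∈ R := by
      intro R hR x x' y ε hx' hε hm
      have hD : 0 < 2 + ε := by positivity
      have := hR hm hx' (a := 1 / (2 + ε)) (b := (1 + ε) / (2 + ε)) (by positivity)
        (by positivity) (by field_simp; ring)
      convert this using 1
      match_scalars <;> field_simp <;> ring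
    rintro y ⟨⟨hyP, x, hx, ε, hε, hm⟩, ⟨hyQ, x', hx', ε', hε', hm'⟩⟩
    have hz : (1 / 2 : ℝ) • x + (1 / 2 : ℝ) • x' ∈ F :=
      hc hx hx' (by norm_num) (by norm_num) (by norm_num)
    have h1 := key hP (hs hx').1 hε hm
    have h2 := key hQ (hs hx).2 hε' hm'
    rw [add_comm ((1 / 2 : ℝ) • x')] at h2
    set z := (1 / 2 : ℝ) • x + (1 / 2 : ℝ) • x'
    have p1 : 0 < ε / (2 + ε) := by positivity
    have p2 : 0 < ε' / (2 + ε') := by positivity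
    set δ := min (ε / (2 + ε)) (ε' / (2 + ε')) with hδ
    have hδ0 : 0 < δ := lt_min p1 p2
    have h1' := shrink_mem hP (hs hz).1 hδ0 (min_le_left _ _) h1
    have h2' := shrink_mem hQ (hs hz).2 hδ0 (min_le_right _ _) h2
    refine he ⟨hyP, hyQ⟩ ⟨h1', h2'⟩ hz
      ⟨δ / (1 + δ), 1 / (1 + δ), by positivity, by positivity, by field_simp; ring, ?_⟩
    match_scalars <;> field_simp <;> ring

theorem IsFace.inter {V : Type*} [AddCommGroup V] [Module ℝ V] {P Q F G : Set V}
    (hF : IsFace P F) (hG : IsFace Q G) (h : (F ∩ G).Nonempty) : IsFace (P ∩ Q) (F ∩ G) := by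
  refine ⟨h, hF.2.1.inter hG.2.1, fun _ hx => ⟨hF.2.2.1 hx.1, hG.2.2.1 hx.2⟩, ?_⟩
  intro x hx y hy z hz hzo
  exact ⟨hF.2.2.2 hx.1 hy.1 hz.1 hzo, hG.2.2.2 hx.2 hy.2 hz.2 hzo⟩

variable {V : Type*} [NormedAddCommGroup V] [NormedSpace ℝ V]

/-- A nonempty polyhedron with rational slopes: finitely many inequalities `ℓ x ≤ b` with `ℓ`
integral on the lattice `Λ` and `b` real. -/
def IsRationalPolyhedron (Λ : Submodule ℤ V) (P : Set V) : Prop :=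
  P.Nonempty ∧ ∃ s : Finset (Module.Dual ℝ V × ℝ),
    (∀ p ∈ s, ∀ x ∈ Λ, ∃ z : ℤ, p.1 x = z) ∧ P = {x | ∀ p ∈ s, p.1 x ≤ p.2}

theorem IsRationalPolyhedron.convex {Λ : Submodule ℤ V} {P : Set V}
    (h : IsRationalPolyhedron Λ P) : Convex ℝ P := by
  obtain ⟨-, s, -, rfl⟩ := h
  intro x hx y hy a b ha hb hab p hp
  have h1 := mul_le_mul_of_nonneg_left (hx p hp) ha
  have h2 := mul_le_mul_of_nonneg_left (hy p hp) hb
  have h3 : p.2 = a * p.2 + b * p.2 := by rw [← add_mul, hab, one_mul]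
  simp only [map_add, map_smul, smul_eq_mul]
  linarith

open Classical in
theorem IsRationalPolyhedron.inter {Λ : Submodule ℤ V} {P Q : Set V}
    (hP : IsRationalPolyhedron Λ P) (hQ : IsRationalPolyhedron Λ Q) (h : (P ∩ Q).Nonempty) :
    IsRationalPolyhedron Λ (P ∩ Q) := by
  obtain ⟨-, s, hs, rfl⟩ := hP
  obtain ⟨-, t, ht, rfl⟩ := hQ
  refine ⟨h, s ∪ t, ?_, ?_⟩
  · intro p hp
    rcases Finset.mem_union.1 hp with hp | hp
    exacts [hs p hp, ht p hp]
  · ext x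
    simp only [Set.mem_inter_iff, Set.mem_ofPred_eq, Finset.mem_union]
    exact ⟨fun hx p hp => hp.elim (hx.1 p) (hx.2 p),
      fun hx => ⟨fun p hp => hx p (.inl hp), fun p hp => hx p (.inr hp)⟩⟩

/-- Dimension of (the affine span of) a set. -/
noncomputable def dim (P : Set V) : ℕ := Module.finrank ℝ (vectorSpan ℝ P)

/-- A finite rational polyhedral complex in `V = N_ℝ`, where `Λ` is the lattice `N`. -/
structure PolyComplex (Λ : Submodule ℤ V) where
  cells : Finset (Set V)
  polyhedron : ∀ σ ∈ cells, IsRationalPolyhedron Λ σ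
  face_mem : ∀ σ ∈ cells, ∀ τ, IsFace σ τ → τ ∈ cells
  inter_face : ∀ σ ∈ cells, ∀ τ ∈ cells, (σ ∩ τ).Nonempty → IsFace σ (σ ∩ τ)

/-- The cells cover the whole space. -/
def PolyComplex.Complete {Λ : Submodule ℤ V} (A : PolyComplex Λ) : Prop :=
  ∀ x : V, ∃ σ ∈ A.cells, x ∈ σ

open Classical in
/-- The common refinement: all nonempty `σ ∩ τ` with `σ` in `A` and `τ` in `B`. -/
noncomputable def PolyComplex.refine {Λ : Submodule ℤ V} (A B : PolyComplex Λ) :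
    PolyComplex Λ where
  cells := (Finset.image₂ (fun σ τ => σ ∩ τ) A.cells B.cells).filter Set.Nonempty
  polyhedron := by
    intro ρ hρ
    obtain ⟨hρ, hne⟩ := Finset.mem_filter.1 hρ
    obtain ⟨σ, hσ, τ, hτ, rfl⟩ := Finset.mem_image₂.1 hρ
    exact (A.polyhedron σ hσ).inter (B.polyhedron τ hτ) hne
  face_mem := by
    intro ρ hρ φ hφ
    obtain ⟨hρ, hne⟩ := Finset.mem_filter.1 hρ
    obtain ⟨σ, hσ, τ, hτ, rfl⟩ := Finset.mem_image₂.1 hρ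
    have cσ := (A.polyhedron σ hσ).convex
    have cτ := (B.polyhedron τ hτ).convex
    have e := face_inter_eq cσ cτ hφ
    refine Finset.mem_filter.2 ⟨Finset.mem_image₂.2
      ⟨_, A.face_mem σ hσ _ (isFace_faceHull cσ (fun x hx => (hφ.2.2.1 hx).1) hφ.2.1 hφ.1),
        _, B.face_mem τ hτ _ (isFace_faceHull cτ (fun x hx => (hφ.2.2.1 hx).2) hφ.2.1 hφ.1),
        e.symm⟩, hφ.1⟩
  inter_face := by
    intro ρ hρ ρ' hρ' h
    obtain ⟨hρ, -⟩ := Finset.mem_filter.1 hρ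
    obtain ⟨σ, hσ, τ, hτ, rfl⟩ := Finset.mem_image₂.1 hρ
    obtain ⟨hρ', -⟩ := Finset.mem_filter.1 hρ'
    obtain ⟨σ', hσ', τ', hτ', rfl⟩ := Finset.mem_image₂.1 hρ'
    have e : σ ∩ τ ∩ (σ' ∩ τ') = (σ ∩ σ') ∩ (τ ∩ τ') := Set.inter_inter_inter_comm _ _ _ _
    change IsFace (σ ∩ τ) (σ ∩ τ ∩ (σ' ∩ τ'))
    change (σ ∩ τ ∩ (σ' ∩ τ')).Nonempty at h
    rw [e] at h ⊢
    exact (A.inter_face σ hσ σ' hσ' (h.mono Set.inter_subset_left)).inter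
      (B.inter_face τ hτ τ' hτ' (h.mono Set.inter_subset_right)) h

/-- A rational polyhedral complex, pure of codimension `codim`, with a rational multiplicity on each
facet (the values of `mult` on other sets carry no information).  Only the complex without
cells is possible when `codim` exceeds the dimension of the space. -/
structure WeightedComplex (Λ : Submodule ℤ V) extends PolyComplex Λ where
  codim : ℕ
  pure : ∀ τ ∈ cells, ∃ σ ∈ cells, τ ⊆ σ ∧ dim σ + codim = Module.finrank ℝ V
  mult : Set V → ℚ

open Classical in
/-- The facets: by purity these are exactly the maximal cells. -/
noncomputable def WeightedComplex.facets {Λ : Submodule ℤ V} (X : WeightedComplex Λ) :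
    Finset (Set V) :=
  X.cells.filter fun σ => dim σ + X.codim = Module.finrank ℝ V

/-- `N_σ`: the maximal sublattice of `Λ` parallel to the affine span of `σ`. -/
def latticeOf (Λ : Submodule ℤ V) (σ : Set V) : AddSubgroup V :=
  Λ.toAddSubgroup ⊓ (vectorSpan ℝ σ).toAddSubgroup

/-- The link of `σ` at (the relative interior points of) `γ`, for `γ ⊆ σ`. -/
def link (γ σ : Set V) : Set V :=
  {u | ∃ ω ∈ intrinsicInterior ℝ γ, ∃ δ : ℝ, 0 < δ ∧ ∀ ε : ℝ, 0 < ε → ε < δ → ω + ε • u ∈ σ}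

open Classical in
/-- A weighted complex is a tropical cycle if it is balanced: for each ridge `τ`,
`∑ mult σ • v_{σ/τ}`, over the facets `σ` containing `τ`, lies in the span of `N_τ`, where
`v_{σ/τ} ∈ N` is in the link of `σ` at `τ` and generates `N_σ` together with `N_τ`. -/
def WeightedComplex.IsTropicalCycle {Λ : Submodule ℤ V} (X : WeightedComplex Λ) : Prop :=
  ∀ τ ∈ X.cells, dim τ + X.codim + 1 = Module.finrank ℝ V →
    ∃ u : Set V → V,
      (∀ σ ∈ X.facets, τ ⊆ σ → u σ ∈ Λ ∧ u σ ∈ link τ σ ∧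
        latticeOf Λ τ ⊔ AddSubgroup.zmultiples (u σ) = latticeOf Λ σ) ∧
      ∑ σ ∈ X.facets.filter (fun σ => τ ⊆ σ), (X.mult σ : ℝ) • u σ ∈
        Submodule.span ℝ (latticeOf Λ τ : Set V)

/-- The facets `σ ∩ τ` of non-zero multiplicity of the common refinement of `X` with `A`, paired
with the multiplicity inherited from `X`. -/
def WeightedComplex.refinedFacets {Λ : Submodule ℤ V} (X : WeightedComplex Λ)
    (A : PolyComplex Λ) : Set (Set V × ℚ) :=
  {p | ∃ σ ∈ X.facets, ∃ τ ∈ A.cells, p = (σ ∩ τ, X.mult σ) ∧ (σ ∩ τ).Nonempty ∧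
    dim (σ ∩ τ) + X.codim = Module.finrank ℝ V ∧ X.mult σ ≠ 0}

/-- Equality of cycles: same codimension, and same facets with multiplicities, up to
facets of multiplicity zero, after common refinement with some complete complex. -/
def WeightedComplex.SameCycle {Λ : Submodule ℤ V} (X Y : WeightedComplex Λ) : Prop :=
  X.codim = Y.codim ∧ ∃ A : PolyComplex Λ, A.Complete ∧ X.refinedFacets A = Y.refinedFacets A

open Classical in
/-- The multiplicity at a generic point `v` of the Minkowski sum `link_γ X - link_γ Y`: the sum of
`mult σ * mult τ * [N : N_σ + N_τ]` over the facets `σ` of `X` and `τ` of `Y` that contain `γ` and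
satisfy `v ∈ link_γ σ - link_γ τ`. -/
noncomputable def linkDiffMult {Λ : Submodule ℤ V} (X Y : WeightedComplex Λ) (γ : Set V)
    (v : V) : ℚ :=
  ∑ σ ∈ X.facets.filter (fun σ => γ ⊆ σ), ∑ τ ∈ Y.facets.filter (fun τ => γ ⊆ τ),
    if v ∈ link γ σ - link γ τ then
      X.mult σ * Y.mult τ *
        ((latticeOf Λ σ ⊔ latticeOf Λ τ).relIndex Λ.toAddSubgroup : ℚ)
    else 0

/-- `link_γ X - link_γ Y` has support the whole space, that is, the points of non-zero multiplicity
are dense.  (Non-generic points form a nowhere dense set and do not matter.) -/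
def LinkDiffComplete {Λ : Submodule ℤ V} (X Y : WeightedComplex Λ) (γ : Set V) : Prop :=
  closure {v | linkDiffMult X Y γ v ≠ 0} = Set.univ

open Classical in
/-- The multiplicity of `γ` in the stable intersection: the constant value of the multiplicity of
`link_γ X - link_γ Y` on a dense open set. -/
noncomputable def stableMult {Λ : Submodule ℤ V} (X Y : WeightedComplex Λ) (γ : Set V) : ℚ :=
  if h : ∃ m : ℚ, ∃ U : Set V, IsOpen U ∧ Dense U ∧ ∀ v ∈ U, linkDiffMult X Y γ v = m then
    h.choose
  else 0

open Classical in
/-- The stable intersection `X · Y`: the subcomplex of the common refinement whose facets are the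
cells `γ` with `codim γ = codim X + codim Y` for which `link_γ X - link_γ Y` has support the
whole space, with the multiplicity of `link_γ X - link_γ Y` as weight. -/
noncomputable def WeightedComplex.stableInter {Λ : Submodule ℤ V} (X Y : WeightedComplex Λ) :
    WeightedComplex Λ where
  cells := (X.refine Y.toPolyComplex).cells.filter fun δ =>
    ∃ γ ∈ (X.refine Y.toPolyComplex).cells,
      dim γ + (X.codim + Y.codim) = Module.finrank ℝ V ∧ LinkDiffComplete X Y γ ∧ δ ⊆ γ
  polyhedron := fun σ hσ => (X.refine Y.toPolyComplex).polyhedron σ (Finset.mem_filter.1 hσ).1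
  face_mem := by
    intro σ hσ τ hτ
    obtain ⟨h1, γ, hγ, hd, hc, hs⟩ := Finset.mem_filter.1 hσ
    exact Finset.mem_filter.2 ⟨(X.refine Y.toPolyComplex).face_mem σ h1 τ hτ,
      γ, hγ, hd, hc, hτ.2.2.1.trans hs⟩
  inter_face := fun σ hσ τ hτ =>
    (X.refine Y.toPolyComplex).inter_face σ (Finset.mem_filter.1 hσ).1 τ (Finset.mem_filter.1 hτ).1
  codim := X.codim + Y.codim
  pure := by
    intro τ hτ
    obtain ⟨-, γ, hγ, hd, hc, hs⟩ := Finset.mem_filter.1 hτ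
    exact ⟨γ, Finset.mem_filter.2 ⟨hγ, γ, hγ, hd, hc, subset_rfl⟩, hs, hd⟩
  mult := stableMult X Y

end Trop

/-! Both sides are read off from one push-forward. Fix a cell γ of the common refinement of X, Y and
Z with codimension `X.codim + Y.codim + Z.codim`, take ω in its relative interior, and replace the
three cycles by their tangent cones at ω. The product of these fans lives in V × V × V; push it
forward to V × V by (x, y, z) ↦ (x − y, y − z), weighting each triple of facets by a lattice index.
The degree at a point of V × V is `tripleMult`.

The degree is generically constant (`BalancedFamily.exists_degree_eq`). Along a generic line it
could only jump at the image of a codimension-one wall, and there the jump is a linear functional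
applied to the balancing sum, because the index of M + ℤu is the absolute value of a linear
functional of u (`exists_linear_relIndex`).

At a point (εv, w) with w and v generic and ε small, the degree is the multiplicity of γ in (X·Y)·Z:
the equation y − z = w places y in the relative interior of σ ∩ τ, and the small term εv is then
solved in the links at σ ∩ τ (`eventually_tripleDiff_iff`, `eventually_linkDiffMult_stableInter`).
Reversing the order of the three factors gives X·(Y·Z) in the same way. The weights agree because
the index of the image lattice in N × N can be factored through either projection: [N : N_σ + N_τ][N
: N_σ ∩ N_τ + N_ρ] = [N : N_τ + N_ρ][N : N_σ + N_τ ∩ N_ρ] (`relIndex_map_tripleDiff`,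
`relIndex_map_tripleDiff'`).

The argument for (X·Y)·Z needs X, Y and Z to be balanced, but not X·Y. So it may be applied with Z a
rational hyperplane through a ridge of X·Y, and comparing the multiplicities at w and −w yields the
balancing condition for X·Y (`isTropicalCycle_stableInter`). -/

namespace Trop

open Filter Topology Module

/-! ### The filter of generic vectors -/

section Generic

variable {E F : Type*} [AddCommGroup E] [Module ℝ E] [AddCommGroup F] [Module ℝ F]

/-- A property holds for generic vectors of `E` if it holds off finitely many proper subspaces. -/
def generic (E : Type*) [AddCommGroup E] [Module ℝ E] : Filter E where
  sets := {U | ∃ s : Set (Submodule ℝ E), s.Finite ∧ (∀ S ∈ s, S ≠ ⊤) ∧ ∀ x, (∀ S ∈ s, x ∉ S) → x ∈ U}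
  univ_sets := ⟨∅, Set.finite_empty, by simp, by simp⟩
  sets_of_superset := by
    rintro U W ⟨s, hs, h1, h2⟩ hUW
    exact ⟨s, hs, h1, fun x hx => hUW (h2 x hx)⟩
  inter_sets := by
    rintro U W ⟨s, hs, h1, h2⟩ ⟨t, ht, h3, h4⟩
    exact ⟨s ∪ t, hs.union ht, fun S hS => hS.elim (h1 S) (h3 S),
      fun x hx => ⟨h2 x fun S hS => hx S (.inl hS), h4 x fun S hS => hx S (.inr hS)⟩⟩

theorem eventually_notMem {S : Submodule ℝ E} (hS : S ≠ ⊤) : ∀ᶠ x in generic E, x ∉ S :=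
  ⟨{S}, Set.finite_singleton S, by simpa using hS, fun x hx => hx S rfl⟩

/-- A real vector space is not a finite union of proper subspaces. -/
instance generic_neBot : (generic E).NeBot := by
  rw [neBot_iff, Ne, ← empty_mem_iff_bot]
  rintro ⟨s, hs, h1, h2⟩
  refine Subspace.biUnion_ne_univ_of_top_notMem (s := hs.toFinset) (k := ℝ) (E := E)
    (fun h => h1 ⊤ (by simpa using h) rfl) ?_
  refine Set.eq_univ_of_forall fun x => ?_
  by_contra hx
  refine h2 x fun S hS hxS => hx ?_
  simp only [Set.mem_iUnion]
  exact ⟨S, by simpa using hS, hxS⟩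

theorem tendsto_generic (f : E →ₗ[ℝ] F) (hf : Function.Surjective f) :
    Tendsto f (generic E) (generic F) := by
  rintro U ⟨s, hs, h1, h2⟩
  refine ⟨Submodule.comap f '' s, hs.image _, ?_, fun x hx => h2 _ fun S hS hxS =>
    hx _ ⟨S, hS, rfl⟩ hxS⟩
  rintro _ ⟨S, hS, rfl⟩ h
  refine h1 S hS (Submodule.eq_top_iff'.2 fun y => ?_)
  obtain ⟨x, rfl⟩ := hf y
  exact Submodule.eq_top_iff'.1 h x

/-- A line not contained in any of finitely many subspaces meets their union in finitely many
points. -/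
theorem finite_setOf_line_mem {s : Set (Submodule ℝ E)} (hs : s.Finite) {a b : E}
    (h : ∀ S ∈ s, a ∈ S → b ∉ S) : {t : ℝ | ∃ S ∈ s, a + t • b ∈ S}.Finite := by
  have : {t : ℝ | ∃ S ∈ s, a + t • b ∈ S} = ⋃ S ∈ s, {t : ℝ | a + t • b ∈ S} := by
    ext; simp
  rw [this]
  refine hs.biUnion fun S hS => Set.Subsingleton.finite fun t ht t' ht' => ?_
  by_contra hne
  have hb : b ∈ S := by
    have := S.smul_mem (t - t')⁻¹ (S.sub_mem ht ht')
    rwa [add_sub_add_left_eq_sub, ← sub_smul, inv_smul_smul₀ (sub_ne_zero.2 hne)] at this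
  exact h S hS (by simpa using S.sub_mem ht (S.smul_mem t hb)) hb

/-- The two axis slices of a proper subspace cannot both be everything. So for v and w off the
proper slices the line (v, 0) + t(0, w) meets the exceptional subspaces for finitely many t only,
and some multiple of w works. This serves to drop the auxiliary factor introduced in
`BalancedFamily.exists_degree_eq`. -/
theorem exists_of_eventually_generic_prod {p : E × F → Prop} (h : ∀ᶠ x in generic (E × F), p x) :
    ∀ᶠ v in generic E, ∃ w, p (v, w) := by
  obtain ⟨s, hs, h1, h2⟩ := h
  have hw : ∀ᶠ w in generic F, ∀ S ∈ s, S.comap (LinearMap.inr ℝ E F) ≠ ⊤ → (0, w) ∉ S := by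
    rw [eventually_all_finite hs]
    intro S hS
    by_cases hT : S.comap (LinearMap.inr ℝ E F) = ⊤
    · simp [hT]
    · filter_upwards [eventually_notMem hT] with w hw _ using hw
  obtain ⟨w, hw⟩ := hw.exists
  have hv : ∀ᶠ v in generic E, ∀ S ∈ s, S.comap (LinearMap.inl ℝ E F) ≠ ⊤ → (v, 0) ∉ S := by
    rw [eventually_all_finite hs]
    intro S hS
    by_cases hT : S.comap (LinearMap.inl ℝ E F) = ⊤
    · simp [hT]
    · filter_upwards [eventually_notMem hT] with w hw _ using hw
  filter_upwards [hv] with v hv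
  have hfin := finite_setOf_line_mem hs (a := ((v, 0) : E × F)) (b := (0, w)) (by
    intro S hS hvS hwS
    refine h1 S hS (Submodule.eq_top_iff'.2 fun x => ?_)
    have e1 : S.comap (LinearMap.inr ℝ E F) = ⊤ := by
      by_contra hT
      exact hw S hS hT hwS
    have e2 : S.comap (LinearMap.inl ℝ E F) = ⊤ := by
      by_contra hT
      exact hv S hS hT hvS
    have := S.add_mem (Submodule.eq_top_iff'.1 e2 x.1) (Submodule.eq_top_iff'.1 e1 x.2)
    simpa using this)
  obtain ⟨t, ht⟩ := hfin.infinite_compl.nonempty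
  refine ⟨t • w, h2 _ fun S hS hm => ht ⟨S, hS, by simpa using hm⟩⟩

/-- The same count on the line (0, w) + t(v, 0). The point (0, w) itself may be exceptional, but a
punctured neighbourhood of t = 0 is free of exceptional values. Hence a generic property of V × V
may be tested at (εv, w) with w chosen first. -/
theorem eventually_generic_prod_smul {p : E × F → Prop} (h : ∀ᶠ x in generic (E × F), p x) :
    ∀ᶠ w in generic F, ∀ᶠ v in generic E, ∀ᶠ ε in 𝓝[>] (0 : ℝ), p (ε • v, w) := by
  obtain ⟨s, hs, h1, h2⟩ := h
  have hw : ∀ᶠ w in generic F, ∀ S ∈ s, S.comap (LinearMap.inr ℝ E F) ≠ ⊤ → (0, w) ∉ S := by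
    rw [eventually_all_finite hs]
    intro S hS
    by_cases hT : S.comap (LinearMap.inr ℝ E F) = ⊤
    · simp [hT]
    · filter_upwards [eventually_notMem hT] with w hw _ using hw
  filter_upwards [hw] with w hw
  have hv : ∀ᶠ v in generic E, ∀ S ∈ s, S.comap (LinearMap.inl ℝ E F) ≠ ⊤ → (v, 0) ∉ S := by
    rw [eventually_all_finite hs]
    intro S hS
    by_cases hT : S.comap (LinearMap.inl ℝ E F) = ⊤
    · simp [hT]
    · filter_upwards [eventually_notMem hT] with w hw _ using hw
  filter_upwards [hv] with v hv
  have hfin := finite_setOf_line_mem hs (a := ((0, w) : E × F)) (b := (v, 0)) (by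
    intro S hS hwS hvS
    refine h1 S hS (Submodule.eq_top_iff'.2 fun x => ?_)
    have e1 : S.comap (LinearMap.inr ℝ E F) = ⊤ := by
      by_contra hT
      exact hw S hS hT hwS
    have e2 : S.comap (LinearMap.inl ℝ E F) = ⊤ := by
      by_contra hT
      exact hv S hS hT hvS
    have := S.add_mem (Submodule.eq_top_iff'.1 e2 x.1) (Submodule.eq_top_iff'.1 e1 x.2)
    simpa using this)
  have : ∀ᶠ ε in 𝓝[≠] (0 : ℝ), ε ∉ {t : ℝ | ∃ S ∈ s, ((0, w) : E × F) + t • (v, 0) ∈ S} := by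
    -- The parameter 0 is removed from the finite set so that the complement is a neighbourhood of
    -- 0.
    have h0 := (hfin.subset (Set.sdiff_subset (t := {0}))).isClosed.isOpen_compl.mem_nhds
      (x := (0 : ℝ)) (by simp)
    filter_upwards [nhdsWithin_le_nhds h0, self_mem_nhdsWithin] with t ht ht0 hm
    exact ht ⟨hm, ht0⟩
  filter_upwards [this.filter_mono (nhdsWithin_mono _ fun x (hx : 0 < x) => hx.ne')] with ε hε
  exact h2 _ fun S hS hm => hε ⟨S, hS, by simpa using hm⟩

end Generic

/-- Passes from genericity off subspaces to the dense open sets used in `stableMult`. -/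
theorem exists_isOpen_dense_of_generic {E : Type*} [NormedAddCommGroup E] [NormedSpace ℝ E]
    [FiniteDimensional ℝ E] {p : E → Prop} (h : ∀ᶠ x in generic E, p x) :
    ∃ U : Set E, IsOpen U ∧ Dense U ∧ ∀ x ∈ U, p x := by
  obtain ⟨s, hs, h1, h2⟩ := h
  refine ⟨⋂ S ∈ s, (S : Set E)ᶜ, ?_, ?_, fun x hx => h2 x (by simpa using hx)⟩
  · exact hs.isOpen_biInter fun S _ => S.closed_of_finiteDimensional.isOpen_compl
  · refine dense_biInter_of_isOpen (fun S _ => S.closed_of_finiteDimensional.isOpen_compl)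
      hs.countable fun S hS => ?_
    rw [← interior_eq_empty_iff_dense_compl]
    by_contra hne
    exact h1 S hS (Submodule.eq_top_of_nonempty_interior' S (Set.nonempty_iff_ne_empty.2 hne))

/-- Every generic property is satisfied by some vector of a given dense open set. -/
theorem exists_mem_of_generic {E : Type*} [NormedAddCommGroup E] [NormedSpace ℝ E]
    [FiniteDimensional ℝ E] {p : E → Prop} (h : ∀ᶠ x in generic E, p x) {U : Set E}
    (hU : IsOpen U) (hd : Dense U) : ∃ x ∈ U, p x := by
  obtain ⟨W, hW, hWd, hp⟩ := exists_isOpen_dense_of_generic h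
  obtain ⟨x, hx⟩ := (hd.inter_of_isOpen_left hWd hU).nonempty
  exact ⟨x, hx.1, hp x hx.2⟩

/-! ### Feasible directions -/

section Feasible

variable {E F : Type*} [AddCommGroup E] [Module ℝ E] [AddCommGroup F] [Module ℝ F]

/-- The directions in which one can move a little from `x` without leaving `P`. -/
def feasible (x : E) (P : Set E) : Set E := {u | ∀ᶠ ε in 𝓝[>] (0 : ℝ), x + ε • u ∈ P}

theorem mem_feasible {x u : E} {P : Set E} :
    u ∈ feasible x P ↔ ∀ᶠ ε in 𝓝[>] (0 : ℝ), x + ε • u ∈ P := Iff.rfl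

theorem feasible_inter (x : E) (P Q : Set E) : feasible x (P ∩ Q) = feasible x P ∩ feasible x Q := by
  ext u
  simp only [Set.mem_inter_iff, mem_feasible, eventually_and]

theorem feasible_mono (x : E) {P Q : Set E} (h : P ⊆ Q) : feasible x P ⊆ feasible x Q :=
  fun _ hu => (mem_feasible.1 hu).mono fun _ hε => h hε

theorem mem_feasible_prod {x : E × F} {P : Set E} {Q : Set F} {u : E × F} :
    u ∈ feasible x (P ×ˢ Q) ↔ u.1 ∈ feasible x.1 P ∧ u.2 ∈ feasible x.2 Q := by
  simp only [mem_feasible, ← eventually_and]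
  rfl

/-- Membership for one small parameter gives feasibility. -/
theorem mem_feasible_of_mem {P : Set E} (hP : Convex ℝ P) {x u : E} (hx : x ∈ P) {δ : ℝ}
    (hδ : 0 < δ) (h : x + δ • u ∈ P) : u ∈ feasible x P := by
  filter_upwards [Ioo_mem_nhdsGT hδ] with ε hε
  exact shrink_mem hP hx hε.1 hε.2.le h

theorem mem_feasible_iff {P : Set E} (hP : Convex ℝ P) {x u : E} (hx : x ∈ P) :
    u ∈ feasible x P ↔ ∃ δ : ℝ, 0 < δ ∧ x + δ • u ∈ P := by
  refine ⟨fun h => ?_, fun ⟨δ, hδ, h⟩ => mem_feasible_of_mem hP hx hδ h⟩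
  obtain ⟨δ, h1, h2⟩ := ((mem_feasible.1 h).and self_mem_nhdsWithin).exists
  exact ⟨δ, h2, h1⟩

theorem smul_mem_feasible {P : Set E} {x u : E} {c : ℝ} (hc : 0 < c) (hu : u ∈ feasible x P) :
    c • u ∈ feasible x P := by
  have : Tendsto (fun ε : ℝ => ε * c) (𝓝[>] 0) (𝓝[>] 0) := by
    refine tendsto_nhdsWithin_iff.2 ⟨?_, ?_⟩
    · exact ((continuous_mul_const c).tendsto' 0 0 (zero_mul c)).mono_left nhdsWithin_le_nhds
    · filter_upwards [self_mem_nhdsWithin] with ε hε using mul_pos hε hc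
  filter_upwards [this.eventually hu] with ε hε
  rwa [smul_smul]

theorem zero_mem_feasible {P : Set E} {x : E} (hx : x ∈ P) : (0 : E) ∈ feasible x P :=
  mem_feasible.2 <| Eventually.of_forall fun ε => by simpa using hx

theorem convex_feasible {P : Set E} (hP : Convex ℝ P) (x : E) : Convex ℝ (feasible x P) := by
  intro u hu v hv a b ha hb hab
  filter_upwards [mem_feasible.1 hu, mem_feasible.1 hv] with ε h1 h2
  have := hP h1 h2 ha hb hab
  convert this using 1
  rw [show b = 1 - a by linarith]
  module

theorem add_mem_feasible {P : Set E} (hP : Convex ℝ P) {x u v : E} (hu : u ∈ feasible x P)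
    (hv : v ∈ feasible x P) : u + v ∈ feasible x P := by
  have := smul_mem_feasible (two_pos : (0 : ℝ) < 2)
    (convex_feasible hP x hu hv (a := 1 / 2) (b := 1 / 2) (by norm_num) (by norm_num) (by norm_num))
  convert this using 1
  module

theorem sub_mem_feasible {P : Set E} (hP : Convex ℝ P) {x y : E} (hx : x ∈ P) (hy : y ∈ P) :
    y - x ∈ feasible x P := mem_feasible_of_mem hP hx one_pos (by simpa using hy)

theorem mem_vectorSpan_of_feasible {P : Set E} {x u : E} (hx : x ∈ P) (hu : u ∈ feasible x P) :
    u ∈ vectorSpan ℝ P := by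
  obtain ⟨δ, h1, h2⟩ := ((mem_feasible.1 hu).and self_mem_nhdsWithin).exists
  have := vsub_mem_vectorSpan ℝ h1 hx
  rw [vsub_eq_sub, add_sub_cancel_left] at this
  simpa [smul_smul, inv_mul_cancel₀ (ne_of_gt h2)] using (vectorSpan ℝ P).smul_mem δ⁻¹ this

/-- For x in P, convexity makes the admissible ε an interval starting at 0, so either all small ε
work or no positive one does. For x outside P, closedness excludes all small ε. -/
theorem eventually_mem_iff_feasible {E : Type*} [NormedAddCommGroup E] [NormedSpace ℝ E]
    {P : Set E} (hP : Convex ℝ P) (hc : IsClosed P) (x u : E) :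
    ∀ᶠ ε in 𝓝[>] (0 : ℝ), (x + ε • u ∈ P ↔ u ∈ feasible x P) := by
  by_cases hu : u ∈ feasible x P
  · filter_upwards [hu] with ε hε using iff_of_true hε hu
  by_cases hx : x ∈ P
  · filter_upwards [self_mem_nhdsWithin] with ε hε
    exact iff_of_false (fun h => hu (mem_feasible_of_mem hP hx hε h)) hu
  · have : Tendsto (fun ε : ℝ => x + ε • u) (𝓝[>] 0) (𝓝 x) := by
      have : Continuous fun ε : ℝ => x + ε • u := by fun_prop
      exact (this.tendsto' 0 x (by simp)).mono_left nhdsWithin_le_nhds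
    filter_upwards [this.eventually (hc.isOpen_compl.mem_nhds hx)] with ε hε
    exact iff_of_false hε hu

theorem mem_of_feasible {E : Type*} [NormedAddCommGroup E] [NormedSpace ℝ E]
    {P : Set E} (hc : IsClosed P) {x u : E} (hu : u ∈ feasible x P) : x ∈ P := by
  have : Tendsto (fun ε : ℝ => x + ε • u) (𝓝[>] 0) (𝓝 x) := by
    have : Continuous fun ε : ℝ => x + ε • u := by fun_prop
    exact (this.tendsto' 0 x (by simp)).mono_left nhdsWithin_le_nhds
  exact hc.mem_of_tendsto this hu

end Feasible

/-! ### The index of a subgroup with one varying generator -/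

section Index

/-- Since u has infinite order modulo M, pulling back along j ↦ j • u reduces the index to that of
kℤ in ℤ. For k = 0 both sides are 0, the value standing for infinite index. -/
theorem relIndex_sup_zmultiples_zsmul {A : Type*} [AddCommGroup A] {M : AddSubgroup A} {u : A}
    (hu : ∀ j : ℤ, j • u ∈ M → j = 0) (k : ℤ) :
    (M ⊔ AddSubgroup.zmultiples (k • u)).relIndex (M ⊔ AddSubgroup.zmultiples u) = k.natAbs := by
  have hle : AddSubgroup.zmultiples (k • u) ≤ AddSubgroup.zmultiples u := by
    rw [AddSubgroup.zmultiples_le]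
    exact ⟨k, rfl⟩
  have e1 : M ⊔ AddSubgroup.zmultiples u =
      AddSubgroup.zmultiples u ⊔ (M ⊔ AddSubgroup.zmultiples (k • u)) := by
    rw [sup_comm M, sup_comm M, ← sup_assoc, sup_eq_left.2 hle]
  have e2 : AddSubgroup.zmultiples u = AddSubgroup.map (zmultiplesHom A u) ⊤ := by
    rw [← AddMonoidHom.range_eq_map]
    rfl
  have e3 : (M ⊔ AddSubgroup.zmultiples (k • u)).comap (zmultiplesHom A u) =
      AddSubgroup.zmultiples k := by
    ext j
    rw [AddSubgroup.mem_comap, AddSubgroup.mem_sup, Int.mem_zmultiples_iff]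
    constructor
    · rintro ⟨m, hm, _, ⟨a, rfl⟩, h⟩
      have : (j - a * k) • u ∈ M := by
        rw [sub_smul, mul_smul]
        simp only [zmultiplesHom_apply] at h
        rw [← h]
        simpa using hm
      exact ⟨a, by linarith [hu _ this]⟩
    · rintro ⟨a, rfl⟩
      refine ⟨0, M.zero_mem, _, ⟨a, rfl⟩, ?_⟩
      simp only [zmultiplesHom_apply, zero_add, smul_smul, mul_comm]
  rw [e1, AddSubgroup.relIndex_sup_right]
  conv_lhs => rw [e2]
  rw [← e2, e2, ← AddSubgroup.relIndex_comap, e3, AddSubgroup.relIndex_top_right,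
    Int.index_zmultiples]

theorem relIndex_nsmul_mem {A : Type*} [AddCommGroup A] (H K : AddSubgroup A) {x : A} (hx : x ∈ K) :
    H.relIndex K • x ∈ H := by
  have := (H.addSubgroupOf K).nsmul_index_mem ⟨x, hx⟩
  exact AddSubgroup.mem_addSubgroupOf.1 this

variable {F : Type*} [AddCommGroup F] [Module ℝ F]

theorem span_eq_top_of_relIndex_ne_zero {H Λ : AddSubgroup F}
    (hΛ : Submodule.span ℝ (Λ : Set F) = ⊤) (h : H.relIndex Λ ≠ 0) :
    Submodule.span ℝ (H : Set F) = ⊤ := by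
  rw [eq_top_iff, ← hΛ, Submodule.span_le]
  intro x hx
  have := Submodule.subset_span (R := ℝ) (relIndex_nsmul_mem H Λ hx)
  rw [← Nat.cast_smul_eq_nsmul ℝ] at this
  simpa [smul_smul, h] using Submodule.smul_mem _ ((H.relIndex Λ : ℝ)⁻¹) this

theorem linearMap_zero_on_span {M : Set F} {D : F →ₗ[ℝ] ℝ} (h : ∀ x ∈ M, D x = 0) {x : F}
    (hx : x ∈ Submodule.span ℝ M) : D x = 0 := by
  have : Submodule.span ℝ M ≤ LinearMap.ker D := Submodule.span_le.2 h
  exact this hx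

/-- As a function of `u ∈ Λ`, the index of `M + ℤ u` in `Λ` is the absolute value of a linear
functional. -/
theorem exists_linear_relIndex {Λ M : AddSubgroup F} (hΛ : Submodule.span ℝ (Λ : Set F) = ⊤)
    (hM : Submodule.span ℝ (M : Set F) ≠ ⊤) (hMΛ : M ≤ Λ) :
    ∃ D : F →ₗ[ℝ] ℝ, (∀ x ∈ M, D x = 0) ∧
      ∀ u ∈ Λ, ((M ⊔ AddSubgroup.zmultiples u).relIndex Λ : ℝ) = |D u| := by
  by_cases h0 : ∀ u ∈ Λ, (M ⊔ AddSubgroup.zmultiples u).relIndex Λ = 0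
  · exact ⟨0, by simp, fun u hu => by simp [h0 u hu]⟩
  push Not at h0
  obtain ⟨u₀, hu₀, hr⟩ := h0
  set r := (M ⊔ AddSubgroup.zmultiples u₀).relIndex Λ with hr_def
  have hr' : (0 : ℝ) < r := by exact_mod_cast Nat.pos_of_ne_zero hr
  have hspan := span_eq_top_of_relIndex_ne_zero hΛ hr
  have hu₀M : u₀ ∉ Submodule.span ℝ (M : Set F) := by
    intro h
    refine hM ?_
    rw [eq_top_iff, ← hspan, Submodule.span_le]
    have : M ⊔ AddSubgroup.zmultiples u₀ ≤ (Submodule.span ℝ (M : Set F)).toAddSubgroup :=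
      sup_le Submodule.subset_span (by rw [AddSubgroup.zmultiples_le]; exact h)
    exact this
  -- `D` is the multiple of `g` normalized by D u₀ = r; a relation r • u = m + a • u₀ with m in M
  -- then gives D u = a.
  obtain ⟨g, hg, hgM⟩ := Submodule.exists_le_ker_of_notMem hu₀M
  have hD0 : ∀ x ∈ M, ((r / g u₀) • g) x = 0 := fun x hx => by
    have : g x = 0 := hgM (Submodule.subset_span hx)
    simp [this]
  refine ⟨((r : ℝ) / g u₀) • g, hD0, fun u hu => ?_⟩
  set D : F →ₗ[ℝ] ℝ := ((r : ℝ) / g u₀) • g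
  have hDu₀ : D u₀ = r := by simp [D, hg]
  obtain ⟨m, hm, _, ⟨a, rfl⟩, h⟩ := AddSubgroup.mem_sup.1
    (relIndex_nsmul_mem (M ⊔ AddSubgroup.zmultiples u₀) Λ hu)
  rw [← hr_def] at h
  have hDu : (r : ℝ) * D u = a * r := by
    have := congrArg D h
    simp only [map_add, map_nsmul, hD0 m hm, zero_add, map_zsmul, hDu₀] at this
    simpa using this.symm
  have hDu' : D u = a := by
    have := mul_left_cancel₀ hr'.ne' (hDu.trans (mul_comm _ _))
    exact this
  -- If a = 0, then `D` kills M + ℤu, so this group does not span and its index is infinite,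
  -- recorded as 0. Otherwise the index of M + ℤ(r • u) = M + ℤ(a • u₀) in Λ is computed through M +
  -- ℤu and through M + ℤu₀.
  by_cases ha : a = 0
  · have : (M ⊔ AddSubgroup.zmultiples u).relIndex Λ = 0 := by
      by_contra hne
      have hs := span_eq_top_of_relIndex_ne_zero hΛ hne
      have : D u₀ = 0 := by
        refine linearMap_zero_on_span (M := (M ⊔ AddSubgroup.zmultiples u : AddSubgroup F)) ?_
          (hs ▸ Submodule.mem_top)
        intro x hx
        obtain ⟨m', hm', _, ⟨b, rfl⟩, rfl⟩ := AddSubgroup.mem_sup.1 hx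
        simp [hD0 m' hm', hDu', ha]
      exact hr'.ne' (hDu₀ ▸ this)
    simp [this, hDu', ha]
  · have hnu : ∀ j : ℤ, j • u ∈ M → j = 0 := fun j hj => by
      have := hD0 _ hj
      rw [map_zsmul, hDu', zsmul_eq_mul] at this
      have h2 := mul_eq_zero.1 this
      simpa [ha] using h2
    have hnu₀ : ∀ j : ℤ, j • u₀ ∈ M → j = 0 := fun j hj => by
      have := hD0 _ hj
      rw [map_zsmul, hDu₀, zsmul_eq_mul] at this
      have h2 := mul_eq_zero.1 this
      simpa [hr] using h2
    have e : M ⊔ AddSubgroup.zmultiples ((r : ℤ) • u) = M ⊔ AddSubgroup.zmultiples (a • u₀) := by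
      have h' : (r : ℤ) • u = m + a • u₀ := by simpa using h.symm
      refine le_antisymm (sup_le le_sup_left ?_) (sup_le le_sup_left ?_)
      · rw [AddSubgroup.zmultiples_le, h']
        exact add_mem (AddSubgroup.mem_sup_left hm)
          (AddSubgroup.mem_sup_right (AddSubgroup.mem_zmultiples _))
      · rw [AddSubgroup.zmultiples_le, show a • u₀ = (r : ℤ) • u - m by rw [h']; abel]
        exact sub_mem (AddSubgroup.mem_sup_right (AddSubgroup.mem_zmultiples _))
          (AddSubgroup.mem_sup_left hm)
    have i1 := relIndex_sup_zmultiples_zsmul hnu r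
    have i2 := relIndex_sup_zmultiples_zsmul hnu₀ a
    have le1 : ∀ (v : F) (k : ℤ), M ⊔ AddSubgroup.zmultiples (k • v) ≤
        M ⊔ AddSubgroup.zmultiples v := fun v k =>
      sup_le_sup_left (by rw [AddSubgroup.zmultiples_le]; exact ⟨k, rfl⟩) _
    have le2 : ∀ v ∈ Λ, M ⊔ AddSubgroup.zmultiples v ≤ Λ := fun v hv =>
      sup_le hMΛ (by rwa [AddSubgroup.zmultiples_le])
    have j1 := AddSubgroup.relIndex_mul_relIndex _ _ _ (le1 u r) (le2 u hu)
    have j2 := AddSubgroup.relIndex_mul_relIndex _ _ _ (le1 u₀ a) (le2 u₀ hu₀)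
    rw [i1] at j1
    rw [i2, ← e, ← j1, ← hr_def] at j2
    have j3 : (M ⊔ AddSubgroup.zmultiples u).relIndex Λ = a.natAbs := by
      have : r * a.natAbs = r * (M ⊔ AddSubgroup.zmultiples u).relIndex Λ := by
        rw [mul_comm, j2]; simp
      exact (Nat.eq_of_mul_eq_mul_left (Nat.pos_of_ne_zero hr) this).symm
    rw [j3, hDu', Nat.cast_natAbs, Int.cast_abs]

end Index

section

/-! ### Balanced families of cones and the degree of their push-forwards -/

open Classical in
/-- `p` lies in the relative interior of exactly one member of the family. -/
def IsInteriorPoint {ι E : Type*} [AddCommGroup E] [Module ℝ E] (I : Finset ι) (C : ι → Set E)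
    (N : ι → AddSubgroup E) (p : E) : Prop :=
  ∃ i ∈ I, p ∈ C i ∧ (∀ j ∈ I, p ∈ C j → j = i) ∧
    ∀ x ∈ Submodule.span ℝ (N i : Set E), x ∈ feasible p (C i)

open Classical in
/-- Near `p`, the members of the family through `p` are half-spaces `span M + ℝ≥0 u i`, balanced
along `span M`. -/
structure IsWallPoint {ι E : Type*} [AddCommGroup E] [Module ℝ E] (I : Finset ι) (C : ι → Set E)
    (N : ι → AddSubgroup E) (m : ι → ℝ) (p : E) (M : AddSubgroup E) (u : ι → E) : Prop where
  mem_span : p ∈ Submodule.span ℝ (M : Set E)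
  sup_eq : ∀ i ∈ I, p ∈ C i → M ⊔ AddSubgroup.zmultiples (u i) = N i
  feasible_pos : ∀ i ∈ I, p ∈ C i → ∀ x ∈ Submodule.span ℝ (M : Set E), ∀ c : ℝ, 0 < c →
    x + c • u i ∈ feasible p (C i)
  feasible_neg : ∀ i ∈ I, p ∈ C i → ∀ x ∈ Submodule.span ℝ (M : Set E), ∀ c : ℝ, c < 0 →
    x + c • u i ∉ feasible p (C i)
  balanced : ∑ i ∈ I.filter (fun i => p ∈ C i), m i • u i ∈ Submodule.span ℝ (M : Set E)

/-- A finite family of `d`-dimensional closed convex sets with multiplicities, satisfying the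
balancing condition outside of finitely many subspaces of dimension less than `d - 1`. -/
structure BalancedFamily (ι E : Type*) [NormedAddCommGroup E] [NormedSpace ℝ E] where
  I : Finset ι
  C : ι → Set E
  N : ι → AddSubgroup E
  m : ι → ℝ
  d : ℕ
  walls : Set (Submodule ℝ E)
  bad : Set (Submodule ℝ E)
  walls_finite : walls.Finite
  bad_finite : bad.Finite
  closed : ∀ i ∈ I, IsClosed (C i)
  convex : ∀ i ∈ I, Convex ℝ (C i)
  subset_span : ∀ i ∈ I, C i ⊆ Submodule.span ℝ (N i : Set E)
  finrank_span : ∀ i ∈ I, finrank ℝ (Submodule.span ℝ (N i : Set E)) = d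
  finrank_walls : ∀ K ∈ walls, finrank ℝ K + 1 ≤ d
  finrank_bad : ∀ B ∈ bad, finrank ℝ B + 2 ≤ d
  point : ∀ p : E, (∀ B ∈ bad, p ∉ B) → (∃ i ∈ I, p ∈ C i) → IsInteriorPoint I C N p ∨
    ∃ (M : AddSubgroup E) (u : ι → E), Submodule.span ℝ (M : Set E) ∈ walls ∧ IsWallPoint I C N m p M u

namespace BalancedFamily

variable {ι E F : Type*} [NormedAddCommGroup E] [NormedSpace ℝ E]
  [NormedAddCommGroup F] [NormedSpace ℝ F]

open Classical in
/-- The degree at `f` of the push-forward by `π`, with weights `w`. -/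
noncomputable def degree (B : BalancedFamily ι E) (π : E →ₗ[ℝ] F) (w : ι → ℝ) (f : F) : ℝ :=
  ∑ i ∈ B.I, if f ∈ π '' B.C i then w i else 0

-- When w i ≠ 0, π is injective on the span of N i, so the only possible preimage of f + t • b there
-- is P i + t • Q i. For small t its membership in C i is decided by the tangent cone at P i.
open Classical in
theorem eventually_degree_line (B : BalancedFamily ι E) (π : E →ₗ[ℝ] F) (w : ι → ℝ)
    (hinj : ∀ i ∈ B.I, w i ≠ 0 → ∀ x ∈ Submodule.span ℝ (B.N i : Set E), π x = 0 → x = 0)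
    {f b : F} {P Q : ι → E}
    (hP : ∀ i ∈ B.I, w i ≠ 0 → P i ∈ Submodule.span ℝ (B.N i : Set E) ∧ π (P i) = f)
    (hQ : ∀ i ∈ B.I, w i ≠ 0 → Q i ∈ Submodule.span ℝ (B.N i : Set E) ∧ π (Q i) = b) :
    ∀ᶠ t in 𝓝[>] (0 : ℝ), B.degree π w (f + t • b) =
      ∑ i ∈ B.I, if Q i ∈ feasible (P i) (B.C i) then w i else 0 := by
  have h : ∀ᶠ t in 𝓝[>] (0 : ℝ), ∀ i ∈ B.I,
      (P i + t • Q i ∈ B.C i ↔ Q i ∈ feasible (P i) (B.C i)) :=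
    (eventually_all_finset _).2 fun i hi =>
      eventually_mem_iff_feasible (B.convex i hi) (B.closed i hi) _ _
  filter_upwards [h] with t ht
  refine Finset.sum_congr rfl fun i hi => ?_
  by_cases hw : w i = 0
  · simp [hw]
  rw [← ht i hi]
  congr 1
  refine propext ⟨?_, fun h => ⟨_, h, by simp [(hP i hi hw).2, (hQ i hi hw).2]⟩⟩
  rintro ⟨x, hx, hxf⟩
  have : P i + t • Q i - x = 0 := by
    refine hinj i hi hw _ (Submodule.sub_mem _ (Submodule.add_mem _ (hP i hi hw).1
      (Submodule.smul_mem _ _ (hQ i hi hw).1)) (B.subset_span i hi hx)) ?_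
    simp [(hP i hi hw).2, (hQ i hi hw).2, hxf]
  rwa [sub_eq_zero.1 this]

-- Members are grouped by their lift p = P i of f. If p is interior to a single member, both
-- directions are feasible and nothing jumps. If p is on a wall, the weights are m i * |D (π (u
-- i))|, and the side of the wall on which the member lies supplies the sign that removes the
-- absolute value. The jump over p is therefore sign(D b) times D ∘ π of the balancing sum, which is
-- zero.
open Classical in
theorem sum_jump_eq_zero (B : BalancedFamily ι E) (π : E →ₗ[ℝ] F) (w : ι → ℝ)
    (hinj : ∀ i ∈ B.I, w i ≠ 0 → ∀ x ∈ Submodule.span ℝ (B.N i : Set E), π x = 0 → x = 0)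
    (hD : ∀ (p : E) (M : AddSubgroup E) (u : ι → E), Submodule.span ℝ (M : Set E) ∈ B.walls → IsWallPoint B.I B.C B.N B.m p M u →
      (∃ i ∈ B.I, p ∈ B.C i) → ∃ D : F →ₗ[ℝ] ℝ, (∀ x ∈ Submodule.span ℝ (M : Set E), D (π x) = 0) ∧
        ∀ i ∈ B.I, p ∈ B.C i → w i = B.m i * |D (π (u i))|)
    {f b : F} (hf : ∀ S ∈ B.bad, f ∉ S.map π) (hb : ∀ K ∈ B.walls, f ∈ K.map π → b ∉ K.map π)
    {P Q : ι → E}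
    (hP : ∀ i ∈ B.I, w i ≠ 0 → P i ∈ Submodule.span ℝ (B.N i : Set E) ∧ π (P i) = f)
    (hQ : ∀ i ∈ B.I, w i ≠ 0 → Q i ∈ Submodule.span ℝ (B.N i : Set E) ∧ π (Q i) = b) :
    ∑ i ∈ B.I, ((if Q i ∈ feasible (P i) (B.C i) then w i else 0) -
      if -Q i ∈ feasible (P i) (B.C i) then w i else 0) = 0 := by
  set T : ι → ℝ := fun i => (if Q i ∈ feasible (P i) (B.C i) then w i else 0) -
      if -Q i ∈ feasible (P i) (B.C i) then w i else 0 with hT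
  have hT0 : ∀ i, w i = 0 → T i = 0 := fun i h => by simp [hT, h]
  have hTn : ∀ i ∈ B.I, P i ∉ B.C i → T i = 0 := fun i hi h => by
    have h1 : ∀ q, q ∉ feasible (P i) (B.C i) := fun q hq => h (mem_of_feasible (B.closed i hi) hq)
    simp [hT, h1]
  have e1 : ∑ i ∈ B.I, T i = ∑ i ∈ B.I.filter (fun i => w i ≠ 0), T i := by
    rw [Finset.sum_filter]
    refine Finset.sum_congr rfl fun i _ => ?_
    by_cases h : w i = 0 <;> simp [h, hT0]
  rw [e1, ← Finset.sum_fiberwise_of_maps_to (g := P) (t := (B.I.filter fun i => w i ≠ 0).image P)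
    (fun i hi => Finset.mem_image_of_mem _ hi)]
  refine Finset.sum_eq_zero fun p _ => ?_
  by_cases hp : ∃ i ∈ B.I, w i ≠ 0 ∧ P i = p ∧ p ∈ B.C i
  swap
  · refine Finset.sum_eq_zero fun i hi => ?_
    simp only [Finset.mem_filter] at hi
    exact hTn i hi.1.1 fun h => hp ⟨i, hi.1.1, hi.1.2, hi.2, hi.2 ▸ h⟩
  obtain ⟨i₀, hi₀, hw₀, hP₀, hC₀⟩ := hp
  have hpf : π p = f := by rw [← hP₀]; exact (hP i₀ hi₀ hw₀).2
  have hpbad : ∀ S ∈ B.bad, p ∉ S := fun S hS hpS => hf S hS ⟨p, hpS, hpf⟩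
  rcases B.point p hpbad ⟨i₀, hi₀, hC₀⟩ with ⟨k, hk, hpk, huniq, hfeas⟩ | ⟨M, u, hM, hwall⟩
  · refine Finset.sum_eq_zero fun i hi => ?_
    simp only [Finset.mem_filter] at hi
    obtain ⟨⟨hi, hw⟩, rfl⟩ := hi
    by_cases h : P i ∈ B.C i
    · obtain rfl := huniq i hi h
      have h1 := hfeas _ (hQ i hi hw).1
      have h2 := hfeas _ (Submodule.neg_mem _ (hQ i hi hw).1)
      simp [hT, h1, h2]
    · exact hTn i hi h
  · obtain ⟨D, hDM, hDw⟩ := hD p M u hM hwall ⟨i₀, hi₀, hC₀⟩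
    have hfM : f ∈ (Submodule.span ℝ (M : Set E)).map π := ⟨p, hwall.mem_span, hpf⟩
    have hbM := hb _ hM hfM
    set s : ℝ := (SignType.sign (D b) : ℝ) with hs
    -- Decompose Q i = κ + c • u i along the wall. Then D b = c * D (π (u i)), and c ≠ 0 because b
    -- is not in the image of the wall; the sign of c tells which of Q i and −Q i is feasible.
    have key : ∀ i ∈ B.I, p ∈ B.C i → w i ≠ 0 → P i = p → T i = B.m i * D (π (u i)) * s := by
      intro i hi hpi hw hPi
      have hQi := (hQ i hi hw).1
      obtain ⟨κ, hκ, c, hc⟩ : ∃ κ ∈ Submodule.span ℝ (M : Set E), ∃ c : ℝ, κ + c • u i = Q i := by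
        have : Submodule.span ℝ (B.N i : Set E) ≤ Submodule.span ℝ (M : Set E) ⊔
            Submodule.span ℝ {u i} := by
          rw [← hwall.sup_eq i hi hpi, Submodule.span_le]
          intro x hx
          obtain ⟨m, hm, _, ⟨a, rfl⟩, rfl⟩ := AddSubgroup.mem_sup.1 hx
          refine Submodule.add_mem _ (Submodule.mem_sup_left (Submodule.subset_span hm))
            (Submodule.mem_sup_right ?_)
          exact zsmul_mem (Submodule.mem_span_singleton_self _) a
        obtain ⟨κ, hκ, y, hy, e⟩ := Submodule.mem_sup.1 (this hQi)
        obtain ⟨c, rfl⟩ := Submodule.mem_span_singleton.1 hy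
        exact ⟨κ, hκ, c, e⟩
      have hDb : D b = c * D (π (u i)) := by
        rw [← (hQ i hi hw).2, ← hc]
        simp [hDM κ hκ]
      have hDu : D (π (u i)) ≠ 0 := by
        intro h
        exact hw (by rw [hDw i hi hpi, h]; simp)
      have hneg : -Q i = -κ + (-c) • u i := by rw [← hc]; module
      rcases lt_trichotomy c 0 with h | h | h
      · have h1 : Q i ∉ feasible (P i) (B.C i) := by
          rw [hPi, ← hc]; exact hwall.feasible_neg i hi hpi κ hκ c h
        have h2 : -Q i ∈ feasible (P i) (B.C i) := by
          rw [hPi, hneg]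
          exact hwall.feasible_pos i hi hpi _ (Submodule.neg_mem _ hκ) _ (neg_pos.2 h)
        simp only [hT, h1, h2, if_true, if_false, zero_sub, hDw i hi hpi, hs, hDb, sign_mul,
          sign_neg h]
        rcases lt_or_gt_of_ne hDu with h' | h'
        · simp [sign_neg h', abs_of_neg h']
        · simp [sign_pos h', abs_of_pos h']
      · refine absurd ⟨Q i, ?_, (hQ i hi hw).2⟩ hbM
        rw [← hc, h]
        simpa using hκ
      · have h1 : Q i ∈ feasible (P i) (B.C i) := by
          rw [hPi, ← hc]; exact hwall.feasible_pos i hi hpi κ hκ c h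
        have h2 : -Q i ∉ feasible (P i) (B.C i) := by
          rw [hPi, hneg]
          exact hwall.feasible_neg i hi hpi _ (Submodule.neg_mem _ hκ) _ (neg_neg_iff_pos.2 h)
        simp only [hT, h1, h2, if_true, if_false, sub_zero, hDw i hi hpi, hs, hDb, sign_mul,
          sign_pos h]
        rcases lt_or_gt_of_ne hDu with h' | h'
        · simp [sign_neg h', abs_of_neg h']
        · simp [sign_pos h', abs_of_pos h']
    have e2 : ∑ i ∈ (B.I.filter fun i => w i ≠ 0) with P i = p, T i =
        ∑ i ∈ B.I.filter (fun i => p ∈ B.C i), B.m i * D (π (u i)) * s := by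
      rw [Finset.filter_filter, Finset.sum_filter, Finset.sum_filter]
      refine Finset.sum_congr rfl fun i hi => ?_
      by_cases hpi : p ∈ B.C i
      -- If w i = 0, then m i = 0 or D (π (u i)) = 0, so including this member in the balancing sum
      -- changes nothing.
      · by_cases hw : w i = 0
        · have h0 := hDw i hi hpi
          rw [hw, eq_comm, mul_eq_zero, abs_eq_zero] at h0
          rcases h0 with h0 | h0 <;> simp [hw, h0]
        · have hPi : P i = p := by
            rw [← sub_eq_zero]
            refine hinj i hi hw _ (Submodule.sub_mem _ (hP i hi hw).1
              (B.subset_span i hi hpi)) ?_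
            simp [(hP i hi hw).2, hpf]
          rw [if_pos ⟨hw, hPi⟩, if_pos hpi, key i hi hpi hw hPi]
      · rw [if_neg hpi]
        split_ifs with h
        · exact hTn i hi (h.2 ▸ hpi)
        · rfl
    rw [e2, ← Finset.sum_mul]
    have := hDM _ hwall.balanced
    simp only [map_sum, map_smul, smul_eq_mul] at this
    rw [this, zero_mul]

end BalancedFamily

end

/-! ### Generic constancy of the degree -/

section

/-- The value `c t₀` is read off from φ near t₀ but not at t₀, so φ may take other values on the
walls. The function `c` is still locally constant, and ℝ is connected. -/
theorem eq_of_eventually_punctured {φ c : ℝ → ℝ}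
    (h : ∀ t₀, ∀ᶠ t in 𝓝[≠] t₀, φ t = c t₀) (s t : ℝ) : c s = c t := by
  have : IsLocallyConstant c := by
    rw [IsLocallyConstant.iff_eventually_eq]
    intro t₀
    have h1 := eventually_eventually_nhdsWithin.2 (h t₀)
    have h2 : ∀ᶠ t in 𝓝[≠] t₀, c t = c t₀ := by
      filter_upwards [h1, self_mem_nhdsWithin] with t ht htn
      rw [(isOpen_compl_singleton (x := t₀)).nhdsWithin_eq htn] at ht
      obtain ⟨r, hr1, hr2⟩ := ((h t).and (ht.filter_mono nhdsWithin_le_nhds)).exists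
      exact hr1.symm.trans hr2
    rw [eventually_nhdsWithin_iff] at h2
    filter_upwards [h2] with t ht
    by_cases e : t = t₀
    · rw [e]
    · exact ht e
  exact this.apply_eq_of_preconnectedSpace s t

namespace BalancedFamily

variable {ι E F : Type*} [NormedAddCommGroup E] [NormedSpace ℝ E] [FiniteDimensional ℝ E]
  [NormedAddCommGroup F] [NormedSpace ℝ F]

-- Two generic points are joined by a line that misses the images of the bad subspaces and lies in
-- no image of a wall. By `sum_jump_eq_zero` the degree has equal one-sided limits at every point of
-- that line, hence is the same at both ends.
open Classical in
theorem exists_degree_eq_of_injective (B : BalancedFamily ι E) (π : E →ₗ[ℝ] F) (w : ι → ℝ)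
    (hd : B.d = finrank ℝ F)
    (hsurj : ∀ i ∈ B.I, w i ≠ 0 → ∀ f, ∃ x ∈ Submodule.span ℝ (B.N i : Set E), π x = f)
    (hinj : ∀ i ∈ B.I, w i ≠ 0 → ∀ x ∈ Submodule.span ℝ (B.N i : Set E), π x = 0 → x = 0)
    (hD : ∀ (p : E) (M : AddSubgroup E) (u : ι → E), Submodule.span ℝ (M : Set E) ∈ B.walls →
      IsWallPoint B.I B.C B.N B.m p M u → (∃ i ∈ B.I, p ∈ B.C i) → ∃ D : F →ₗ[ℝ] ℝ,
        (∀ x ∈ Submodule.span ℝ (M : Set E), D (π x) = 0) ∧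
          ∀ i ∈ B.I, p ∈ B.C i → w i = B.m i * |D (π (u i))|) :
    ∃ c, ∀ᶠ f in generic F, B.degree π w f = c := by
  have hlift : ∀ f, ∃ P : ι → E, ∀ i ∈ B.I, w i ≠ 0 →
      P i ∈ Submodule.span ℝ (B.N i : Set E) ∧ π (P i) = f := by
    intro f
    have : ∀ i, ∃ x, i ∈ B.I → w i ≠ 0 → x ∈ Submodule.span ℝ (B.N i : Set E) ∧ π x = f := by
      intro i
      by_cases hi : i ∈ B.I ∧ w i ≠ 0
      · obtain ⟨x, hx, hf⟩ := hsurj i hi.1 hi.2 f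
        exact ⟨x, fun _ _ => ⟨hx, hf⟩⟩
      · exact ⟨0, fun h1 h2 => absurd ⟨h1, h2⟩ hi⟩
    choose P hP using this
    exact ⟨P, hP⟩
  have hmap : ∀ S : Submodule ℝ E, finrank ℝ (S.map π) ≤ finrank ℝ S := fun S =>
    Submodule.finrank_map_le π S
  have htop : ∀ S : Submodule ℝ F, finrank ℝ S + 1 ≤ finrank ℝ F → S ≠ ⊤ := by
    rintro S hS rfl
    rw [finrank_top] at hS
    omega
  -- the degree on both sides of a point, in a given direction
  have hside : ∀ f b, (∀ S ∈ B.bad, f ∉ S.map π) → (∀ K ∈ B.walls, f ∈ K.map π → b ∉ K.map π) →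
      ∃ c, (∀ᶠ t in 𝓝[>] (0 : ℝ), B.degree π w (f + t • b) = c) ∧
        (∀ᶠ t in 𝓝[>] (0 : ℝ), B.degree π w (f + t • -b) = c) ∧
        ((∀ K ∈ B.walls, f ∉ K.map π) → B.degree π w f = c) := by
    intro f b hf hb
    obtain ⟨P, hP⟩ := hlift f
    obtain ⟨Q, hQ⟩ := hlift b
    have hQ' : ∀ i ∈ B.I, w i ≠ 0 → (-Q) i ∈ Submodule.span ℝ (B.N i : Set E) ∧ π ((-Q) i) = -b :=
      fun i hi hw => ⟨Submodule.neg_mem _ (hQ i hi hw).1, by simp [(hQ i hi hw).2]⟩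
    have hj := B.sum_jump_eq_zero π w hinj hD hf hb hP hQ
    rw [Finset.sum_sub_distrib, sub_eq_zero] at hj
    refine ⟨_, B.eventually_degree_line π w hinj hP hQ, ?_, fun hK => ?_⟩
    · rw [hj]
      exact B.eventually_degree_line π w hinj hP hQ'
    · refine Finset.sum_congr rfl fun i hi => ?_
      by_cases hw : w i = 0
      · simp [hw]
      have hPi := hP i hi hw
      have h1 : f ∈ π '' B.C i ↔ P i ∈ B.C i := by
        refine ⟨?_, fun h => ⟨_, h, hPi.2⟩⟩
        rintro ⟨x, hx, hxf⟩
        have : P i - x = 0 := hinj i hi hw _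
          (Submodule.sub_mem _ hPi.1 (B.subset_span i hi hx)) (by simp [hPi.2, hxf])
        rwa [sub_eq_zero.1 this]
      have h2 : P i ∈ B.C i ↔ Q i ∈ feasible (P i) (B.C i) := by
        refine ⟨fun h => ?_, mem_of_feasible (B.closed i hi)⟩
        rcases B.point (P i) (fun S hS hp => hf S hS ⟨_, hp, hPi.2⟩) ⟨i, hi, h⟩ with
          ⟨k, hk, hpk, huniq, hfeas⟩ | ⟨M, u, hM, hwall⟩
        · obtain rfl := huniq i hi h
          exact hfeas _ (hQ i hi hw).1
        · exact absurd ⟨_, hwall.mem_span, hPi.2⟩ (hK _ hM)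
      rw [h1, h2]
  have hU : ∀ᶠ f in generic F, (∀ S ∈ B.bad, f ∉ S.map π) ∧ ∀ K ∈ B.walls, f ∉ K.map π := by
    refine ((eventually_all_finite B.bad_finite).2 fun S hS => ?_).and
      ((eventually_all_finite B.walls_finite).2 fun K hK => ?_)
    · refine eventually_notMem (htop _ ?_)
      have := hmap S
      have := B.finrank_bad S hS
      omega
    · refine eventually_notMem (htop _ ?_)
      have := hmap K
      have := B.finrank_walls K hK
      omega
  obtain ⟨f₀, hf₀b, hf₀w⟩ := hU.exists
  -- The image of a bad subspace has codimension at least 2 in F, so adjoining f₀ leaves it proper.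
  -- If f is outside this sum and f₀ outside the image, the whole line through f₀ and f misses the
  -- image.
  have hU' : ∀ᶠ f in generic F, ∀ S ∈ B.bad, f ∉ S.map π ⊔ Submodule.span ℝ {f₀} := by
    refine (eventually_all_finite B.bad_finite).2 fun S hS => eventually_notMem (htop _ ?_)
    have h1 := hmap S
    have h2 := B.finrank_bad S hS
    have h3 := Submodule.finrank_add_le_finrank_add_finrank (S.map π) (Submodule.span ℝ {f₀})
    have h4 := finrank_span_le_card (R := ℝ) ({f₀} : Set F)
    simp only [Set.toFinset_singleton, Finset.card_singleton] at h4
    omega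
  refine ⟨B.degree π w f₀, ?_⟩
  filter_upwards [hU, hU'] with f hf hf'
  have hline : ∀ t₀ : ℝ, ∃ c, (∀ᶠ t in 𝓝[≠] t₀, B.degree π w (f₀ + t • (f - f₀)) = c) ∧
      ((∀ K ∈ B.walls, f₀ + t₀ • (f - f₀) ∉ K.map π) →
        B.degree π w (f₀ + t₀ • (f - f₀)) = c) := by
    intro t₀
    obtain ⟨c, h1, h2, h3⟩ := hside (f₀ + t₀ • (f - f₀)) (f - f₀) (by
      intro S hS h
      by_cases ht : t₀ = 0
      · exact hf₀b S hS (by simpa [ht] using h)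
      · refine hf' S hS ?_
        have h5 : t₀⁻¹ • (f₀ + t₀ • (f - f₀)) + (1 - t₀⁻¹) • f₀ = f := by
          match_scalars <;> field_simp; ring
        rw [← h5]
        exact Submodule.add_mem _ (Submodule.mem_sup_left (Submodule.smul_mem _ _ h))
          (Submodule.mem_sup_right (Submodule.smul_mem _ _ (Submodule.mem_span_singleton_self _))))
      (by
        intro K hK h h'
        refine hf₀w K hK ?_
        simpa using Submodule.sub_mem _ h (Submodule.smul_mem _ t₀ h'))
    refine ⟨c, ?_, h3⟩
    rw [← nhdsLT_sup_nhdsGT, eventually_sup]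
    constructor
    · have : Tendsto (fun t : ℝ => t₀ - t) (𝓝[<] t₀) (𝓝[>] 0) := by
        refine tendsto_nhdsWithin_iff.2 ⟨?_, ?_⟩
        · exact ((continuous_const.sub continuous_id).tendsto' t₀ 0 (by simp)).mono_left
            nhdsWithin_le_nhds
        · filter_upwards [self_mem_nhdsWithin] with t (ht : t < t₀) using sub_pos.2 ht
      filter_upwards [this.eventually h2] with t ht
      rw [← ht]
      congr 1
      module
    · have : Tendsto (fun t : ℝ => t - t₀) (𝓝[>] t₀) (𝓝[>] 0) := by
        refine tendsto_nhdsWithin_iff.2 ⟨?_, ?_⟩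
        · exact ((continuous_id.sub continuous_const).tendsto' t₀ 0 (by simp)).mono_left
            nhdsWithin_le_nhds
        · filter_upwards [self_mem_nhdsWithin] with t (ht : t₀ < t) using sub_pos.2 ht
      filter_upwards [this.eventually h1] with t ht
      rw [← ht]
      congr 1
      module
  choose c hc1 hc2 using hline
  have e := eq_of_eventually_punctured hc1 1 0
  rw [← hc2 1 (by simpa using hf.2), ← hc2 0 (by simpa using hf₀w)] at e
  simpa using e

variable [FiniteDimensional ℝ F]

open Classical in
/-- The push-forward of a balanced family with lineality space `G` has generically constant
degree. -/
theorem exists_degree_eq (B : BalancedFamily ι E) (π : E →ₗ[ℝ] F) (G : Submodule ℝ E)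
    (Λ : AddSubgroup F) (hΛ : Submodule.span ℝ (Λ : Set F) = ⊤)
    (hd : B.d = finrank ℝ F + finrank ℝ G) (hπG : ∀ g ∈ G, π g = 0)
    (hGN : ∀ i ∈ B.I, G ≤ Submodule.span ℝ (B.N i : Set E))
    (hGC : ∀ i ∈ B.I, ∀ x ∈ B.C i, ∀ g ∈ G, x + g ∈ B.C i)
    (hN : ∀ i ∈ B.I, (B.N i).map π.toAddMonoidHom ≤ Λ) :
    ∃ c, ∀ᶠ f in generic F,
      B.degree π (fun i => B.m i * (((B.N i).map π.toAddMonoidHom).relIndex Λ : ℝ)) f = c := by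
  set w : ι → ℝ := fun i => B.m i * (((B.N i).map π.toAddMonoidHom).relIndex Λ : ℝ) with hw
  -- A retraction q onto G turns π into (π, q) : E → F × G, whose target has dimension d, and this
  -- reduces to the injective case. Since every C i is invariant under G, the extra coordinate can
  -- be forgotten at the end.
  obtain ⟨q, hq⟩ := LinearMap.exists_leftInverse_of_injective G.subtype (Submodule.ker_subtype G)
  have hqG : ∀ g : G, q g = g := fun g => LinearMap.congr_fun hq g
  set π' : E →ₗ[ℝ] F × G := π.prod q
  have hspan : ∀ M : AddSubgroup E, Submodule.span ℝ (M.map π.toAddMonoidHom : Set F) =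
      (Submodule.span ℝ (M : Set E)).map π := fun M => by
    rw [Submodule.map_span]
    rfl
  have hsur : ∀ W : Submodule ℝ E, G ≤ W → W.map π = ⊤ → ∀ f, ∃ x ∈ W, π' x = f := by
    rintro W hGW hW ⟨f, g⟩
    obtain ⟨x, hx, rfl⟩ : f ∈ W.map π := hW ▸ Submodule.mem_top
    refine ⟨x + (g - q x : G), W.add_mem hx (hGW (g - q x).2), Prod.ext ?_ ?_⟩
    · change π _ = _
      rw [map_add, hπG _ (g - q x).2, add_zero]
    · change q _ = _
      rw [map_add, hqG]
      abel
  have hws : ∀ i ∈ B.I, w i ≠ 0 → ∀ f, ∃ x ∈ Submodule.span ℝ (B.N i : Set E), π' x = f := by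
    intro i hi hwi
    refine hsur _ (hGN i hi) ?_
    rw [← hspan]
    refine span_eq_top_of_relIndex_ne_zero hΛ fun h => hwi ?_
    simp [hw, h]
  have hfr : finrank ℝ (F × G) = B.d := by rw [finrank_prod, hd]
  have key := B.exists_degree_eq_of_injective π' w hfr.symm hws ?_ ?_
  · obtain ⟨c, hc⟩ := key
    refine ⟨c, ?_⟩
    filter_upwards [exists_of_eventually_generic_prod hc] with f ⟨g, hg⟩
    rw [← hg]
    refine Finset.sum_congr rfl fun i hi => ?_
    congr 1
    refine propext ⟨?_, ?_⟩
    · rintro ⟨x, hx, rfl⟩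
      refine ⟨x + (g - q x : G), hGC i hi x hx _ (g - q x).2, Prod.ext ?_ ?_⟩
      · change π _ = _
        rw [map_add, hπG _ (g - q x).2, add_zero]
      · change q _ = _
        rw [map_add, hqG]
        abel
    · rintro ⟨x, hx, h⟩
      exact ⟨x, hx, congrArg Prod.fst h⟩
  · intro i hi hwi x hx hx0
    have hs : Function.Surjective (π'.domRestrict (Submodule.span ℝ (B.N i : Set E))) := by
      intro f
      obtain ⟨x, hx, h⟩ := hws i hi hwi f
      exact ⟨⟨x, hx⟩, h⟩
    have hi' := (LinearMap.injective_iff_surjective_of_finrank_eq_finrank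
      (by rw [hfr, B.finrank_span i hi])).2 hs
    exact congrArg Subtype.val (@hi' ⟨x, hx⟩ 0 (by simpa using hx0))
  · rintro p M u hM hwall ⟨i₀, hi₀, hp₀⟩
    have hdec : ∀ i ∈ B.I, p ∈ B.C i → B.N i = M ⊔ AddSubgroup.zmultiples (u i) :=
      fun i hi hp => (hwall.sup_eq i hi hp).symm
    -- A vector of G is feasible together with its negative, whereas a member at a wall contains no
    -- direction with a negative coefficient on u i₀. So that coefficient vanishes.
    have hGM : G ≤ Submodule.span ℝ (M : Set E) := by
      intro g hg
      have hg' := hGN i₀ hi₀ hg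
      have : Submodule.span ℝ (B.N i₀ : Set E) ≤ Submodule.span ℝ (M : Set E) ⊔
          Submodule.span ℝ {u i₀} := by
        rw [hdec i₀ hi₀ hp₀, Submodule.span_le]
        intro x hx
        obtain ⟨m, hm, _, ⟨a, rfl⟩, rfl⟩ := AddSubgroup.mem_sup.1 hx
        exact Submodule.add_mem _ (Submodule.mem_sup_left (Submodule.subset_span hm))
          (Submodule.mem_sup_right (zsmul_mem (Submodule.mem_span_singleton_self _) a))
      obtain ⟨κ, hκ, y, hy, e⟩ := Submodule.mem_sup.1 (this hg')
      obtain ⟨c, rfl⟩ := Submodule.mem_span_singleton.1 hy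
      have hfeas : ∀ g ∈ G, g ∈ feasible p (B.C i₀) := fun g hg =>
        mem_feasible.2 <| Eventually.of_forall fun t => hGC i₀ hi₀ p hp₀ _ (G.smul_mem t hg)
      rcases lt_trichotomy c 0 with h | h | h
      · exact absurd (e ▸ hfeas g hg) (hwall.feasible_neg i₀ hi₀ hp₀ κ hκ c h)
      · rw [← e, h]
        simpa using hκ
      · refine absurd (hfeas (-g) (G.neg_mem hg)) ?_
        have : -g = -κ + (-c) • u i₀ := by rw [← e]; module
        rw [this]
        exact hwall.feasible_neg i₀ hi₀ hp₀ _ (Submodule.neg_mem _ hκ) _ (neg_neg_iff_pos.2 h)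
    -- Otherwise (π, q) would map the span of M, of dimension less than d, onto F × G, of dimension
    -- d.
    have hne : Submodule.span ℝ (M.map π.toAddMonoidHom : Set F) ≠ ⊤ := by
      intro h
      rw [hspan] at h
      have hs : Function.Surjective (π'.domRestrict (Submodule.span ℝ (M : Set E))) := by
        intro f
        obtain ⟨x, hx, h⟩ := hsur _ hGM h f
        exact ⟨⟨x, hx⟩, h⟩
      have h1 := LinearMap.finrank_le_finrank_of_surjective hs
      have h2 := B.finrank_walls _ hM
      omega
    have hmap : ∀ i ∈ B.I, p ∈ B.C i → (B.N i).map π.toAddMonoidHom =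
        M.map π.toAddMonoidHom ⊔ AddSubgroup.zmultiples (π (u i)) := by
      intro i hi hp
      rw [hdec i hi hp, AddSubgroup.map_sup, AddMonoidHom.map_zmultiples]
      rfl
    have hMΛ : M.map π.toAddMonoidHom ≤ Λ :=
      le_sup_left.trans ((hmap i₀ hi₀ hp₀).ge.trans (hN i₀ hi₀))
    obtain ⟨D, hD1, hD2⟩ := exists_linear_relIndex hΛ hne hMΛ
    refine ⟨D ∘ₗ LinearMap.fst ℝ F G, fun x hx => ?_, fun i hi hp => ?_⟩
    · refine linearMap_zero_on_span hD1 ?_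
      rw [hspan]
      exact ⟨x, hx, rfl⟩
    · have hu : π (u i) ∈ Λ := hN i hi (by
        rw [hmap i hi hp]
        exact AddSubgroup.mem_sup_right (AddSubgroup.mem_zmultiples _))
      simp only [hw, hmap i hi hp, hD2 _ hu]
      rfl

end BalancedFamily

end

/-! ### Products of balanced families -/

section

theorem span_prod_eq {E F : Type*} [AddCommGroup E] [Module ℝ E] [AddCommGroup F] [Module ℝ F]
    (A : AddSubgroup E) (B : AddSubgroup F) :
    Submodule.span ℝ (A.prod B : Set (E × F)) =
      (Submodule.span ℝ (A : Set E)).prod (Submodule.span ℝ (B : Set F)) := by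
  refine le_antisymm (Submodule.span_le.2 fun x hx => ?_) ?_
  · exact ⟨Submodule.subset_span hx.1, Submodule.subset_span hx.2⟩
  · have h1 : (Submodule.span ℝ (A : Set E)).map (LinearMap.inl ℝ E F) ≤
        Submodule.span ℝ (A.prod B : Set (E × F)) := by
      rw [Submodule.map_span, Submodule.span_le]
      rintro _ ⟨a, ha, rfl⟩
      exact Submodule.subset_span ⟨ha, B.zero_mem⟩
    have h2 : (Submodule.span ℝ (B : Set F)).map (LinearMap.inr ℝ E F) ≤
        Submodule.span ℝ (A.prod B : Set (E × F)) := by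
      rw [Submodule.map_span, Submodule.span_le]
      rintro _ ⟨a, ha, rfl⟩
      exact Submodule.subset_span ⟨A.zero_mem, ha⟩
    rintro ⟨x, y⟩ ⟨hx, hy⟩
    have := Submodule.add_mem _ (h1 ⟨x, hx, rfl⟩) (h2 ⟨y, hy, rfl⟩)
    simpa using this

theorem prod_sup_zmultiples_left {E F : Type*} [AddCommGroup E] [AddCommGroup F] (M : AddSubgroup E)
    (N : AddSubgroup F) (u : E) :
    M.prod N ⊔ AddSubgroup.zmultiples (u, (0 : F)) = (M ⊔ AddSubgroup.zmultiples u).prod N := by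
  refine le_antisymm (sup_le (AddSubgroup.prod_mono le_sup_left le_rfl) ?_) ?_
  · rw [AddSubgroup.zmultiples_le]
    exact ⟨AddSubgroup.mem_sup_right (AddSubgroup.mem_zmultiples _), N.zero_mem⟩
  · rintro ⟨x, y⟩ ⟨hx, hy⟩
    obtain ⟨m, hm, _, ⟨a, rfl⟩, rfl⟩ := AddSubgroup.mem_sup.1 hx
    refine AddSubgroup.mem_sup.2 ⟨(m, y), ⟨hm, hy⟩, _, ⟨a, rfl⟩, by simp⟩

theorem prod_sup_zmultiples_right {E F : Type*} [AddCommGroup E] [AddCommGroup F] (M : AddSubgroup E)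
    (N : AddSubgroup F) (u : F) :
    M.prod N ⊔ AddSubgroup.zmultiples ((0 : E), u) = M.prod (N ⊔ AddSubgroup.zmultiples u) := by
  refine le_antisymm (sup_le (AddSubgroup.prod_mono le_rfl le_sup_left) ?_) ?_
  · rw [AddSubgroup.zmultiples_le]
    exact ⟨M.zero_mem, AddSubgroup.mem_sup_right (AddSubgroup.mem_zmultiples _)⟩
  · rintro ⟨x, y⟩ ⟨hx, hy⟩
    obtain ⟨m, hm, _, ⟨a, rfl⟩, rfl⟩ := AddSubgroup.mem_sup.1 hy
    refine AddSubgroup.mem_sup.2 ⟨(x, m), ⟨hx, hm⟩, _, ⟨a, rfl⟩, by simp⟩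

open Classical in
theorem filter_prod_eq_left {ι κ E F : Type*} {I : Finset ι} {J : Finset κ} {C : ι → Set E} {D : κ → Set F} {p : E × F}
    {j : κ} [hdec : DecidablePred fun i : ι × κ => p ∈ C i.1 ×ˢ D i.2] (hj : j ∈ J) (hpj : p.2 ∈ D j) (huniq : ∀ k ∈ J, p.2 ∈ D k → k = j) :
    (I ×ˢ J).filter (fun i => p ∈ C i.1 ×ˢ D i.2) = (I.filter fun i => p.1 ∈ C i) ×ˢ {j} := by
  ext ⟨i, k⟩
  simp only [Finset.mem_filter, Finset.mem_product, Finset.mem_singleton, Set.mem_prod]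
  constructor
  · rintro ⟨⟨h1, h2⟩, h3, h4⟩
    exact ⟨⟨h1, h3⟩, huniq k h2 h4⟩
  · rintro ⟨⟨h1, h3⟩, rfl⟩
    exact ⟨⟨h1, hj⟩, h3, hpj⟩

open Classical in
theorem filter_prod_eq_right {ι κ E F : Type*} {I : Finset ι} {J : Finset κ} {C : ι → Set E} {D : κ → Set F}
    {p : E × F} {i : ι} [hdec : DecidablePred fun i : ι × κ => p ∈ C i.1 ×ˢ D i.2] (hi : i ∈ I) (hpi : p.1 ∈ C i) (huniq : ∀ k ∈ I, p.1 ∈ C k → k = i) :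
    (I ×ˢ J).filter (fun i => p ∈ C i.1 ×ˢ D i.2) = {i} ×ˢ (J.filter fun j => p.2 ∈ D j) := by
  ext ⟨k, j⟩
  simp only [Finset.mem_filter, Finset.mem_product, Finset.mem_singleton, Set.mem_prod]
  constructor
  · rintro ⟨⟨h1, h2⟩, h3, h4⟩
    exact ⟨huniq k h1 h3, h2, h4⟩
  · rintro ⟨rfl, h3, h4⟩
    exact ⟨⟨hi, h3⟩, hpi, h4⟩

namespace BalancedFamily

variable {ι κ E F : Type*} [NormedAddCommGroup E] [NormedSpace ℝ E] [FiniteDimensional ℝ E]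
  [NormedAddCommGroup F] [NormedSpace ℝ F] [FiniteDimensional ℝ F]

theorem finrank_submodule_prod (S : Submodule ℝ E) (T : Submodule ℝ F) :
    finrank ℝ (S.prod T) = finrank ℝ S + finrank ℝ T := by
  rw [← finrank_prod]
  exact LinearEquiv.finrank_eq
    { toFun := fun x => (⟨x.1.1, x.2.1⟩, ⟨x.1.2, x.2.2⟩)
      invFun := fun x => ⟨(x.1.1, x.2.1), x.1.2, x.2.2⟩
      map_add' := fun _ _ => rfl
      map_smul' := fun _ _ => rfl
      left_inv := fun _ => rfl
      right_inv := fun _ => rfl }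

open Classical in
/-- The product of two balanced families. -/
noncomputable def prod (A : BalancedFamily ι E) (B : BalancedFamily κ F) :
    BalancedFamily (ι × κ) (E × F) where
  I := A.I ×ˢ B.I
  C i := A.C i.1 ×ˢ B.C i.2
  N i := (A.N i.1).prod (B.N i.2)
  m i := A.m i.1 * B.m i.2
  d := A.d + B.d
  walls := Set.image2 (fun S T => S.prod T) A.walls ((fun j => Submodule.span ℝ (B.N j : Set F)) '' B.I) ∪
    Set.image2 (fun S T => S.prod T) ((fun i => Submodule.span ℝ (A.N i : Set E)) '' A.I) B.walls
  bad := Set.image2 (fun S T => S.prod T) A.bad ((fun j => Submodule.span ℝ (B.N j : Set F)) '' B.I) ∪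
    Set.image2 (fun S T => S.prod T) ((fun i => Submodule.span ℝ (A.N i : Set E)) '' A.I) B.bad ∪
    Set.image2 (fun S T => S.prod T) A.walls B.walls
  walls_finite := (A.walls_finite.image2 _ (B.I.finite_toSet.image _)).union
    ((A.I.finite_toSet.image _).image2 _ B.walls_finite)
  bad_finite := ((A.bad_finite.image2 _ (B.I.finite_toSet.image _)).union
    ((A.I.finite_toSet.image _).image2 _ B.bad_finite)).union
    (A.walls_finite.image2 _ B.walls_finite)
  closed i hi := (A.closed _ (Finset.mem_product.1 hi).1).prod (B.closed _ (Finset.mem_product.1 hi).2)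
  convex i hi := (A.convex _ (Finset.mem_product.1 hi).1).prod (B.convex _ (Finset.mem_product.1 hi).2)
  subset_span := by
    rintro i hi x ⟨hx, hy⟩
    rw [span_prod_eq]
    exact ⟨A.subset_span _ (Finset.mem_product.1 hi).1 hx,
      B.subset_span _ (Finset.mem_product.1 hi).2 hy⟩
  finrank_span := by
    intro i hi
    rw [span_prod_eq, finrank_submodule_prod, A.finrank_span _ (Finset.mem_product.1 hi).1,
      B.finrank_span _ (Finset.mem_product.1 hi).2]
  finrank_walls := by
    rintro _ (⟨K, hK, _, ⟨j, hj, rfl⟩, rfl⟩ | ⟨_, ⟨j, hj, rfl⟩, K, hK, rfl⟩)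
    · have := A.finrank_walls K hK
      have := B.finrank_span j hj
      simp only [finrank_submodule_prod]
      omega
    · have := B.finrank_walls K hK
      have := A.finrank_span j hj
      simp only [finrank_submodule_prod]
      omega
  finrank_bad := by
    rintro _ ((⟨K, hK, _, ⟨j, hj, rfl⟩, rfl⟩ | ⟨_, ⟨j, hj, rfl⟩, K, hK, rfl⟩) | ⟨K, hK, L, hL, rfl⟩)
    · have := A.finrank_bad K hK
      have := B.finrank_span j hj
      simp only [finrank_submodule_prod]
      omega
    · have := B.finrank_bad K hK
      have := A.finrank_span j hj
      simp only [finrank_submodule_prod]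
      omega
    · have := A.finrank_walls K hK
      have := B.finrank_walls L hL
      simp only [finrank_submodule_prod]
      omega
  point := by
    rintro p hp ⟨⟨i₀, j₀⟩, hi, hpi⟩
    obtain ⟨hi₀, hj₀⟩ := Finset.mem_product.1 hi
    have hA := A.point p.1 (fun S hS h => hp _ (.inl (.inl ⟨S, hS, _, ⟨j₀, hj₀, rfl⟩, rfl⟩))
      ⟨h, B.subset_span _ hj₀ hpi.2⟩) ⟨i₀, hi₀, hpi.1⟩
    have hB := B.point p.2 (fun S hS h => hp _ (.inl (.inr ⟨_, ⟨i₀, hi₀, rfl⟩, S, hS, rfl⟩))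
      ⟨A.subset_span _ hi₀ hpi.1, h⟩) ⟨j₀, hj₀, hpi.2⟩
    rcases hA with ⟨i, hi, hpi', hui, hfi⟩ | ⟨M, u, hM, hwM⟩ <;>
      rcases hB with ⟨j, hj, hpj', huj, hfj⟩ | ⟨M', u', hM', hwM'⟩
    · refine .inl ⟨(i, j), Finset.mem_product.2 ⟨hi, hj⟩, ⟨hpi', hpj'⟩, ?_, ?_⟩
      · rintro ⟨k, l⟩ hkl ⟨h1, h2⟩
        obtain ⟨hk, hl⟩ := Finset.mem_product.1 hkl
        exact Prod.ext (hui k hk h1) (huj l hl h2)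
      · intro x hx
        rw [span_prod_eq] at hx
        exact mem_feasible_prod.2 ⟨hfi _ hx.1, hfj _ hx.2⟩
    · refine .inr ⟨(A.N i).prod M', fun k => (0, u' k.2), ?_, ?_⟩
      · rw [span_prod_eq]
        exact .inr ⟨_, ⟨i, hi, rfl⟩, _, hM', rfl⟩
      · have hst : ∀ k ∈ A.I ×ˢ B.I, p ∈ A.C k.1 ×ˢ B.C k.2 → k.1 = i ∧ k.2 ∈ B.I ∧ p.2 ∈ B.C k.2 :=
          fun k hk hpk => ⟨hui _ (Finset.mem_product.1 hk).1 hpk.1, (Finset.mem_product.1 hk).2, hpk.2⟩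
        refine ⟨?_, ?_, ?_, ?_, ?_⟩
        · rw [span_prod_eq]
          exact ⟨A.subset_span i hi hpi', hwM'.mem_span⟩
        · intro k hk hpk
          obtain ⟨rfl, h2, h3⟩ := hst k hk hpk
          rw [prod_sup_zmultiples_right, hwM'.sup_eq _ h2 h3]
        · intro k hk hpk x hx c hc
          obtain ⟨rfl, h2, h3⟩ := hst k hk hpk
          rw [span_prod_eq] at hx
          refine mem_feasible_prod.2 ⟨?_, hwM'.feasible_pos _ h2 h3 _ hx.2 c hc⟩
          simpa using hfi _ hx.1
        · intro k hk hpk x hx c hc h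
          obtain ⟨rfl, h2, h3⟩ := hst k hk hpk
          rw [span_prod_eq] at hx
          exact hwM'.feasible_neg _ h2 h3 _ hx.2 c hc (mem_feasible_prod.1 h).2
        · rw [span_prod_eq, filter_prod_eq_right (hdec := _) (J := B.I) (D := B.C) hi hpi' hui, Finset.sum_product,
            Finset.sum_singleton]
          refine ⟨?_, ?_⟩
          · rw [Prod.fst_sum]
            simp
          · rw [Prod.snd_sum]
            have := Submodule.smul_mem _ (A.m i) hwM'.balanced
            simpa [Finset.smul_sum, smul_smul] using this
    · refine .inr ⟨M.prod (B.N j), fun k => (u k.1, 0), ?_, ?_⟩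
      · rw [span_prod_eq]
        exact .inl ⟨_, hM, _, ⟨j, hj, rfl⟩, rfl⟩
      · have hst : ∀ k ∈ A.I ×ˢ B.I, p ∈ A.C k.1 ×ˢ B.C k.2 → k.2 = j ∧ k.1 ∈ A.I ∧ p.1 ∈ A.C k.1 :=
          fun k hk hpk => ⟨huj _ (Finset.mem_product.1 hk).2 hpk.2, (Finset.mem_product.1 hk).1, hpk.1⟩
        refine ⟨?_, ?_, ?_, ?_, ?_⟩
        · rw [span_prod_eq]
          exact ⟨hwM.mem_span, B.subset_span j hj hpj'⟩
        · intro k hk hpk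
          obtain ⟨rfl, h2, h3⟩ := hst k hk hpk
          rw [prod_sup_zmultiples_left, hwM.sup_eq _ h2 h3]
        · intro k hk hpk x hx c hc
          obtain ⟨rfl, h2, h3⟩ := hst k hk hpk
          rw [span_prod_eq] at hx
          refine mem_feasible_prod.2 ⟨hwM.feasible_pos _ h2 h3 _ hx.1 c hc, ?_⟩
          simpa using hfj _ hx.2
        · intro k hk hpk x hx c hc h
          obtain ⟨rfl, h2, h3⟩ := hst k hk hpk
          rw [span_prod_eq] at hx
          exact hwM.feasible_neg _ h2 h3 _ hx.1 c hc (mem_feasible_prod.1 h).1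
        · rw [span_prod_eq, filter_prod_eq_left (hdec := _) (I := A.I) (C := A.C) hj hpj' huj, Finset.sum_product_right,
            Finset.sum_singleton]
          refine ⟨?_, ?_⟩
          · rw [Prod.fst_sum]
            have := Submodule.smul_mem _ (B.m j) hwM.balanced
            simpa [Finset.smul_sum, smul_smul, mul_comm] using this
          · rw [Prod.snd_sum]
            simp
    -- A product of two walls has dimension at most d − 2 and was declared bad.
    · exact absurd ⟨hwM.mem_span, hwM'.mem_span⟩ (hp _ (.inr ⟨_, hM, _, hM', rfl⟩))

end BalancedFamily

end

/-! ### Relative interiors and faces -/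

section Convex

variable {V : Type*} [AddCommGroup V] [Module ℝ V]

/-- The points of `P` from which one can move a little in every direction parallel to `P`. -/
def relInt (P : Set V) : Set V := {x | x ∈ P ∧ ∀ u ∈ vectorSpan ℝ P, u ∈ feasible x P}

theorem mem_relInt {P : Set V} {x : V} :
    x ∈ relInt P ↔ x ∈ P ∧ ∀ u ∈ vectorSpan ℝ P, u ∈ feasible x P := Iff.rfl

/-- The segment from y to x can be prolonged in P to x + δ(x − y). The convex combination of this
point and y + εu that cancels y is x + (εδ/(1 + δ))u. -/
theorem feasible_subset_of_relInt {P Q : Set V} (hQ : Convex ℝ Q) (hPQ : P ⊆ Q) {x y : V}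
    (hx : x ∈ relInt P) (hy : y ∈ P) : feasible y Q ⊆ feasible x Q := by
  intro u hu
  have hPx := (mem_relInt.1 hx).2 (x - y) (vsub_mem_vectorSpan ℝ (mem_relInt.1 hx).1 hy)
  obtain ⟨δ, h1, hδ : 0 < δ⟩ := ((mem_feasible.1 hPx).and self_mem_nhdsWithin).exists
  obtain ⟨ε, h2, hε : 0 < ε⟩ := ((mem_feasible.1 hu).and self_mem_nhdsWithin).exists
  refine mem_feasible_of_mem hQ (hPQ (mem_relInt.1 hx).1) (δ := ε * δ / (1 + δ)) (by positivity) ?_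
  have := hQ (hPQ h1) h2 (a := 1 / (1 + δ)) (b := δ / (1 + δ)) (by positivity) (by positivity)
    (by field_simp)
  convert this using 1
  match_scalars <;> field_simp
  ring

theorem subset_of_isExtreme_of_relInt {P F Q : Set V} (hF : IsExtreme ℝ P F) (hQP : Q ⊆ P) {x : V}
    (hx : x ∈ relInt Q) (hxF : x ∈ F) : Q ⊆ F := by
  intro y hy
  have hPx := (mem_relInt.1 hx).2 (x - y) (vsub_mem_vectorSpan ℝ (mem_relInt.1 hx).1 hy)
  obtain ⟨δ, h1, hδ : 0 < δ⟩ := ((mem_feasible.1 hPx).and self_mem_nhdsWithin).exists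
  refine hF.2 (hQP hy) (hQP h1) hxF ⟨δ / (1 + δ), 1 / (1 + δ), by positivity, by positivity,
    by field_simp; ring, ?_⟩
  match_scalars <;> field_simp; ring

theorem IsFace.eq_of_vectorSpan_le {P F : Set V} (hF : IsFace P F) {x : V} (hx : x ∈ relInt F)
    (h : vectorSpan ℝ P ≤ vectorSpan ℝ F) : F = P := by
  refine Set.Subset.antisymm hF.2.2.1 fun y hy => ?_
  have hxF := (mem_relInt.1 hx).1
  have hPx := (mem_relInt.1 hx).2 (x - y) (h (vsub_mem_vectorSpan ℝ (hF.2.2.1 hxF) hy))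
  obtain ⟨δ, h1, hδ : 0 < δ⟩ := ((mem_feasible.1 hPx).and self_mem_nhdsWithin).exists
  refine hF.2.2.2 hy (hF.2.2.1 h1) hxF ⟨δ / (1 + δ), 1 / (1 + δ), by positivity, by positivity,
    by field_simp; ring, ?_⟩
  match_scalars <;> field_simp; ring

/-- The hypothesis says that every segment from a point y of P to x can be prolonged beyond x. So
the generators y − x of the direction space are feasible together with their negatives. -/
theorem mem_relInt_of_faceHull {P : Set V} (hP : Convex ℝ P) {x : V} (hx : x ∈ P)
    (h : P ⊆ faceHull P {x}) : x ∈ relInt P := by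
  refine ⟨hx, fun u hu => ?_⟩
  rw [vectorSpan_eq_span_vsub_set_right ℝ hx] at hu
  suffices u ∈ feasible x P ∧ -u ∈ feasible x P from this.1
  induction hu using Submodule.span_induction with
  | mem v hv =>
    obtain ⟨y, hy, rfl⟩ := hv
    obtain ⟨-, x', hx', ε, hε, hm⟩ := h hy
    obtain rfl : x' = x := hx'
    refine ⟨sub_mem_feasible hP hx hy, mem_feasible_of_mem hP hx hε ?_⟩
    simpa using hm
  | zero => simpa using zero_mem_feasible hx
  | add v w _ _ hv hw =>
    refine ⟨add_mem_feasible hP hv.1 hw.1, ?_⟩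
    rw [neg_add]
    exact add_mem_feasible hP hv.2 hw.2
  | smul c v _ hv =>
    rcases lt_trichotomy c 0 with hc | rfl | hc
    · have e : c • v = (-c) • -v := by module
      rw [e, ← smul_neg, neg_neg]
      exact ⟨smul_mem_feasible (neg_pos.2 hc) hv.2, smul_mem_feasible (neg_pos.2 hc) hv.1⟩
    · simpa using zero_mem_feasible hx
    · rw [← smul_neg]
      exact ⟨smul_mem_feasible hc hv.1, smul_mem_feasible hc hv.2⟩

theorem add_mem_feasible_of_relInt {P Q : Set V} (hQ : Convex ℝ Q) (hPQ : P ⊆ Q) {x u g : V}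
    (hx : x ∈ relInt P) (hu : u ∈ feasible x Q) (hg : g ∈ vectorSpan ℝ P) :
    u + g ∈ feasible x Q :=
  add_mem_feasible hQ hu (feasible_mono x hPQ ((mem_relInt.1 hx).2 g hg))

end Convex

/-! ### Links as tangent cones -/

section Normed

variable {V : Type*} [NormedAddCommGroup V] [NormedSpace ℝ V]

theorem mem_relInt_of_mem_intrinsicInterior {P : Set V} {x : V} (hx : x ∈ intrinsicInterior ℝ P) :
    x ∈ relInt P := by
  refine ⟨intrinsicInterior_subset hx, fun u hu => ?_⟩
  obtain ⟨y, hy, rfl⟩ := mem_intrinsicInterior.1 hx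
  have hmem : ∀ t : ℝ, (y : V) + t • u ∈ affineSpan ℝ P := fun t => by
    have := AffineSubspace.vadd_mem_of_mem_direction (s := affineSpan ℝ P) (v := t • u)
      (by rw [direction_affineSpan]; exact Submodule.smul_mem _ _ hu) y.2
    rwa [vadd_eq_add, add_comm] at this
  have hc : Continuous fun t : ℝ => (⟨(y : V) + t • u, hmem t⟩ : affineSpan ℝ P) := by
    apply Continuous.subtype_mk
    fun_prop
  have ht : Tendsto (fun t : ℝ => (⟨(y : V) + t • u, hmem t⟩ : affineSpan ℝ P)) (𝓝[>] 0) (𝓝 y) :=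
    (hc.tendsto' 0 y (Subtype.ext (by simp))).mono_left nhdsWithin_le_nhds
  rw [mem_feasible]
  filter_upwards [ht.eventually (isOpen_interior.mem_nhds hy)] with t ht
  exact interior_subset (s := ((↑) ⁻¹' P : Set (affineSpan ℝ P))) ht

theorem mem_link_iff {γ σ : Set V} {u : V} :
    u ∈ link γ σ ↔ ∃ ω ∈ intrinsicInterior ℝ γ, u ∈ feasible ω σ := by
  have : ∀ ω, u ∈ feasible ω σ ↔ ∃ δ : ℝ, 0 < δ ∧ ∀ ε : ℝ, 0 < ε → ε < δ → ω + ε • u ∈ σ := by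
    intro ω
    rw [mem_feasible, (nhdsGT_basis (0 : ℝ)).eventually_iff]
    simp [Set.mem_Ioo, and_imp]
  simp only [this]
  rfl

/-- By `feasible_subset_of_relInt`, the tangent cones of σ at any two relative interior points of γ
contain each other, so one fixed point ω computes the links of all cells containing γ. -/
theorem link_eq_feasible [FiniteDimensional ℝ V] {γ σ : Set V} (hγ : Convex ℝ γ) (hσ : Convex ℝ σ)
    (h : γ ⊆ σ) {x : V} (hx : x ∈ relInt γ) : link γ σ = feasible x σ := by
  ext u
  rw [mem_link_iff]
  constructor
  · rintro ⟨ω, hω, hu⟩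
    exact feasible_subset_of_relInt hσ h hx (intrinsicInterior_subset hω) hu
  · intro hu
    obtain ⟨ω, hω⟩ := Set.Nonempty.intrinsicInterior hγ ⟨x, (mem_relInt.1 hx).1⟩
    exact ⟨ω, hω, feasible_subset_of_relInt hσ h (mem_relInt_of_mem_intrinsicInterior hω)
      (mem_relInt.1 hx).1 hu⟩

theorem relInt_nonempty [FiniteDimensional ℝ V] {P : Set V} (hP : Convex ℝ P) (hne : P.Nonempty) :
    (relInt P).Nonempty := by
  obtain ⟨ω, hω⟩ := Set.Nonempty.intrinsicInterior hP hne
  exact ⟨ω, mem_relInt_of_mem_intrinsicInterior hω⟩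

/-! ### Polyhedra -/

/-- The set of solutions of finitely many linear inequalities. -/
def halfspaces (s : Finset (Module.Dual ℝ V × ℝ)) : Set V := {x | ∀ p ∈ s, p.1 x ≤ p.2}

theorem mem_halfspaces {s : Finset (Module.Dual ℝ V × ℝ)} {x : V} :
    x ∈ halfspaces s ↔ ∀ p ∈ s, p.1 x ≤ p.2 := Iff.rfl

theorem mem_feasible_halfspaces {s : Finset (Module.Dual ℝ V × ℝ)} {x : V}
    (hx : x ∈ halfspaces s) {u : V} :
    u ∈ feasible x (halfspaces s) ↔ ∀ p ∈ s, p.1 x = p.2 → p.1 u ≤ 0 := by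
  constructor
  · intro h p hp he
    obtain ⟨δ, h1, hδ : 0 < δ⟩ := ((mem_feasible.1 h).and self_mem_nhdsWithin).exists
    have := h1 p hp
    rw [map_add, map_smul, he, smul_eq_mul] at this
    by_contra hne
    have := mul_pos hδ (not_le.1 hne)
    linarith
  · intro h
    rw [mem_feasible]
    have : ∀ᶠ ε in 𝓝[>] (0 : ℝ), ∀ p ∈ s, p.1 (x + ε • u) ≤ p.2 := by
      rw [eventually_all_finset]
      intro p hp
      simp only [map_add, map_smul, smul_eq_mul]
      rcases (hx p hp).eq_or_lt with he | hlt
      · filter_upwards [self_mem_nhdsWithin] with ε (hε : 0 < ε)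
        nlinarith [h p hp he]
      · have hc : Continuous fun ε : ℝ => p.1 x + ε * p.1 u := by fun_prop
        have := (hc.tendsto' 0 (p.1 x) (by simp)).eventually (gt_mem_nhds hlt)
        filter_upwards [nhdsWithin_le_nhds this] with ε hε using le_of_lt hε
    exact this

open Classical in
theorem feasible_halfspaces {s : Finset (Module.Dual ℝ V × ℝ)} {x : V} (hx : x ∈ halfspaces s) :
    feasible x (halfspaces s) =
      halfspaces ((s.filter fun p => p.1 x = p.2).image fun p => (p.1, (0 : ℝ))) := by
  ext u
  rw [mem_feasible_halfspaces hx, mem_halfspaces]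
  constructor
  · intro h q hq
    obtain ⟨p, hp, rfl⟩ := Finset.mem_image.1 hq
    exact h p (Finset.mem_filter.1 hp).1 (Finset.mem_filter.1 hp).2
  · intro h p hp he
    exact h (p.1, 0) (Finset.mem_image.2 ⟨p, Finset.mem_filter.2 ⟨hp, he⟩, rfl⟩)

theorem isClosed_halfspaces [FiniteDimensional ℝ V] (s : Finset (Module.Dual ℝ V × ℝ)) :
    IsClosed (halfspaces s) := by
  have : halfspaces s = ⋂ p ∈ s, {x : V | p.1 x ≤ p.2} := by
    ext x
    simp [mem_halfspaces]
  rw [this]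
  exact isClosed_biInter fun p _ =>
    isClosed_le p.1.continuous_of_finiteDimensional continuous_const

/-- The tangent cone at a point near `x` in the direction `u` is an iterated tangent cone. -/
theorem eventually_feasible_halfspaces {s : Finset (Module.Dual ℝ V × ℝ)} {x : V}
    (hx : x ∈ halfspaces s) {u : V} (hu : u ∈ feasible x (halfspaces s)) :
    ∀ᶠ ε in 𝓝[>] (0 : ℝ),
      feasible (x + ε • u) (halfspaces s) = feasible u (feasible x (halfspaces s)) := by
  classical
  have h1 : ∀ᶠ ε in 𝓝[>] (0 : ℝ), ∀ p ∈ s, p.1 (x + ε • u) = p.2 ↔ p.1 x = p.2 ∧ p.1 u = 0 := by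
    rw [eventually_all_finset]
    intro p hp
    simp only [map_add, map_smul, smul_eq_mul]
    rcases (hx p hp).eq_or_lt with he | hlt
    · filter_upwards [self_mem_nhdsWithin] with ε (hε : 0 < ε)
      simp [he, hε.ne']
    · have hc : Continuous fun ε : ℝ => p.1 x + ε * p.1 u := by fun_prop
      have := (hc.tendsto' 0 (p.1 x) (by simp)).eventually (gt_mem_nhds hlt)
      filter_upwards [nhdsWithin_le_nhds this] with ε hε
      exact iff_of_false (ne_of_lt hε) fun h => hlt.ne h.1
  filter_upwards [h1, mem_feasible.1 hu] with ε hε hm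
  ext v
  rw [mem_feasible_halfspaces hm]
  rw [feasible_halfspaces hx] at hu ⊢
  rw [mem_feasible_halfspaces hu]
  constructor
  · intro h q hq hq0
    obtain ⟨p, hp, rfl⟩ := Finset.mem_image.1 hq
    obtain ⟨hp, hpx⟩ := Finset.mem_filter.1 hp
    exact h p hp ((hε p hp).2 ⟨hpx, hq0⟩)
  · intro h p hp he
    obtain ⟨h2, h3⟩ := (hε p hp).1 he
    exact h (p.1, 0) (Finset.mem_image.2 ⟨p, Finset.mem_filter.2 ⟨hp, h2⟩, rfl⟩) h3

theorem vectorSpan_halfspaces {s : Finset (Module.Dual ℝ V × ℝ)} {ω : V}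
    (hω : ω ∈ relInt (halfspaces s)) {x : V} :
    x ∈ vectorSpan ℝ (halfspaces s) ↔ ∀ p ∈ s, p.1 ω = p.2 → p.1 x = 0 := by
  have hωP := (mem_relInt.1 hω).1
  constructor
  · intro hx p hp he
    have h1 := (mem_feasible_halfspaces hωP).1 ((mem_relInt.1 hω).2 x hx) p hp he
    have h2 := (mem_feasible_halfspaces hωP).1
      ((mem_relInt.1 hω).2 _ (Submodule.neg_mem _ hx)) p hp he
    rw [map_neg] at h2
    linarith
  · intro h
    exact mem_vectorSpan_of_feasible hωP ((mem_feasible_halfspaces hωP).2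
      fun p hp he => (h p hp he).le)

end Normed

section

variable {V : Type*} [NormedAddCommGroup V] [NormedSpace ℝ V] {Λ : Submodule ℤ V}

/-! ### Rational polyhedra -/

/-- Induction on the functionals. If l is non-zero at a lattice point u of the previous kernel, the
projection along u onto ker l sends a lattice point y to (l u)⁻¹ • (l(u) • y − l(y) • u), a real
multiple of a lattice point because l is integral. -/
theorem span_setOf_forall_eq_zero (hΛ : Submodule.span ℝ (Λ : Set V) = ⊤)
    (s : Finset (Module.Dual ℝ V)) (hs : ∀ l ∈ s, ∀ x ∈ Λ, ∃ z : ℤ, l x = z) {x : V}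
    (hx : ∀ l ∈ s, l x = 0) : x ∈ Submodule.span ℝ {y : V | y ∈ Λ ∧ ∀ l ∈ s, l y = 0} := by
  classical
  induction s using Finset.induction_on with
  | empty =>
    have : {y : V | y ∈ Λ ∧ ∀ l ∈ (∅ : Finset (Module.Dual ℝ V)), l y = 0} = Λ := by ext; simp
    rw [this, hΛ]
    trivial
  | insert l s hl ih =>
    have hx' := ih (fun l' h => hs l' (Finset.mem_insert_of_mem h))
      fun l' h => hx l' (Finset.mem_insert_of_mem h)
    by_cases h0 : ∀ y ∈ Λ, (∀ l ∈ s, l y = 0) → l y = 0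
    · refine Submodule.span_mono ?_ hx'
      rintro y ⟨hy, hys⟩
      refine ⟨hy, fun l' hl' => ?_⟩
      rcases Finset.mem_insert.1 hl' with rfl | h
      exacts [h0 y hy hys, hys _ h]
    · push Not at h0
      obtain ⟨u, hu, hus, hlu⟩ := h0
      obtain ⟨k, hk⟩ := hs l (Finset.mem_insert_self _ _) u hu
      let f : V →ₗ[ℝ] V := LinearMap.id - (l.smulRight ((l u)⁻¹ • u))
      have hf : ∀ y, f y = y - (l y) • (l u)⁻¹ • u := fun y => rfl
      have hfx : f x = x := by rw [hf, hx l (Finset.mem_insert_self _ _)]; simp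
      rw [← hfx]
      have : (Submodule.span ℝ {y : V | y ∈ Λ ∧ ∀ l ∈ s, l y = 0}).map f ≤
          Submodule.span ℝ {y : V | y ∈ Λ ∧ ∀ l' ∈ insert l s, l' y = 0} := by
        rw [Submodule.map_span, Submodule.span_le]
        rintro _ ⟨y, ⟨hy, hys⟩, rfl⟩
        obtain ⟨j, hj⟩ := hs l (Finset.mem_insert_self _ _) y hy
        have e : f y = (l u)⁻¹ • (k • y - j • u) := by
          rw [hf, ← Int.cast_smul_eq_zsmul ℝ k, ← Int.cast_smul_eq_zsmul ℝ j, ← hk, ← hj]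
          match_scalars <;> field_simp
        rw [e]
        refine Submodule.smul_mem _ _ (Submodule.subset_span ⟨Λ.sub_mem (Λ.smul_mem k hy)
          (Λ.smul_mem j hu), fun l' hl' => ?_⟩)
        rcases Finset.mem_insert.1 hl' with rfl | h
        · simp only [map_sub, map_zsmul, hk, hj, zsmul_eq_mul]
          ring
        · simp [hys l' h, hus l' h]
      exact this ⟨x, hx', rfl⟩

theorem exists_generator {L : AddSubgroup V} {l : Module.Dual ℝ V}
    (hl : ∀ x ∈ L, ∃ z : ℤ, l x = z) : ∃ u ∈ L, ∀ x ∈ L, ∃ j : ℤ, l x = j * l u := by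
  let A : AddSubgroup ℤ := (L.map l.toAddMonoidHom).comap (Int.castAddHom ℝ)
  obtain ⟨e, he⟩ := Int.subgroup_cyclic A
  have hA : ∀ z : ℤ, z ∈ A ↔ ∃ x ∈ L, l x = z := fun z => Iff.rfl
  obtain ⟨u, hu, hue⟩ := (hA e).1 (by rw [he]; exact AddSubgroup.subset_closure rfl)
  refine ⟨u, hu, fun x hx => ?_⟩
  obtain ⟨z, hz⟩ := hl x hx
  have hzA : z ∈ A := (hA z).2 ⟨x, hx, hz⟩
  rw [he, ← AddSubgroup.zmultiples_eq_closure, AddSubgroup.mem_zmultiples_iff] at hzA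
  obtain ⟨j, hj⟩ := hzA
  refine ⟨j, ?_⟩
  rw [hz, ← hj, hue]
  simp

theorem mem_latticeOf {P : Set V} {x : V} : x ∈ latticeOf Λ P ↔ x ∈ Λ ∧ x ∈ vectorSpan ℝ P := Iff.rfl

theorem latticeOf_le (P : Set V) : latticeOf Λ P ≤ Λ.toAddSubgroup := inf_le_left

theorem latticeOf_mono {P Q : Set V} (h : P ⊆ Q) : latticeOf Λ P ≤ latticeOf Λ Q :=
  inf_le_inf_left _ (vectorSpan_mono ℝ h)

namespace IsRationalPolyhedron

theorem exists_eq_halfspaces {P : Set V} (hP : IsRationalPolyhedron Λ P) :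
    ∃ s : Finset (Module.Dual ℝ V × ℝ), (∀ p ∈ s, ∀ x ∈ Λ, ∃ z : ℤ, p.1 x = z) ∧
      P = halfspaces s := hP.2

variable [FiniteDimensional ℝ V]

theorem isClosed {P : Set V} (hP : IsRationalPolyhedron Λ P) : IsClosed P := by
  obtain ⟨s, -, rfl⟩ := hP.exists_eq_halfspaces
  exact isClosed_halfspaces s

theorem isClosed_feasible {P : Set V} (hP : IsRationalPolyhedron Λ P) (x : V) :
    IsClosed (feasible x P) := by
  classical
  by_cases hx : x ∈ P
  · obtain ⟨s, -, rfl⟩ := hP.exists_eq_halfspaces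
    rw [feasible_halfspaces hx]
    exact isClosed_halfspaces _
  · have : feasible x P = ∅ := Set.eq_empty_of_forall_notMem fun u hu =>
      hx (mem_of_feasible hP.isClosed hu)
    rw [this]
    exact isClosed_empty

theorem eventually_feasible {P : Set V} (hP : IsRationalPolyhedron Λ P) {x u : V}
    (hu : u ∈ feasible x P) :
    ∀ᶠ ε in 𝓝[>] (0 : ℝ), feasible (x + ε • u) P = feasible u (feasible x P) := by
  have hx := mem_of_feasible hP.isClosed hu
  obtain ⟨s, -, rfl⟩ := hP.exists_eq_halfspaces
  exact eventually_feasible_halfspaces hx hu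

theorem relInt_nonempty {P : Set V} (hP : IsRationalPolyhedron Λ P) : (relInt P).Nonempty :=
  Trop.relInt_nonempty hP.convex hP.1

/-- The direction space is cut out by the inequalities active at a relative interior point, and
these are integral. -/
theorem exists_integral {P : Set V} (hP : IsRationalPolyhedron Λ P) {x : V}
    (hx : x ∉ vectorSpan ℝ P) : ∃ l : Module.Dual ℝ V, (∀ y ∈ Λ, ∃ z : ℤ, l y = z) ∧
      (∀ y ∈ vectorSpan ℝ P, l y = 0) ∧ l x ≠ 0 := by
  obtain ⟨ω, hω⟩ := hP.relInt_nonempty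
  obtain ⟨s, hs, rfl⟩ := hP.exists_eq_halfspaces
  rw [vectorSpan_halfspaces hω] at hx
  push Not at hx
  obtain ⟨p, hp, he, hne⟩ := hx
  exact ⟨p.1, hs p hp, fun y hy => (vectorSpan_halfspaces hω).1 hy p hp he, hne⟩

theorem span_latticeOf (hΛ : Submodule.span ℝ (Λ : Set V) = ⊤) {P : Set V}
    (hP : IsRationalPolyhedron Λ P) :
    Submodule.span ℝ (latticeOf Λ P : Set V) = vectorSpan ℝ P := by
  classical
  refine le_antisymm (Submodule.span_le.2 fun x hx => (mem_latticeOf.1 hx).2) fun x hx => ?_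
  obtain ⟨ω, hω⟩ := hP.relInt_nonempty
  obtain ⟨s, hs, rfl⟩ := hP.exists_eq_halfspaces
  have h := span_setOf_forall_eq_zero hΛ ((s.filter fun p => p.1 ω = p.2).image Prod.fst) (by
    intro l hl
    obtain ⟨p, hp, rfl⟩ := Finset.mem_image.1 hl
    exact hs p (Finset.mem_filter.1 hp).1) (x := x) (by
    intro l hl
    obtain ⟨p, hp, rfl⟩ := Finset.mem_image.1 hl
    exact (vectorSpan_halfspaces hω).1 hx p (Finset.mem_filter.1 hp).1 (Finset.mem_filter.1 hp).2)
  refine Submodule.span_mono ?_ h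
  rintro y ⟨hy, hys⟩
  refine mem_latticeOf.2 ⟨hy, (vectorSpan_halfspaces hω).2 fun p hp he => ?_⟩
  exact hys p.1 (Finset.mem_image.2 ⟨p, Finset.mem_filter.2 ⟨hp, he⟩, rfl⟩)

/-- Existence of a lattice normal vector of a polyhedron at a facet. -/
theorem exists_normal (hΛ : Submodule.span ℝ (Λ : Set V) = ⊤) {τ σ : Set V}
    (hτ : IsRationalPolyhedron Λ τ) (hσ : IsRationalPolyhedron Λ σ) (hf : IsFace σ τ)
    (hd : dim τ + 1 = dim σ) : ∃ u ∈ Λ, u ∈ link τ σ ∧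
      latticeOf Λ τ ⊔ AddSubgroup.zmultiples u = latticeOf Λ σ := by
  obtain ⟨ω, hω⟩ := hτ.relInt_nonempty
  have hsub := hf.2.2.1
  rw [link_eq_feasible hτ.convex hσ.convex hsub hω]
  have hle : vectorSpan ℝ τ ≤ vectorSpan ℝ σ := vectorSpan_mono ℝ hsub
  have hωτ := (mem_relInt.1 hω).1
  -- a point of `σ` outside of the affine span of `τ`
  obtain ⟨y, hy, hyτ⟩ : ∃ y ∈ σ, y - ω ∉ vectorSpan ℝ τ := by
    by_contra! h
    have : vectorSpan ℝ σ ≤ vectorSpan ℝ τ := by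
      rw [vectorSpan_eq_span_vsub_set_right ℝ (hsub hωτ), Submodule.span_le]
      rintro _ ⟨y, hy, rfl⟩
      exact h y hy
    have := Submodule.finrank_mono this
    unfold dim at hd
    omega
  have hyσ : y - ω ∈ vectorSpan ℝ σ := vsub_mem_vectorSpan ℝ hy (hsub hωτ)
  -- By dimension, the kernel of l on the span of σ is the span of τ, so l embeds N_σ/N_τ in ℤ. The
  -- normal vector is a lattice vector generating the image, with the sign that makes it point into
  -- σ.
  obtain ⟨l, hl, hlτ, hly⟩ := hτ.exists_integral hyτ
  have hker : ∀ x ∈ vectorSpan ℝ σ, l x = 0 → x ∈ vectorSpan ℝ τ := by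
    intro x hx hlx
    have h1 : vectorSpan ℝ τ ≤ vectorSpan ℝ σ ⊓ LinearMap.ker l :=
      le_inf hle fun y hy => hlτ y hy
    have h2 : vectorSpan ℝ σ ⊓ LinearMap.ker l < vectorSpan ℝ σ := by
      refine lt_of_le_of_ne inf_le_left fun h => hly ?_
      exact (inf_eq_left.1 h) hyσ
    have h3 := Submodule.finrank_lt_finrank_of_lt h2
    have h4 := Submodule.eq_of_le_of_finrank_le h1 (by unfold dim at hd; omega)
    rw [h4]
    exact ⟨hx, hlx⟩
  obtain ⟨u₀, hu₀, hgen⟩ := exists_generator (L := latticeOf Λ σ) (l := l)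
    fun x hx => hl x (mem_latticeOf.1 hx).1
  have hl0 : l u₀ ≠ 0 := by
    intro h0
    refine hly (linearMap_zero_on_span (M := (latticeOf Λ σ : Set V)) (fun x hx => ?_)
      (by rwa [hσ.span_latticeOf hΛ]))
    obtain ⟨j, hj⟩ := hgen x hx
    rw [hj, h0, mul_zero]
  have hsup : ∀ u ∈ latticeOf Λ σ, (l u = l u₀ ∨ l u = -l u₀) →
      latticeOf Λ τ ⊔ AddSubgroup.zmultiples u = latticeOf Λ σ := by
    intro u hu hue
    refine le_antisymm (sup_le (latticeOf_mono hsub) (by rwa [AddSubgroup.zmultiples_le])) ?_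
    intro x hx
    obtain ⟨j, hj⟩ : ∃ j : ℤ, l x = j * l u := by
      obtain ⟨j, hj⟩ := hgen x hx
      rcases hue with h | h
      · exact ⟨j, by rw [hj, h]⟩
      · exact ⟨-j, by rw [hj, h]; push_cast; ring⟩
    have hmem : x - j • u ∈ latticeOf Λ σ := sub_mem hx (zsmul_mem hu j)
    refine AddSubgroup.mem_sup.2 ⟨x - j • u, mem_latticeOf.2 ⟨(mem_latticeOf.1 hmem).1,
      hker _ (mem_latticeOf.1 hmem).2 ?_⟩, j • u, ⟨j, rfl⟩, by abel⟩
    rw [map_sub, map_zsmul, hj, zsmul_eq_mul, sub_self]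
  have hfeas : ∀ u ∈ vectorSpan ℝ σ, 0 < l u * l (y - ω) → u ∈ feasible ω σ := by
    intro u hu hpos
    have hlu : l u ≠ 0 := fun h => by simp [h] at hpos
    have hc : 0 < l u / l (y - ω) := by
      rw [← mul_div_mul_right _ _ hly]
      exact div_pos hpos (mul_self_pos.2 hly)
    have hg : u - (l u / l (y - ω)) • (y - ω) ∈ vectorSpan ℝ τ := by
      refine hker _ (Submodule.sub_mem _ hu (Submodule.smul_mem _ _ hyσ)) ?_
      rw [map_sub, map_smul, smul_eq_mul, div_mul_cancel₀ _ hly, sub_self]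
    have := add_mem_feasible_of_relInt hσ.convex hsub hω
      (smul_mem_feasible hc (sub_mem_feasible hσ.convex (hsub hωτ) hy)) hg
    simpa using this
  have hu₀' := mem_latticeOf.1 hu₀
  rcases lt_or_gt_of_ne (mul_ne_zero hl0 hly) with h | h
  · refine ⟨-u₀, Λ.neg_mem hu₀'.1, hfeas _ (Submodule.neg_mem _ hu₀'.2) ?_,
      hsup _ (neg_mem hu₀) (.inr (by rw [map_neg]))⟩
    rw [map_neg]
    linarith
  · exact ⟨u₀, hu₀'.1, hfeas _ hu₀'.2 h, hsup _ hu₀ (.inl rfl)⟩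

theorem notMem_vectorSpan_of_sup_eq (hΛ : Submodule.span ℝ (Λ : Set V) = ⊤) {τ σ : Set V}
    (hσ : IsRationalPolyhedron Λ σ) (hd : dim τ < dim σ) {u : V}
    (hu : latticeOf Λ τ ⊔ AddSubgroup.zmultiples u = latticeOf Λ σ) : u ∉ vectorSpan ℝ τ := by
  intro h
  have : vectorSpan ℝ σ ≤ vectorSpan ℝ τ := by
    rw [← hσ.span_latticeOf hΛ, Submodule.span_le, ← hu]
    have : latticeOf Λ τ ⊔ AddSubgroup.zmultiples u ≤ (vectorSpan ℝ τ).toAddSubgroup :=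
      sup_le inf_le_right (by rw [AddSubgroup.zmultiples_le]; exact h)
    exact this
  have := Submodule.finrank_mono this
  unfold dim at hd
  omega

/-- The tangent cone of `σ` at a facet `τ` is the half-space spanned by a normal vector. -/
theorem add_smul_mem_feasible (hΛ : Submodule.span ℝ (Λ : Set V) = ⊤) {τ σ : Set V}
    (hτ : IsRationalPolyhedron Λ τ) (hσ : IsRationalPolyhedron Λ σ) (hf : IsFace σ τ)
    (hd : dim τ < dim σ) {u : V} (hu : u ∈ link τ σ)
    (hsup : latticeOf Λ τ ⊔ AddSubgroup.zmultiples u = latticeOf Λ σ) {q : V} (hq : q ∈ relInt τ)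
    {x : V} (hx : x ∈ vectorSpan ℝ τ) {c : ℝ} :
    (0 < c → x + c • u ∈ feasible q σ) ∧ (c < 0 → x + c • u ∉ feasible q σ) := by
  rw [link_eq_feasible hτ.convex hσ.convex hf.2.2.1 hq] at hu
  constructor
  · intro hc
    rw [add_comm]
    exact add_mem_feasible_of_relInt hσ.convex hf.2.2.1 hq (smul_mem_feasible hc hu) hx
  · intro hc h
    have h1 := add_mem_feasible_of_relInt hσ.convex hf.2.2.1 hq h (Submodule.neg_mem _ hx)
    have h2 : -u ∈ feasible q σ := by
      convert smul_mem_feasible (inv_pos.2 (neg_pos.2 hc)) h1 using 1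
      have := hc.ne
      match_scalars <;> field_simp
      simp
    obtain ⟨δ, ⟨h3, h4⟩, hδ : 0 < δ⟩ :=
      (((mem_feasible.1 hu).and (mem_feasible.1 h2)).and self_mem_nhdsWithin).exists
    have h5 : q + δ • u ∈ τ := by
      refine hf.2.2.2 h3 h4 (mem_relInt.1 hq).1 ⟨1 / 2, 1 / 2, by norm_num, by norm_num,
        by norm_num, by module⟩
    refine notMem_vectorSpan_of_sup_eq hΛ hσ hd hsup ?_
    refine mem_vectorSpan_of_feasible (mem_relInt.1 hq).1
      (mem_feasible_of_mem hτ.convex (mem_relInt.1 hq).1 hδ h5)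

end IsRationalPolyhedron

/-! ### Polyhedral complexes -/

namespace PolyComplex

theorem inter_mem (A : PolyComplex Λ) {σ τ : Set V} (hσ : σ ∈ A.cells) (hτ : τ ∈ A.cells)
    (h : (σ ∩ τ).Nonempty) : σ ∩ τ ∈ A.cells :=
  A.face_mem σ hσ _ (A.inter_face σ hσ τ hτ h)

theorem isFace_of_subset (A : PolyComplex Λ) {σ τ : Set V} (hσ : σ ∈ A.cells) (hτ : τ ∈ A.cells)
    (h : τ ⊆ σ) : IsFace σ τ := by
  have := A.inter_face σ hσ τ hτ (by
    rw [Set.inter_eq_right.2 h]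
    exact (A.polyhedron τ hτ).1)
  rwa [Set.inter_eq_right.2 h] at this

theorem subset_of_mem_relInt (A : PolyComplex Λ) {γ σ κ : Set V} (hσ : σ ∈ A.cells) (hγ : γ ⊆ σ)
    {x : V} (hx : x ∈ relInt γ) (hκ : κ ∈ A.cells) (hxκ : x ∈ κ) : γ ⊆ κ := by
  have hxσ := hγ (mem_relInt.1 hx).1
  exact (subset_of_isExtreme_of_relInt (A.inter_face σ hσ κ hκ ⟨x, hxσ, hxκ⟩).2.2 hγ hx
    ⟨hxσ, hxκ⟩).trans Set.inter_subset_right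

variable [FiniteDimensional ℝ V]

theorem eq_of_subset_of_dim_le (A : PolyComplex Λ) {σ τ : Set V} (hσ : σ ∈ A.cells)
    (hτ : τ ∈ A.cells) (h : τ ⊆ σ) (hd : dim σ ≤ dim τ) : τ = σ := by
  obtain ⟨x, hx⟩ := (A.polyhedron τ hτ).relInt_nonempty
  refine (A.isFace_of_subset hσ hτ h).eq_of_vectorSpan_le hx (le_of_eq ?_)
  exact (Submodule.eq_of_le_of_finrank_le (vectorSpan_mono ℝ h) hd).symm

/-- The smallest cell into which one moves from `x` in the direction `p`. -/
theorem exists_minimal_cell (A : PolyComplex Λ) {x p : V} (h : ∃ σ ∈ A.cells, p ∈ feasible x σ) :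
    ∃ κ ∈ A.cells, p ∈ feasible x κ ∧ (∀ σ ∈ A.cells, p ∈ feasible x σ → κ ⊆ σ) ∧
      ∀ᶠ ε in 𝓝[>] (0 : ℝ), x + ε • p ∈ relInt κ := by
  classical
  obtain ⟨σ₀, hσ₀, hp₀⟩ := h
  obtain ⟨κ, hκ⟩ := (A.cells.filter fun σ => p ∈ feasible x σ).exists_minimal
    ⟨σ₀, Finset.mem_filter.2 ⟨hσ₀, hp₀⟩⟩
  obtain ⟨hκA, hpκ⟩ := Finset.mem_filter.1 hκ.1
  have hmin : ∀ σ ∈ A.cells, p ∈ feasible x σ → κ ⊆ σ := by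
    intro σ hσ hpσ
    have hne : (κ ∩ σ).Nonempty := ⟨x, mem_of_feasible (A.polyhedron κ hκA).isClosed hpκ,
      mem_of_feasible (A.polyhedron σ hσ).isClosed hpσ⟩
    have := hκ.2 (y := κ ∩ σ) (Finset.mem_filter.2 ⟨A.inter_mem hκA hσ hne, by
      rw [feasible_inter]; exact ⟨hpκ, hpσ⟩⟩) Set.inter_subset_left
    exact fun y hy => (this hy).2
  refine ⟨κ, hκA, hpκ, hmin, ?_⟩
  have hκc := (A.polyhedron κ hκA).convex
  have hx := mem_of_feasible (A.polyhedron κ hκA).isClosed hpκ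
  obtain ⟨δ, hδ, hδm⟩ := (mem_feasible_iff hκc hx).1 hpκ
  filter_upwards [Ioo_mem_nhdsGT hδ] with s ⟨hs, hsδ⟩
  have hq : x + s • p ∈ κ := shrink_mem hκc hx hs hsδ.le hδm
  -- The face generated by x + s • p contains x, since the segment from x goes on inside κ. So p
  -- points from x into this face, and minimality of κ forces the face to be all of κ.
  have hF : IsFace κ (faceHull κ {x + s • p}) :=
    isFace_faceHull hκc (by simpa using hq) (convex_singleton _) (Set.singleton_nonempty _)
  have hxF : x ∈ faceHull κ {x + s • p} := by
    refine ⟨hx, _, rfl, (δ - s) / s, div_pos (sub_pos.2 hsδ) hs, ?_⟩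
    convert hδm using 1
    match_scalars <;> field_simp <;> ring
  have hqF : x + s • p ∈ faceHull κ {x + s • p} :=
    ⟨hq, _, rfl, 1, one_pos, by simpa using hq⟩
  exact mem_relInt_of_faceHull hκc hq
    (hmin _ (A.face_mem κ hκA _ hF) (mem_feasible_of_mem hF.2.1 hxF hs hqF))

end PolyComplex

end

section

/-! ### The link of a tropical cycle as a balanced family -/

namespace WeightedComplex

variable {V : Type*} [NormedAddCommGroup V] [NormedSpace ℝ V] {Λ : Submodule ℤ V}

theorem mem_facets {X : WeightedComplex Λ} {σ : Set V} :
    σ ∈ X.facets ↔ σ ∈ X.cells ∧ dim σ + X.codim = finrank ℝ V := by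
  classical
  exact Finset.mem_filter

variable [FiniteDimensional ℝ V]

-- Let κ be the smallest cell entered from ω in direction p. A small point ω + s • p is relative
-- interior to κ, and the tangent cones there equal those of the cones `feasible ω σ` at p. If κ is
-- a facet, p is an interior point; if κ is a ridge, the balancing condition of X at κ applies; a
-- smaller κ has p in its direction space, which is excluded.
open Classical in
theorem linkFamily_point (X : WeightedComplex Λ) (hX : X.IsTropicalCycle)
    (hΛ : Submodule.span ℝ (Λ : Set V) = ⊤) {γ σ₀ : Set V} (hσ₀ : σ₀ ∈ X.cells) (hγ : γ ⊆ σ₀)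
    {ω : V} (hω : ω ∈ relInt γ) {p : V}
    (hp : ∀ κ ∈ X.cells, dim κ + X.codim + 2 ≤ finrank ℝ V → p ∉ vectorSpan ℝ κ)
    (hex : ∃ σ ∈ X.facets.filter (fun σ => γ ⊆ σ), p ∈ feasible ω σ) :
    IsInteriorPoint (X.facets.filter fun σ => γ ⊆ σ) (feasible ω) (latticeOf Λ) p ∨
      ∃ τ ∈ X.cells, dim τ + X.codim + 1 = finrank ℝ V ∧ ∃ u,
        IsWallPoint (X.facets.filter fun σ => γ ⊆ σ) (feasible ω) (latticeOf Λ)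
          (fun σ => (X.mult σ : ℝ)) p (latticeOf Λ τ) u := by
  obtain ⟨σ₁, hσ₁, hp₁⟩ := hex
  obtain ⟨hσ₁, -⟩ := Finset.mem_filter.1 hσ₁
  obtain ⟨hσ₁c, hσ₁d⟩ := mem_facets.1 hσ₁
  obtain ⟨κ, hκ, hpκ, hmin, hev⟩ := X.exists_minimal_cell ⟨σ₁, hσ₁c, hp₁⟩
  have hκp := X.polyhedron κ hκ
  have hωκ := mem_of_feasible hκp.isClosed hpκ
  have hγκ : γ ⊆ κ := X.subset_of_mem_relInt hσ₀ hγ hω hκ hωκ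
  have hpκ' : p ∈ vectorSpan ℝ κ := mem_vectorSpan_of_feasible hωκ hpκ
  have hle : dim κ ≤ dim σ₁ := Submodule.finrank_mono (vectorSpan_mono ℝ (hmin σ₁ hσ₁c hp₁))
  have hnb : ¬ dim κ + X.codim + 2 ≤ finrank ℝ V := fun h => hp κ hκ h hpκ'
  have hmem : ∀ σ ∈ X.facets.filter (fun σ => γ ⊆ σ), p ∈ feasible ω σ →
      σ ∈ X.cells ∧ dim σ + X.codim = finrank ℝ V ∧ κ ⊆ σ := by
    intro σ hσ hpσ
    obtain ⟨hσ, -⟩ := Finset.mem_filter.1 hσ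
    obtain ⟨hσc, hσd⟩ := mem_facets.1 hσ
    exact ⟨hσc, hσd, hmin σ hσc hpσ⟩
  rcases (show dim κ + X.codim = finrank ℝ V ∨ dim κ + X.codim + 1 = finrank ℝ V by omega) with
    hd | hd
  · refine .inl ⟨κ, Finset.mem_filter.2 ⟨mem_facets.2 ⟨hκ, hd⟩, hγκ⟩, hpκ, ?_, ?_⟩
    · intro σ hσ hpσ
      obtain ⟨hσc, hσd, hκσ⟩ := hmem σ hσ hpσ
      exact (X.eq_of_subset_of_dim_le hσc hκ hκσ (by omega)).symm
    · intro x hx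
      rw [hκp.span_latticeOf hΛ] at hx
      obtain ⟨s, hs1, hs2⟩ := (hev.and (hκp.eventually_feasible hpκ)).exists
      rw [← hs2]
      exact (mem_relInt.1 hs1).2 x hx
  · obtain ⟨u, hu, hbal⟩ := hX κ hκ hd
    have hwall : ∀ σ ∈ X.facets.filter (fun σ => γ ⊆ σ), p ∈ feasible ω σ →
        ∀ x ∈ vectorSpan ℝ κ, ∀ c : ℝ, (0 < c → x + c • u σ ∈ feasible p (feasible ω σ)) ∧
          (c < 0 → x + c • u σ ∉ feasible p (feasible ω σ)) := by
      intro σ hσ hpσ x hx c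
      obtain ⟨hσc, hσd, hκσ⟩ := hmem σ hσ hpσ
      have hσp := X.polyhedron σ hσc
      obtain ⟨-, hul, hus⟩ := hu σ (mem_facets.2 ⟨hσc, hσd⟩) hκσ
      obtain ⟨s, hs1, hs2⟩ := (hev.and (hσp.eventually_feasible hpσ)).exists
      rw [← hs2]
      exact hκp.add_smul_mem_feasible hΛ hσp (X.isFace_of_subset hσc hκ hκσ) (by omega) hul hus
        hs1 hx
    refine .inr ⟨κ, hκ, hd, u, ?_, ?_, ?_, ?_, ?_⟩
    · rwa [hκp.span_latticeOf hΛ]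
    · intro σ hσ hpσ
      obtain ⟨hσc, hσd, hκσ⟩ := hmem σ hσ hpσ
      exact (hu σ (mem_facets.2 ⟨hσc, hσd⟩) hκσ).2.2
    · intro σ hσ hpσ x hx c hc
      rw [hκp.span_latticeOf hΛ] at hx
      exact (hwall σ hσ hpσ x hx c).1 hc
    · intro σ hσ hpσ x hx c hc
      rw [hκp.span_latticeOf hΛ] at hx
      exact (hwall σ hσ hpσ x hx c).2 hc
    · convert hbal using 1
      refine Finset.sum_congr ?_ fun _ _ => rfl
      ext σ
      simp only [Finset.mem_filter]
      constructor
      · rintro ⟨⟨h1, h2⟩, h3⟩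
        exact ⟨h1, (hmem σ (Finset.mem_filter.2 ⟨h1, h2⟩) h3).2.2⟩
      · rintro ⟨h1, h2⟩
        exact ⟨⟨h1, hγκ.trans h2⟩, feasible_mono ω h2 hpκ⟩

open Classical in
/-- The tangent cones at `ω` of the facets of a tropical cycle that contain `γ`, where `ω` is a
relative interior point of `γ`. -/
noncomputable def linkFamily (X : WeightedComplex Λ) (hX : X.IsTropicalCycle)
    (hΛ : Submodule.span ℝ (Λ : Set V) = ⊤) {γ σ₀ : Set V} (hσ₀ : σ₀ ∈ X.cells) (hγ : γ ⊆ σ₀)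
    {ω : V} (hω : ω ∈ relInt γ) : BalancedFamily (Set V) V where
  I := X.facets.filter fun σ => γ ⊆ σ
  C := feasible ω
  N := latticeOf Λ
  m := fun σ => X.mult σ
  d := finrank ℝ V - X.codim
  walls := vectorSpan ℝ '' {τ | τ ∈ X.cells ∧ dim τ + X.codim + 1 = finrank ℝ V}
  bad := vectorSpan ℝ '' {τ | τ ∈ X.cells ∧ dim τ + X.codim + 2 ≤ finrank ℝ V}
  walls_finite := (X.cells.finite_toSet.subset fun _ h => h.1).image _
  bad_finite := (X.cells.finite_toSet.subset fun _ h => h.1).image _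
  closed σ hσ := (X.polyhedron σ (mem_facets.1 (Finset.mem_filter.1 hσ).1).1).isClosed_feasible ω
  convex σ hσ := convex_feasible
    (X.polyhedron σ (mem_facets.1 (Finset.mem_filter.1 hσ).1).1).convex ω
  subset_span := by
    intro σ hσ x hx
    obtain ⟨h1, h2⟩ := Finset.mem_filter.1 hσ
    have hp := X.polyhedron σ (mem_facets.1 h1).1
    rw [hp.span_latticeOf hΛ]
    exact mem_vectorSpan_of_feasible (h2 (mem_relInt.1 hω).1) hx
  finrank_span := by
    intro σ hσ
    obtain ⟨h1, h2⟩ := Finset.mem_filter.1 hσ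
    have hp := X.polyhedron σ (mem_facets.1 h1).1
    rw [hp.span_latticeOf hΛ]
    have := (mem_facets.1 h1).2
    unfold dim at this
    omega
  finrank_walls := by
    rintro _ ⟨τ, ⟨-, h⟩, rfl⟩
    unfold dim at h
    omega
  finrank_bad := by
    rintro _ ⟨τ, ⟨-, h⟩, rfl⟩
    unfold dim at h
    omega
  point := by
    intro p hp hex
    rcases X.linkFamily_point hX hΛ hσ₀ hγ hω (fun κ hκ hd => hp _ ⟨κ, ⟨hκ, hd⟩, rfl⟩) hex with
      h | ⟨τ, hτ, hd, u, h⟩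
    · exact .inl h
    · refine .inr ⟨latticeOf Λ τ, u, ⟨τ, ⟨hτ, hd⟩, ?_⟩, h⟩
      rw [(X.polyhedron τ hτ).span_latticeOf hΛ]

end WeightedComplex

end

/-! ### Indices of images of product lattices -/

section Index

/-- The group K ⊔ L ⊓ ker φ between K and L splits the index into an image part and a kernel part.
-/
theorem relIndex_eq_map_mul {A B : Type*} [AddCommGroup A] [AddCommGroup B] (φ : A →+ B)
    {K L : AddSubgroup A} (h : K ≤ L) :
    K.relIndex L = (K.map φ).relIndex (L.map φ) * K.relIndex (L ⊓ φ.ker) := by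
  have h1 : K ≤ K ⊔ L ⊓ φ.ker := le_sup_left
  have h2 : K ⊔ L ⊓ φ.ker ≤ L := sup_le h inf_le_left
  rw [← AddSubgroup.relIndex_mul_relIndex _ _ _ h1 h2, mul_comm]
  congr 1
  · rw [← AddSubgroup.relIndex_comap, AddSubgroup.comap_map_eq,
      ← AddSubgroup.inf_relIndex_right (K ⊔ φ.ker), sup_inf_assoc_of_le _ h, inf_comm]
  · rw [sup_comm, AddSubgroup.relIndex_sup_right]

variable {V : Type*} [AddCommGroup V] [Module ℝ V]

/-- The map `(x, y, z) ↦ (x - y, y - z)`. -/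
def tripleDiff (V : Type*) [AddCommGroup V] [Module ℝ V] : V × V × V →ₗ[ℝ] V × V :=
  (LinearMap.fst ℝ V (V × V) - LinearMap.fst ℝ V V ∘ₗ LinearMap.snd ℝ V (V × V)).prod
    ((LinearMap.fst ℝ V V - LinearMap.snd ℝ V V) ∘ₗ LinearMap.snd ℝ V (V × V))

variable {A B C L : AddSubgroup V}

theorem mem_map_tripleDiff {f : V × V} :
    f ∈ (A.prod (B.prod C)).map (tripleDiff V).toAddMonoidHom ↔
      ∃ x ∈ A, ∃ y ∈ B, ∃ z ∈ C, x - y = f.1 ∧ y - z = f.2 := by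
  constructor
  · rintro ⟨⟨x, y, z⟩, ⟨hx, hy, hz⟩, rfl⟩
    exact ⟨x, hx, y, hy, z, hz, rfl, rfl⟩
  · rintro ⟨x, hx, y, hy, z, hz, h1, h2⟩
    exact ⟨(x, y, z), ⟨hx, hy, hz⟩, Prod.ext h1 h2⟩

theorem map_tripleDiff_le (hA : A ≤ L) (hB : B ≤ L) (hC : C ≤ L) :
    (A.prod (B.prod C)).map (tripleDiff V).toAddMonoidHom ≤ L.prod L := by
  intro f hf
  obtain ⟨x, hx, y, hy, z, hz, h1, h2⟩ := mem_map_tripleDiff.1 hf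
  exact ⟨by rw [← h1]; exact L.sub_mem (hA hx) (hB hy), by rw [← h2]; exact L.sub_mem (hB hy) (hC hz)⟩

theorem relIndex_map_tripleDiff (hA : A ≤ L) (hB : B ≤ L) (hC : C ≤ L) :
    ((A.prod (B.prod C)).map (tripleDiff V).toAddMonoidHom).relIndex (L.prod L) =
      (A ⊔ B).relIndex L * (A ⊓ B ⊔ C).relIndex L := by
  rw [relIndex_eq_map_mul (AddMonoidHom.fst V V) (map_tripleDiff_le hA hB hC)]
  congr 1
  · congr 1
    · ext v
      rw [AddSubgroup.mem_sup]
      constructor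
      · rintro ⟨f, hf, rfl⟩
        obtain ⟨x, hx, y, hy, z, hz, h1, h2⟩ := mem_map_tripleDiff.1 hf
        exact ⟨x, hx, -y, neg_mem hy, by rw [← sub_eq_add_neg]; exact h1⟩
      · rintro ⟨x, hx, y, hy, rfl⟩
        exact ⟨(x + y, -y), mem_map_tripleDiff.2 ⟨x, hx, -y, neg_mem hy, 0, zero_mem _, by simp,
          by simp⟩, rfl⟩
    · ext v
      exact ⟨fun ⟨f, hf, h⟩ => h ▸ hf.1, fun h => ⟨(v, 0), ⟨h, zero_mem _⟩, rfl⟩⟩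
  · have e : L.prod L ⊓ (AddMonoidHom.fst V V).ker = L.map (AddMonoidHom.inr V V) := by
      ext ⟨v, w⟩
      constructor
      · rintro ⟨h1, h2⟩
        exact ⟨w, h1.2, Prod.ext (Eq.symm h2) rfl⟩
      · rintro ⟨w', h, e⟩
        obtain ⟨rfl, rfl⟩ := Prod.ext_iff.1 e
        exact ⟨⟨zero_mem _, h⟩, rfl⟩
    rw [e, ← AddSubgroup.relIndex_comap]
    congr 1
    ext w
    rw [AddSubgroup.mem_comap, mem_map_tripleDiff, AddSubgroup.mem_sup]
    constructor
    · rintro ⟨x, hx, y, hy, z, hz, h1, h2⟩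
      have h1 : x = y := sub_eq_zero.1 h1
      subst h1
      exact ⟨x, ⟨hx, hy⟩, -z, neg_mem hz, by rw [← sub_eq_add_neg]; exact h2⟩
    · rintro ⟨x, ⟨hx, hy⟩, z, hz, rfl⟩
      exact ⟨x, hx, x, hy, -z, neg_mem hz, by simp, by simp⟩

/-- Here the second coordinate is projected out instead of the first. That the two factorizations
compute the same index is the lattice form of associativity. -/
theorem relIndex_map_tripleDiff' (hA : A ≤ L) (hB : B ≤ L) (hC : C ≤ L) :
    ((A.prod (B.prod C)).map (tripleDiff V).toAddMonoidHom).relIndex (L.prod L) =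
      (B ⊔ C).relIndex L * (A ⊔ B ⊓ C).relIndex L := by
  rw [relIndex_eq_map_mul (AddMonoidHom.snd V V) (map_tripleDiff_le hA hB hC)]
  congr 1
  · congr 1
    · ext v
      rw [AddSubgroup.mem_sup]
      constructor
      · rintro ⟨f, hf, rfl⟩
        obtain ⟨x, hx, y, hy, z, hz, h1, h2⟩ := mem_map_tripleDiff.1 hf
        exact ⟨y, hy, -z, neg_mem hz, by rw [← sub_eq_add_neg]; exact h2⟩
      · rintro ⟨x, hx, y, hy, rfl⟩
        exact ⟨(-x, x + y), mem_map_tripleDiff.2 ⟨0, zero_mem _, x, hx, -y, neg_mem hy, by simp,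
          by simp⟩, rfl⟩
    · ext v
      exact ⟨fun ⟨f, hf, h⟩ => h ▸ hf.2, fun h => ⟨(0, v), ⟨zero_mem _, h⟩, rfl⟩⟩
  · have e : L.prod L ⊓ (AddMonoidHom.snd V V).ker = L.map (AddMonoidHom.inl V V) := by
      ext ⟨v, w⟩
      constructor
      · rintro ⟨h1, h2⟩
        exact ⟨v, h1.1, Prod.ext rfl (Eq.symm h2)⟩
      · rintro ⟨w', h, e⟩
        obtain ⟨rfl, rfl⟩ := Prod.ext_iff.1 e
        exact ⟨⟨h, zero_mem _⟩, rfl⟩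
    rw [e, ← AddSubgroup.relIndex_comap]
    congr 1
    ext w
    rw [AddSubgroup.mem_comap, mem_map_tripleDiff, AddSubgroup.mem_sup]
    constructor
    · rintro ⟨x, hx, y, hy, z, hz, h1, h2⟩
      have h2 : y = z := sub_eq_zero.1 h2
      subst h2
      exact ⟨x, hx, -y, ⟨B.neg_mem hy, C.neg_mem hz⟩, by rw [← sub_eq_add_neg]; exact h1⟩
    · rintro ⟨x, hx, z, ⟨hz, hz'⟩, rfl⟩
      exact ⟨x, hx, -z, neg_mem hz, -z, neg_mem hz', by simp, by simp⟩

theorem map_fst_sub_snd (A B : AddSubgroup V) :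
    (A.prod B).map (LinearMap.fst ℝ V V - LinearMap.snd ℝ V V).toAddMonoidHom = A ⊔ B := by
  ext v
  rw [AddSubgroup.mem_sup]
  constructor
  · rintro ⟨⟨x, y⟩, ⟨hx, hy⟩, rfl⟩
    exact ⟨x, hx, -y, neg_mem hy, (sub_eq_add_neg x y).symm⟩
  · rintro ⟨x, hx, y, hy, rfl⟩
    exact ⟨(x, -y), ⟨hx, B.neg_mem hy⟩, sub_neg_eq_add x y⟩

end Index

/-! ### Generic constancy of the local intersection multiplicities -/

section Constancy

variable {V : Type*} [NormedAddCommGroup V] [NormedSpace ℝ V] {Λ : Submodule ℤ V}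

theorem linkDiffMult_eq_feasible [FiniteDimensional ℝ V] (X Y : WeightedComplex Λ) {γ : Set V}
    (hγ : Convex ℝ γ) {ω : V} (hω : ω ∈ relInt γ) (v : V) [DecidablePred fun σ => γ ⊆ σ]
    [∀ σ τ, Decidable (v ∈ feasible ω σ - feasible ω τ)] :
    linkDiffMult X Y γ v = ∑ σ ∈ X.facets.filter (fun σ => γ ⊆ σ),
      ∑ τ ∈ Y.facets.filter (fun τ => γ ⊆ τ), if v ∈ feasible ω σ - feasible ω τ then
        X.mult σ * Y.mult τ * ((latticeOf Λ σ ⊔ latticeOf Λ τ).relIndex Λ.toAddSubgroup : ℚ)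
      else 0 := by
  unfold linkDiffMult
  refine Finset.sum_congr (by congr!) fun σ hσ => Finset.sum_congr (by congr!) fun τ hτ => ?_
  rw [Finset.mem_filter] at hσ hτ
  rw [link_eq_feasible hγ (X.polyhedron σ (WeightedComplex.mem_facets.1 hσ.1).1).convex hσ.2 hω,
    link_eq_feasible hγ (Y.polyhedron τ (WeightedComplex.mem_facets.1 hτ.1).1).convex hτ.2 hω]
  congr

open Classical in
/-- The multiplicity at `f` of the push-forward of the link of `X × Y × Z` by
`(x, y, z) ↦ (x - y, y - z)`. -/
noncomputable def tripleMult (X Y Z : WeightedComplex Λ) (γ : Set V) (ω : V) (f : V × V) : ℚ :=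
  ∑ σ ∈ X.facets.filter (fun σ => γ ⊆ σ), ∑ τ ∈ Y.facets.filter (fun τ => γ ⊆ τ),
    ∑ ρ ∈ Z.facets.filter (fun ρ => γ ⊆ ρ),
      if ∃ x ∈ feasible ω σ, ∃ y ∈ feasible ω τ, ∃ z ∈ feasible ω ρ, x - y = f.1 ∧ y - z = f.2 then
        X.mult σ * Y.mult τ * Z.mult ρ *
          ((latticeOf Λ σ ⊔ latticeOf Λ τ).relIndex Λ.toAddSubgroup *
            (latticeOf Λ σ ⊓ latticeOf Λ τ ⊔ latticeOf Λ ρ).relIndex Λ.toAddSubgroup : ℕ)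
      else 0

/-- Exchanging x and z sends (x − y, y − z) to its negated swap; the weights agree by the two
factorizations of the index. -/
theorem tripleMult_symm (X Y Z : WeightedComplex Λ) (γ : Set V) (ω : V) (v w : V) :
    tripleMult Z Y X γ ω (-w, -v) = tripleMult X Y Z γ ω (v, w) := by
  classical
  unfold tripleMult
  rw [Finset.sum_comm]
  conv_rhs => rw [Finset.sum_comm]
  refine Finset.sum_congr rfl fun τ _ => ?_
  rw [Finset.sum_comm]
  refine Finset.sum_congr rfl fun σ _ => Finset.sum_congr rfl fun ρ _ => ?_
  have h1 : (latticeOf Λ ρ ⊔ latticeOf Λ τ).relIndex Λ.toAddSubgroup *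
      (latticeOf Λ ρ ⊓ latticeOf Λ τ ⊔ latticeOf Λ σ).relIndex Λ.toAddSubgroup =
      (latticeOf Λ σ ⊔ latticeOf Λ τ).relIndex Λ.toAddSubgroup *
      (latticeOf Λ σ ⊓ latticeOf Λ τ ⊔ latticeOf Λ ρ).relIndex Λ.toAddSubgroup := by
    rw [← relIndex_map_tripleDiff (latticeOf_le σ) (latticeOf_le τ) (latticeOf_le ρ),
      relIndex_map_tripleDiff' (latticeOf_le σ) (latticeOf_le τ) (latticeOf_le ρ),
      sup_comm (latticeOf Λ ρ), inf_comm (latticeOf Λ ρ), sup_comm _ (latticeOf Λ σ)]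
  have h2 : (∃ x ∈ feasible ω ρ, ∃ y ∈ feasible ω τ, ∃ z ∈ feasible ω σ, x - y = -w ∧ y - z = -v) ↔
      ∃ x ∈ feasible ω σ, ∃ y ∈ feasible ω τ, ∃ z ∈ feasible ω ρ, x - y = v ∧ y - z = w := by
    constructor
    · rintro ⟨x, hx, y, hy, z, hz, e1, e2⟩
      exact ⟨z, hz, y, hy, x, hx, by rw [← neg_inj, neg_sub, e2], by rw [← neg_inj, neg_sub, e1]⟩
    · rintro ⟨x, hx, y, hy, z, hz, e1, e2⟩
      exact ⟨z, hz, y, hy, x, hx, by rw [← e2, neg_sub], by rw [← e1, neg_sub]⟩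
  simp only [h1, h2]
  split_ifs <;> ring

variable [FiniteDimensional ℝ V]

theorem exists_rat_eq_of_eventually {E : Type*} [AddCommGroup E] [Module ℝ E] {φ : E → ℚ} {c : ℝ}
    (h : ∀ᶠ f in generic E, (φ f : ℝ) = c) : ∃ q : ℚ, ∀ᶠ f in generic E, φ f = q := by
  obtain ⟨f₀, hf₀⟩ := h.exists
  refine ⟨φ f₀, ?_⟩
  filter_upwards [h] with f hf
  exact_mod_cast hf.trans hf₀.symm

theorem finrank_map_of_injective {E F : Type*} [AddCommGroup E] [Module ℝ E] [AddCommGroup F]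
    [Module ℝ F] (f : E →ₗ[ℝ] F) (hf : Function.Injective f) (S : Submodule ℝ E) :
    finrank ℝ (S.map f) = finrank ℝ S :=
  (LinearEquiv.finrank_eq (Submodule.equivMapOfInjective f hf S)).symm

/-- Constancy of the degree for the product of two links under (x, y) ↦ x − y. The lineality space
is the diagonal copy of the span of γ, and `hd` is exactly the required equality of dimensions. -/
theorem exists_linkDiffMult_eq (hΛ : Submodule.span ℝ (Λ : Set V) = ⊤) {X Y : WeightedComplex Λ}
    (hX : X.IsTropicalCycle) (hY : Y.IsTropicalCycle) {γ σ₀ τ₀ : Set V} (hγ : Convex ℝ γ)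
    (hne : γ.Nonempty) (hσ₀ : σ₀ ∈ X.cells) (hγσ : γ ⊆ σ₀) (hτ₀ : τ₀ ∈ Y.cells) (hγτ : γ ⊆ τ₀)
    (hd : dim γ + (X.codim + Y.codim) = finrank ℝ V) :
    ∃ c : ℚ, ∀ᶠ v in generic V, linkDiffMult X Y γ v = c := by
  classical
  obtain ⟨ω, hω⟩ := relInt_nonempty hγ hne
  set B := (X.linkFamily hX hΛ hσ₀ hγσ hω).prod (Y.linkFamily hY hΛ hτ₀ hγτ hω) with hB
  set δ : V →ₗ[ℝ] V × V := LinearMap.id.prod LinearMap.id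
  have hδ : Function.Injective δ := fun x y h => congrArg Prod.fst h
  have hI : ∀ i ∈ B.I, (i.1 ∈ X.facets ∧ γ ⊆ i.1) ∧ (i.2 ∈ Y.facets ∧ γ ⊆ i.2) := by
    intro i hi
    exact ⟨Finset.mem_filter.1 (Finset.mem_product.1 hi).1,
      Finset.mem_filter.1 (Finset.mem_product.1 hi).2⟩
  have hpX : ∀ i ∈ X.facets, IsRationalPolyhedron Λ i := fun i hi =>
    X.polyhedron i (WeightedComplex.mem_facets.1 hi).1
  have hpY : ∀ i ∈ Y.facets, IsRationalPolyhedron Λ i := fun i hi =>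
    Y.polyhedron i (WeightedComplex.mem_facets.1 hi).1
  obtain ⟨c, hc⟩ := B.exists_degree_eq (LinearMap.fst ℝ V V - LinearMap.snd ℝ V V)
    ((vectorSpan ℝ γ).map δ) Λ.toAddSubgroup hΛ
    (by
      rw [finrank_map_of_injective δ hδ]
      change finrank ℝ V - X.codim + (finrank ℝ V - Y.codim) = _
      unfold dim at hd
      omega)
    (by
      rintro _ ⟨g, -, rfl⟩
      exact sub_self g)
    (by
      intro i hi
      obtain ⟨⟨h1, h2⟩, h3, h4⟩ := hI i hi
      change _ ≤ Submodule.span ℝ ((latticeOf Λ i.1).prod (latticeOf Λ i.2) : Set (V × V))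
      rw [span_prod_eq, (hpX _ h1).span_latticeOf hΛ, (hpY _ h3).span_latticeOf hΛ]
      rintro _ ⟨g, hg, rfl⟩
      exact ⟨vectorSpan_mono ℝ h2 hg, vectorSpan_mono ℝ h4 hg⟩)
    (by
      rintro i hi x ⟨hx, hx'⟩ _ ⟨g, hg, rfl⟩
      obtain ⟨⟨h1, h2⟩, h3, h4⟩ := hI i hi
      exact ⟨add_mem_feasible_of_relInt (hpX _ h1).convex h2 hω hx hg,
        add_mem_feasible_of_relInt (hpY _ h3).convex h4 hω hx' hg⟩)
    (by
      intro i hi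
      change ((latticeOf Λ i.1).prod (latticeOf Λ i.2)).map _ ≤ _
      rw [map_fst_sub_snd]
      exact sup_le (latticeOf_le _) (latticeOf_le _))
  refine exists_rat_eq_of_eventually (c := c) ?_
  filter_upwards [hc] with v hv
  rw [← hv, linkDiffMult_eq_feasible X Y hγ hω, BalancedFamily.degree]
  change _ = ∑ i ∈ (X.facets.filter fun σ => γ ⊆ σ) ×ˢ (Y.facets.filter fun σ => γ ⊆ σ), _
  rw [Finset.sum_product]
  push_cast
  refine Finset.sum_congr rfl fun σ _ => Finset.sum_congr rfl fun τ _ => ?_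
  have h1 : v ∈ (LinearMap.fst ℝ V V - LinearMap.snd ℝ V V) '' B.C (σ, τ) ↔
      v ∈ feasible ω σ - feasible ω τ := by
    rw [Set.mem_sub]
    constructor
    · rintro ⟨⟨x, y⟩, ⟨hx, hy⟩, rfl⟩
      exact ⟨x, hx, y, hy, rfl⟩
    · rintro ⟨x, hx, y, hy, rfl⟩
      exact ⟨(x, y), ⟨hx, hy⟩, rfl⟩
  have h2 : (B.N (σ, τ)).map (LinearMap.fst ℝ V V - LinearMap.snd ℝ V V).toAddMonoidHom =
      latticeOf Λ σ ⊔ latticeOf Λ τ := map_fst_sub_snd _ _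
  have h3 : B.m (σ, τ) = (X.mult σ : ℝ) * (Y.mult τ : ℝ) := rfl
  simp only [h1, h2, h3]
  split_ifs <;> simp

/-- The three-factor analogue, with the span of γ embedded diagonally: the source cones have
dimension 3n minus the three codimensions, which is 2n + dim γ for n the rank. -/
theorem exists_tripleMult_eq (hΛ : Submodule.span ℝ (Λ : Set V) = ⊤) {X Y Z : WeightedComplex Λ}
    (hX : X.IsTropicalCycle) (hY : Y.IsTropicalCycle) (hZ : Z.IsTropicalCycle)
    {γ σ₀ τ₀ ρ₀ : Set V} {ω : V} (hω : ω ∈ relInt γ) (hσ₀ : σ₀ ∈ X.cells)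
    (hγσ : γ ⊆ σ₀) (hτ₀ : τ₀ ∈ Y.cells) (hγτ : γ ⊆ τ₀) (hρ₀ : ρ₀ ∈ Z.cells) (hγρ : γ ⊆ ρ₀)
    (hd : dim γ + (X.codim + Y.codim + Z.codim) = finrank ℝ V) :
    ∃ c : ℚ, ∀ᶠ f in generic (V × V), tripleMult X Y Z γ ω f = c := by
  classical
  set B := (X.linkFamily hX hΛ hσ₀ hγσ hω).prod
    ((Y.linkFamily hY hΛ hτ₀ hγτ hω).prod (Z.linkFamily hZ hΛ hρ₀ hγρ hω)) with hB
  set δ : V →ₗ[ℝ] V × V × V := LinearMap.id.prod (LinearMap.id.prod LinearMap.id)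
  have hδ : Function.Injective δ := fun x y h => congrArg Prod.fst h
  have hI : ∀ i ∈ B.I, (i.1 ∈ X.facets ∧ γ ⊆ i.1) ∧ (i.2.1 ∈ Y.facets ∧ γ ⊆ i.2.1) ∧
      (i.2.2 ∈ Z.facets ∧ γ ⊆ i.2.2) := by
    intro i hi
    have h := Finset.mem_product.1 (Finset.mem_product.1 hi).2
    exact ⟨Finset.mem_filter.1 (Finset.mem_product.1 hi).1, Finset.mem_filter.1 h.1,
      Finset.mem_filter.1 h.2⟩
  have hpX : ∀ i ∈ X.facets, IsRationalPolyhedron Λ i := fun i hi =>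
    X.polyhedron i (WeightedComplex.mem_facets.1 hi).1
  have hpY : ∀ i ∈ Y.facets, IsRationalPolyhedron Λ i := fun i hi =>
    Y.polyhedron i (WeightedComplex.mem_facets.1 hi).1
  have hpZ : ∀ i ∈ Z.facets, IsRationalPolyhedron Λ i := fun i hi =>
    Z.polyhedron i (WeightedComplex.mem_facets.1 hi).1
  obtain ⟨c, hc⟩ := B.exists_degree_eq (tripleDiff V)
    ((vectorSpan ℝ γ).map δ) (Λ.toAddSubgroup.prod Λ.toAddSubgroup)
    (by
      rw [span_prod_eq]
      change (Submodule.span ℝ (Λ : Set V)).prod (Submodule.span ℝ (Λ : Set V)) = ⊤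
      rw [hΛ, Submodule.prod_top])
    (by
      rw [finrank_map_of_injective δ hδ, finrank_prod]
      change finrank ℝ V - X.codim + (finrank ℝ V - Y.codim + (finrank ℝ V - Z.codim)) = _
      unfold dim at hd
      omega)
    (by
      rintro _ ⟨g, -, rfl⟩
      exact Prod.ext (sub_self g) (sub_self g))
    (by
      intro i hi
      obtain ⟨⟨h1, h2⟩, ⟨h3, h4⟩, h5, h6⟩ := hI i hi
      change _ ≤ Submodule.span ℝ ((latticeOf Λ i.1).prod
        ((latticeOf Λ i.2.1).prod (latticeOf Λ i.2.2)) : Set (V × V × V))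
      rw [span_prod_eq, span_prod_eq, (hpX _ h1).span_latticeOf hΛ, (hpY _ h3).span_latticeOf hΛ,
        (hpZ _ h5).span_latticeOf hΛ]
      rintro _ ⟨g, hg, rfl⟩
      exact ⟨vectorSpan_mono ℝ h2 hg, vectorSpan_mono ℝ h4 hg, vectorSpan_mono ℝ h6 hg⟩)
    (by
      rintro i hi x ⟨hx, hx', hx''⟩ _ ⟨g, hg, rfl⟩
      obtain ⟨⟨h1, h2⟩, ⟨h3, h4⟩, h5, h6⟩ := hI i hi
      exact ⟨add_mem_feasible_of_relInt (hpX _ h1).convex h2 hω hx hg,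
        add_mem_feasible_of_relInt (hpY _ h3).convex h4 hω hx' hg,
        add_mem_feasible_of_relInt (hpZ _ h5).convex h6 hω hx'' hg⟩)
    (fun i _ => map_tripleDiff_le (latticeOf_le _) (latticeOf_le _) (latticeOf_le _))
  refine exists_rat_eq_of_eventually (c := c) ?_
  filter_upwards [hc] with f hf
  rw [← hf, tripleMult, BalancedFamily.degree]
  change _ = ∑ i ∈ (X.facets.filter fun σ => γ ⊆ σ) ×ˢ ((Y.facets.filter fun σ => γ ⊆ σ) ×ˢ
    (Z.facets.filter fun σ => γ ⊆ σ)), _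
  rw [Finset.sum_product]
  simp only [Finset.sum_product]
  push_cast
  refine Finset.sum_congr rfl fun σ _ => Finset.sum_congr rfl fun τ _ =>
    Finset.sum_congr rfl fun ρ _ => ?_
  have h1 : f ∈ tripleDiff V '' B.C (σ, τ, ρ) ↔ ∃ x ∈ feasible ω σ, ∃ y ∈ feasible ω τ,
      ∃ z ∈ feasible ω ρ, x - y = f.1 ∧ y - z = f.2 := by
    constructor
    · rintro ⟨⟨x, y, z⟩, ⟨hx, hy, hz⟩, rfl⟩
      exact ⟨x, hx, y, hy, z, hz, rfl, rfl⟩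
    · rintro ⟨x, hx, y, hy, z, hz, h1, h2⟩
      exact ⟨(x, y, z), ⟨hx, hy, hz⟩, Prod.ext h1 h2⟩
  have h2 : ((B.N (σ, τ, ρ)).map (tripleDiff V).toAddMonoidHom).relIndex
      (Λ.toAddSubgroup.prod Λ.toAddSubgroup) =
      (latticeOf Λ σ ⊔ latticeOf Λ τ).relIndex Λ.toAddSubgroup *
        (latticeOf Λ σ ⊓ latticeOf Λ τ ⊔ latticeOf Λ ρ).relIndex Λ.toAddSubgroup :=
    relIndex_map_tripleDiff (latticeOf_le _) (latticeOf_le _) (latticeOf_le _)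
  have h3 : B.m (σ, τ, ρ) = (X.mult σ : ℝ) * ((Y.mult τ : ℝ) * (Z.mult ρ : ℝ)) := rfl
  simp only [h1, h2, h3]
  split_ifs
  · push_cast
    ring
  · simp

end Constancy

section

variable {V : Type*} [NormedAddCommGroup V] [NormedSpace ℝ V] {Λ : Submodule ℤ V}

/-! ### Multiplicities and facets of stable intersections -/

theorem PolyComplex.mem_refine {A B : PolyComplex Λ} {δ : Set V} :
    δ ∈ (A.refine B).cells ↔ ∃ σ ∈ A.cells, ∃ τ ∈ B.cells, σ ∩ τ = δ ∧ δ.Nonempty := by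
  classical
  unfold PolyComplex.refine
  simp only [Finset.mem_filter, Finset.mem_image₂]
  constructor
  · rintro ⟨⟨σ, hσ, τ, hτ, h⟩, hne⟩
    exact ⟨σ, hσ, τ, hτ, h, hne⟩
  · rintro ⟨σ, hσ, τ, hτ, h, hne⟩
    exact ⟨⟨σ, hσ, τ, hτ, h⟩, hne⟩

theorem mem_cells_stableInter {X Y : WeightedComplex Λ} {δ : Set V} :
    δ ∈ (X.stableInter Y).cells ↔ δ ∈ (X.refine Y.toPolyComplex).cells ∧
      ∃ γ ∈ (X.refine Y.toPolyComplex).cells,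
        dim γ + (X.codim + Y.codim) = finrank ℝ V ∧ LinkDiffComplete X Y γ ∧ δ ⊆ γ := by
  classical
  exact Finset.mem_filter

theorem sup_vectorSpan_eq_top (hΛ : Submodule.span ℝ (Λ : Set V) = ⊤) {A B : AddSubgroup V}
    (h : (A ⊔ B).relIndex Λ.toAddSubgroup ≠ 0) {S T : Submodule ℝ V} (hA : (A : Set V) ⊆ S)
    (hB : (B : Set V) ⊆ T) : S ⊔ T = ⊤ := by
  rw [eq_top_iff, ← span_eq_top_of_relIndex_ne_zero (Λ := Λ.toAddSubgroup) hΛ h, Submodule.span_le]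
  have : A ⊔ B ≤ (S ⊔ T).toAddSubgroup :=
    sup_le (fun x hx => Submodule.mem_sup_left (hA hx)) fun x hx => Submodule.mem_sup_right (hB hx)
  exact this

theorem latticeOf_eq_inf {σ τ δ : Set V}
    (h : vectorSpan ℝ δ = vectorSpan ℝ σ ⊓ vectorSpan ℝ τ) :
    latticeOf Λ δ = latticeOf Λ σ ⊓ latticeOf Λ τ := by
  ext x
  rw [AddSubgroup.mem_inf, mem_latticeOf, mem_latticeOf, mem_latticeOf, h, Submodule.mem_inf]
  tauto

variable [FiniteDimensional ℝ V]

theorem mem_facets_stableInter {X Y : WeightedComplex Λ} {δ : Set V} :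
    δ ∈ (X.stableInter Y).facets ↔ δ ∈ (X.refine Y.toPolyComplex).cells ∧
      dim δ + (X.codim + Y.codim) = finrank ℝ V ∧ LinkDiffComplete X Y δ := by
  rw [WeightedComplex.mem_facets, mem_cells_stableInter]
  constructor
  · rintro ⟨⟨h1, γ, hγ, hd, hc, hδγ⟩, h2⟩
    have h2 : dim δ + (X.codim + Y.codim) = finrank ℝ V := h2
    obtain rfl := (X.refine Y.toPolyComplex).eq_of_subset_of_dim_le hγ h1 hδγ (by omega)
    exact ⟨h1, hd, hc⟩
  · rintro ⟨h1, h2, h3⟩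
    exact ⟨⟨h1, δ, h1, h2, h3, subset_rfl⟩, h2⟩

theorem stableMult_eq {X Y : WeightedComplex Λ} {γ : Set V} {c : ℚ}
    (h : ∀ᶠ v in generic V, linkDiffMult X Y γ v = c) : stableMult X Y γ = c := by
  have hex : ∃ m : ℚ, ∃ U : Set V, IsOpen U ∧ Dense U ∧ ∀ v ∈ U, linkDiffMult X Y γ v = m :=
    ⟨c, exists_isOpen_dense_of_generic h⟩
  unfold stableMult
  rw [dif_pos hex]
  obtain ⟨U, hU, hd, hUm⟩ := hex.choose_spec
  obtain ⟨v, hv, hvc⟩ := exists_mem_of_generic h hU hd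
  rw [← hUm v hv, hvc]

theorem linkDiffComplete_iff {X Y : WeightedComplex Λ} {γ : Set V} {c : ℚ}
    (h : ∀ᶠ v in generic V, linkDiffMult X Y γ v = c) : LinkDiffComplete X Y γ ↔ c ≠ 0 := by
  obtain ⟨U, hU, hd, hUm⟩ := exists_isOpen_dense_of_generic h
  unfold LinkDiffComplete
  rw [← dense_iff_closure_eq]
  constructor
  · rintro hD rfl
    obtain ⟨v, hv, hv'⟩ := hD.inter_open_nonempty U hU hd.nonempty
    exact hv' (hUm v hv)
  · intro hc
    refine hd.mono fun v hv => ?_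
    change linkDiffMult X Y γ v ≠ 0
    rwa [hUm v hv]

/-- The second clause allows sums over facets of X·Y to be extended to all cells of the expected
dimension. -/
theorem eventually_linkDiffMult_eq_stableMult {X Y : WeightedComplex Λ} (hΛ : Submodule.span ℝ (Λ : Set V) = ⊤)
    (hX : X.IsTropicalCycle) (hY : Y.IsTropicalCycle) {δ : Set V}
    (hδ : δ ∈ (X.refine Y.toPolyComplex).cells)
    (hd : dim δ + (X.codim + Y.codim) = finrank ℝ V) :
    (∀ᶠ v in generic V, linkDiffMult X Y δ v = stableMult X Y δ) ∧
      (δ ∉ (X.stableInter Y).facets → stableMult X Y δ = 0) := by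
  have hp := (X.refine Y.toPolyComplex).polyhedron δ hδ
  obtain ⟨σ, hσ, τ, hτ, rfl, hne⟩ := PolyComplex.mem_refine.1 hδ
  obtain ⟨c, hc⟩ := exists_linkDiffMult_eq hΛ hX hY hp.convex hne hσ Set.inter_subset_left hτ
    Set.inter_subset_right hd
  have e := stableMult_eq hc
  refine ⟨by rwa [e], fun h => ?_⟩
  rw [e]
  by_contra hc0
  exact h (mem_facets_stableInter.2 ⟨hδ, hd, (linkDiffComplete_iff hc).2 hc0⟩)

/-! ### Transversality -/

theorem finrank_inf_of_sup_eq_top {S T : Submodule ℝ V} (h : S ⊔ T = ⊤) :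
    finrank ℝ (S ⊓ T : Submodule ℝ V) + finrank ℝ V = finrank ℝ S + finrank ℝ T := by
  have := Submodule.finrank_sup_add_finrank_inf_eq S T
  rw [h, finrank_top] at this
  omega

/-- A finite index makes the spans of σ and τ add up to V, so their intersection has the expected
dimension, which is already that of δ. -/
theorem eq_inter_of_transversal (hΛ : Submodule.span ℝ (Λ : Set V) = ⊤) {X Y : WeightedComplex Λ}
    {σ τ δ : Set V} (hσ : σ ∈ X.facets) (hτ : τ ∈ Y.facets)
    (hi : (latticeOf Λ σ ⊔ latticeOf Λ τ).relIndex Λ.toAddSubgroup ≠ 0)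
    (hδ : δ ∈ (X.refine Y.toPolyComplex).cells) (hd : dim δ + (X.codim + Y.codim) = finrank ℝ V)
    (hδσ : δ ⊆ σ) (hδτ : δ ⊆ τ) :
    δ = σ ∩ τ ∧ vectorSpan ℝ δ = vectorSpan ℝ σ ⊓ vectorSpan ℝ τ := by
  obtain ⟨hσc, hσd⟩ := WeightedComplex.mem_facets.1 hσ
  obtain ⟨hτc, hτd⟩ := WeightedComplex.mem_facets.1 hτ
  have hsup : vectorSpan ℝ σ ⊔ vectorSpan ℝ τ = ⊤ := sup_vectorSpan_eq_top hΛ hi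
    (fun x hx => (mem_latticeOf.1 hx).2) fun x hx => (mem_latticeOf.1 hx).2
  have hf := finrank_inf_of_sup_eq_top hsup
  have hne : (σ ∩ τ).Nonempty :=
    ((X.refine Y.toPolyComplex).polyhedron δ hδ).1.mono (Set.subset_inter hδσ hδτ)
  have hle : vectorSpan ℝ (σ ∩ τ) ≤ vectorSpan ℝ σ ⊓ vectorSpan ℝ τ :=
    le_inf (vectorSpan_mono ℝ Set.inter_subset_left) (vectorSpan_mono ℝ Set.inter_subset_right)
  have hle' : vectorSpan ℝ δ ≤ vectorSpan ℝ (σ ∩ τ) :=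
    vectorSpan_mono ℝ (Set.subset_inter hδσ hδτ)
  have h1 := Submodule.finrank_mono hle
  unfold dim at hd hσd hτd
  refine ⟨(X.refine Y.toPolyComplex).eq_of_subset_of_dim_le
    (PolyComplex.mem_refine.2 ⟨σ, hσc, τ, hτc, rfl, hne⟩) hδ (Set.subset_inter hδσ hδτ) ?_,
    Submodule.eq_of_le_of_finrank_le (hle'.trans hle) (by omega)⟩
  unfold dim
  omega

/-- For a generic vector `y - z`, the vectors `y` and `z` are relative interior. -/
theorem generic_mem_relInt {X Y Z : WeightedComplex Λ} {γ σ τ ρ : Set V}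
    (hγ : γ ∈ ((X.refine Y.toPolyComplex).refine Z.toPolyComplex).cells) {ω : V}
    (hω : ω ∈ relInt γ)
    (hd : dim γ + (X.codim + Y.codim + Z.codim) = finrank ℝ V)
    (hσ : σ ∈ X.facets) (hτ : τ ∈ Y.facets) (hρ : ρ ∈ Z.facets)
    (hγρ : γ ⊆ ρ) (hsup : vectorSpan ℝ σ ⊔ vectorSpan ℝ τ = ⊤) {y z : V}
    (hw : ∀ κ ∈ (X.refine Y.toPolyComplex).cells, ∀ ρ ∈ Z.cells,
      vectorSpan ℝ κ ⊔ vectorSpan ℝ ρ ≠ ⊤ → y - z ∉ vectorSpan ℝ κ ⊔ vectorSpan ℝ ρ)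
    (hy : y ∈ feasible ω (σ ∩ τ)) (hz : z ∈ feasible ω ρ) :
    σ ∩ τ ∈ (X.refine Y.toPolyComplex).cells ∧
      dim (σ ∩ τ) + (X.codim + Y.codim) = finrank ℝ V ∧
      (∀ᶠ s in 𝓝[>] (0 : ℝ), ω + s • y ∈ relInt (σ ∩ τ)) ∧
      ∀ᶠ s in 𝓝[>] (0 : ℝ), ω + s • z ∈ relInt ρ := by
  set R := X.refine Y.toPolyComplex with hR
  obtain ⟨hσc, hσd⟩ := WeightedComplex.mem_facets.1 hσ
  obtain ⟨hτc, hτd⟩ := WeightedComplex.mem_facets.1 hτ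
  obtain ⟨hρc, hρd⟩ := WeightedComplex.mem_facets.1 hρ
  obtain ⟨δ₀, hδ₀, ρ₀, hρ₀, hγe, hγne⟩ := PolyComplex.mem_refine.1 hγ
  have hγδ₀ : γ ⊆ δ₀ := hγe ▸ Set.inter_subset_left
  have hωρ := hγρ (mem_relInt.1 hω).1
  have hωστ : ω ∈ σ ∩ τ :=
    mem_of_feasible ((X.polyhedron σ hσc).isClosed.inter (Y.polyhedron τ hτc).isClosed) hy
  have hδ : σ ∩ τ ∈ R.cells := PolyComplex.mem_refine.2 ⟨σ, hσc, τ, hτc, rfl, ω, hωστ⟩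
  have hf := finrank_inf_of_sup_eq_top hsup
  have hle : vectorSpan ℝ (σ ∩ τ) ≤ vectorSpan ℝ σ ⊓ vectorSpan ℝ τ :=
    le_inf (vectorSpan_mono ℝ Set.inter_subset_left) (vectorSpan_mono ℝ Set.inter_subset_right)
  have hleδ := Submodule.finrank_mono hle
  -- a transversal pair of cells containing `γ` has maximal dimension
  have key : ∀ κ ∈ R.cells, ∀ ρ' ∈ Z.cells, y ∈ feasible ω κ → z ∈ feasible ω ρ' →
      dim γ + finrank ℝ V ≤ dim κ + dim ρ' := by
    intro κ hκ ρ' hρ' hyκ hzρ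
    have hωκ := mem_of_feasible (R.polyhedron κ hκ).isClosed hyκ
    have hωρ' := mem_of_feasible (Z.polyhedron ρ' hρ').isClosed hzρ
    have hγκ : γ ⊆ κ := R.subset_of_mem_relInt hδ₀ hγδ₀ hω hκ hωκ
    have hγρ' : γ ⊆ ρ' := Z.subset_of_mem_relInt hρc hγρ hω hρ' hωρ'
    have htop : vectorSpan ℝ κ ⊔ vectorSpan ℝ ρ' = ⊤ := by
      by_contra hne
      exact hw κ hκ ρ' hρ' hne (Submodule.sub_mem _
        (Submodule.mem_sup_left (mem_vectorSpan_of_feasible hωκ hyκ))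
        (Submodule.mem_sup_right (mem_vectorSpan_of_feasible hωρ' hzρ)))
    have h1 := finrank_inf_of_sup_eq_top htop
    have h2 := Submodule.finrank_mono
      (le_inf (vectorSpan_mono ℝ hγκ) (vectorSpan_mono ℝ hγρ'))
    unfold dim
    omega
  obtain ⟨κ, hκ, hyκ, hκmin, hκint⟩ := R.exists_minimal_cell ⟨_, hδ, hy⟩
  obtain ⟨κ', hκ', hzκ', hκ'min, hκ'int⟩ := Z.exists_minimal_cell ⟨_, hρc, hz⟩
  have h1 := key κ hκ ρ hρc hyκ hz
  have h2 := key κ hκ κ' hκ' hyκ hzκ'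
  have hκδ := hκmin _ hδ hy
  have hκρ := hκ'min _ hρc hz
  have h3 : dim κ ≤ dim (σ ∩ τ) := Submodule.finrank_mono (vectorSpan_mono ℝ hκδ)
  have hdστ : dim (σ ∩ τ) + (X.codim + Y.codim) = finrank ℝ V := by
    unfold dim at *
    omega
  have e1 : κ = σ ∩ τ := R.eq_of_subset_of_dim_le hδ hκ hκδ (by omega)
  have e2 : κ' = ρ := Z.eq_of_subset_of_dim_le hρc hκ' hκρ (by omega)
  exact ⟨hδ, hdστ, e1 ▸ hκint, e2 ▸ hκ'int⟩

end

section

variable {V : Type*} [NormedAddCommGroup V] [NormedSpace ℝ V] {Λ : Submodule ℤ V}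
  [FiniteDimensional ℝ V]

/-! ### Iterated stable intersections -/

/-- For transversal facets, membership of `(ε v, w)` in the image of the product of the links, for
small `ε`, is decided in two steps. -/
theorem eventually_tripleDiff_iff {X Y Z : WeightedComplex Λ} {γ σ τ ρ : Set V}
    (hγ : γ ∈ ((X.refine Y.toPolyComplex).refine Z.toPolyComplex).cells) {ω : V}
    (hω : ω ∈ relInt γ) (hd : dim γ + (X.codim + Y.codim + Z.codim) = finrank ℝ V)
    (hσ : σ ∈ X.facets) (hτ : τ ∈ Y.facets) (hρ : ρ ∈ Z.facets)
    (hγσ : γ ⊆ σ) (hγτ : γ ⊆ τ) (hγρ : γ ⊆ ρ) (hsup : vectorSpan ℝ σ ⊔ vectorSpan ℝ τ = ⊤)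
    (hsup' : vectorSpan ℝ σ ⊓ vectorSpan ℝ τ ⊔ vectorSpan ℝ ρ = ⊤) {v w : V}
    (hw : ∀ κ ∈ (X.refine Y.toPolyComplex).cells, ∀ ρ ∈ Z.cells,
      vectorSpan ℝ κ ⊔ vectorSpan ℝ ρ ≠ ⊤ → w ∉ vectorSpan ℝ κ ⊔ vectorSpan ℝ ρ) :
    ∀ᶠ ε in 𝓝[>] (0 : ℝ),
      ((∃ x ∈ feasible ω σ, ∃ y ∈ feasible ω τ, ∃ z ∈ feasible ω ρ, x - y = ε • v ∧ y - z = w) ↔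
        dim (σ ∩ τ) + (X.codim + Y.codim) = finrank ℝ V ∧
          v ∈ link (σ ∩ τ) σ - link (σ ∩ τ) τ ∧ w ∈ feasible ω (σ ∩ τ) - feasible ω ρ) := by
  obtain ⟨hσc, hσd⟩ := WeightedComplex.mem_facets.1 hσ
  obtain ⟨hτc, hτd⟩ := WeightedComplex.mem_facets.1 hτ
  obtain ⟨hρc, hρd⟩ := WeightedComplex.mem_facets.1 hρ
  have pσ := X.polyhedron σ hσc
  have pτ := Y.polyhedron τ hτc
  have pρ := Z.polyhedron ρ hρc
  have hωγ := (mem_relInt.1 hω).1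
  have hf := finrank_inf_of_sup_eq_top hsup
  have hf' := finrank_inf_of_sup_eq_top hsup'
  have hle : vectorSpan ℝ (σ ∩ τ) ≤ vectorSpan ℝ σ ⊓ vectorSpan ℝ τ :=
    le_inf (vectorSpan_mono ℝ Set.inter_subset_left) (vectorSpan_mono ℝ Set.inter_subset_right)
  -- By transversality the intersection of the three spans has dimension dim γ. So solutions of x −
  -- y = εv, y − z = w in these spans are unique up to a common shift by the span of γ, under which
  -- the tangent cones are invariant.
  have hker : ∀ g, g ∈ vectorSpan ℝ σ → g ∈ vectorSpan ℝ τ → g ∈ vectorSpan ℝ ρ →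
      g ∈ vectorSpan ℝ γ := by
    have h1 : vectorSpan ℝ γ ≤ vectorSpan ℝ σ ⊓ vectorSpan ℝ τ ⊓ vectorSpan ℝ ρ :=
      le_inf (le_inf (vectorSpan_mono ℝ hγσ) (vectorSpan_mono ℝ hγτ)) (vectorSpan_mono ℝ hγρ)
    have h2 := Submodule.eq_of_le_of_finrank_le h1 (by unfold dim at *; omega)
    intro g h3 h4 h5
    rw [h2]
    exact ⟨⟨h3, h4⟩, h5⟩
  have hlin : ∀ {P : Set V}, Convex ℝ P → γ ⊆ P → ∀ {u g : V}, u ∈ feasible ω P →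
      g ∈ vectorSpan ℝ γ → u + g ∈ feasible ω P :=
    fun hP hγP _ _ hu hg => add_mem_feasible_of_relInt hP hγP hω hu hg
  -- the solutions for `ε = 0` and for `w = 0`
  obtain ⟨y₀, hy₀, r, hr, hyr⟩ := Submodule.mem_sup.1 (show w ∈ _ from hsup' ▸ Submodule.mem_top)
  obtain ⟨z₀, hz₀, hyz₀⟩ : ∃ z₀ ∈ vectorSpan ℝ ρ, y₀ - z₀ = w :=
    ⟨-r, Submodule.neg_mem _ hr, by rw [sub_neg_eq_add, hyr]⟩
  -- y₁ is chosen in the span of ρ as well, so that y and z can both move by ε • y₁ without changing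
  -- y − z.
  obtain ⟨x₁, hx₁, y₁, hy₁, hy₁ρ, hxy₁⟩ : ∃ x₁ ∈ vectorSpan ℝ σ, ∃ y₁ ∈ vectorSpan ℝ τ,
      y₁ ∈ vectorSpan ℝ ρ ∧ x₁ - y₁ = v := by
    obtain ⟨s, hs, t, ht, rfl⟩ := Submodule.mem_sup.1 (show v ∈ _ from hsup ▸ Submodule.mem_top)
    obtain ⟨a, ha, r, hr, rfl⟩ := Submodule.mem_sup.1 (show t ∈ _ from hsup' ▸ Submodule.mem_top)
    refine ⟨s + a, Submodule.add_mem _ hs ha.1, -r, ?_, Submodule.neg_mem _ hr, by abel⟩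
    have := Submodule.sub_mem _ ha.2 ht
    simpa using this
  have hT : ∀ ε : ℝ, (∃ x ∈ feasible ω σ, ∃ y ∈ feasible ω τ, ∃ z ∈ feasible ω ρ,
      x - y = ε • v ∧ y - z = w) ↔ y₀ + ε • x₁ ∈ feasible ω σ ∧ y₀ + ε • y₁ ∈ feasible ω τ ∧
        z₀ + ε • y₁ ∈ feasible ω ρ := by
    intro ε
    constructor
    · rintro ⟨x, hx, y, hy, z, hz, e1, e2⟩
      set g := y₀ + ε • x₁ - x with hg
      have g1 : g = y₀ + ε • y₁ - y := by
        have : x = y + ε • v := by rw [← e1]; abel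
        rw [hg, this, ← hxy₁]
        module
      have g2 : g = z₀ + ε • y₁ - z := by
        have : z = y - w := by rw [← e2]; abel
        rw [g1, this, ← hyz₀]
        abel
      have hgγ : g ∈ vectorSpan ℝ γ := by
        refine hker g ?_ ?_ ?_
        · exact Submodule.sub_mem _ (Submodule.add_mem _ hy₀.1 (Submodule.smul_mem _ _ hx₁))
            (mem_vectorSpan_of_feasible (hγσ hωγ) hx)
        · rw [g1]
          exact Submodule.sub_mem _ (Submodule.add_mem _ hy₀.2 (Submodule.smul_mem _ _ hy₁))
            (mem_vectorSpan_of_feasible (hγτ hωγ) hy)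
        · rw [g2]
          exact Submodule.sub_mem _ (Submodule.add_mem _ hz₀ (Submodule.smul_mem _ _ hy₁ρ))
            (mem_vectorSpan_of_feasible (hγρ hωγ) hz)
      refine ⟨?_, ?_, ?_⟩
      · have := hlin pσ.convex hγσ hx hgγ
        rwa [hg, add_sub_cancel] at this
      · have := hlin pτ.convex hγτ hy hgγ
        rwa [g1, add_sub_cancel] at this
      · have := hlin pρ.convex hγρ hz hgγ
        rwa [g2, add_sub_cancel] at this
    · rintro ⟨h1, h2, h3⟩
      refine ⟨_, h1, _, h2, _, h3, ?_, ?_⟩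
      · rw [← hxy₁]; module
      · rw [← hyz₀]; abel
  have hstatic : (x₁ ∈ feasible y₀ (feasible ω σ) ∧ y₁ ∈ feasible y₀ (feasible ω τ) ∧
      y₁ ∈ feasible z₀ (feasible ω ρ)) ↔ dim (σ ∩ τ) + (X.codim + Y.codim) = finrank ℝ V ∧
        v ∈ link (σ ∩ τ) σ - link (σ ∩ τ) τ ∧ w ∈ feasible ω (σ ∩ τ) - feasible ω ρ := by
    -- Genericity of w makes ω + s • y₀ and ω + s • z₀ relative interior to σ ∩ τ and ρ for small s.
    -- The links along σ ∩ τ are therefore iterated tangent cones at y₀.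
    have hgen : y₀ ∈ feasible ω (σ ∩ τ) → z₀ ∈ feasible ω ρ →
        dim (σ ∩ τ) + (X.codim + Y.codim) = finrank ℝ V ∧
        (∃ q ∈ relInt (σ ∩ τ), link (σ ∩ τ) σ = feasible q σ ∧ link (σ ∩ τ) τ = feasible q τ ∧
          feasible q σ = feasible y₀ (feasible ω σ) ∧ feasible q τ = feasible y₀ (feasible ω τ)) ∧
        ∃ q ∈ relInt ρ, feasible q ρ = feasible z₀ (feasible ω ρ) := by
      intro h1 h2
      obtain ⟨-, hdim, hq, hq'⟩ := generic_mem_relInt hγ hω hd hσ hτ hρ hγρ hsup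
        (by rwa [hyz₀]) h1 h2
      refine ⟨hdim, ?_, ?_⟩
      · rw [feasible_inter] at h1
        obtain ⟨s, ⟨hs1, hs2⟩, hs3⟩ := ((hq.and (pσ.eventually_feasible h1.1)).and
          (pτ.eventually_feasible h1.2)).exists
        have hconv := pσ.convex.inter pτ.convex
        exact ⟨_, hs1, link_eq_feasible hconv pσ.convex Set.inter_subset_left hs1,
          link_eq_feasible hconv pτ.convex Set.inter_subset_right hs1, hs2, hs3⟩
      · obtain ⟨s, hs1, hs2⟩ := (hq'.and (pρ.eventually_feasible h2)).exists
        exact ⟨_, hs1, hs2⟩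
    constructor
    · rintro ⟨h1, h2, h3⟩
      have k1 : y₀ ∈ feasible ω (σ ∩ τ) := by
        rw [feasible_inter]
        exact ⟨mem_of_feasible (pσ.isClosed_feasible ω) h1,
          mem_of_feasible (pτ.isClosed_feasible ω) h2⟩
      have k2 : z₀ ∈ feasible ω ρ := mem_of_feasible (pρ.isClosed_feasible ω) h3
      obtain ⟨hdim, ⟨q, hq, e1, e2, e3, e4⟩, -⟩ := hgen k1 k2
      refine ⟨hdim, ?_, Set.mem_sub.2 ⟨y₀, k1, z₀, k2, hyz₀⟩⟩
      rw [e1, e2, e3, e4]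
      exact Set.mem_sub.2 ⟨x₁, h1, y₁, h2, hxy₁⟩
    · rintro ⟨hdim, hv, hw'⟩
      obtain ⟨y', hy', z', hz', e⟩ := Set.mem_sub.1 hw'
      have hωστ : ω ∈ σ ∩ τ := ⟨hγσ hωγ, hγτ hωγ⟩
      have hy'' := hle (mem_vectorSpan_of_feasible hωστ hy')
      have hg : y₀ - y' ∈ vectorSpan ℝ γ := by
        refine hker _ (Submodule.sub_mem _ hy₀.1 hy''.1) (Submodule.sub_mem _ hy₀.2 hy''.2) ?_
        have : y₀ - y' = z₀ - z' := by
          rw [sub_eq_sub_iff_sub_eq_sub, hyz₀, e]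
        rw [this]
        exact Submodule.sub_mem _ hz₀ (mem_vectorSpan_of_feasible (hγρ hωγ) hz')
      have k1 : y₀ ∈ feasible ω (σ ∩ τ) := by
        have := hlin (pσ.convex.inter pτ.convex) (Set.subset_inter hγσ hγτ) hy' hg
        rwa [add_sub_cancel] at this
      have k2 : z₀ ∈ feasible ω ρ := by
        have : y₀ - y' = z₀ - z' := by
          rw [sub_eq_sub_iff_sub_eq_sub, hyz₀, e]
        rw [this] at hg
        have := hlin pρ.convex hγρ hz' hg
        rwa [add_sub_cancel] at this
      obtain ⟨-, ⟨q, hq, e1, e2, e3, e4⟩, q', hq', e5⟩ := hgen k1 k2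
      have hspan : vectorSpan ℝ (σ ∩ τ) = vectorSpan ℝ σ ⊓ vectorSpan ℝ τ :=
        Submodule.eq_of_le_of_finrank_le hle (by unfold dim at *; omega)
      rw [e1, e2] at hv
      obtain ⟨x', hx', y'', hy''', e'⟩ := Set.mem_sub.1 hv
      have hqm := (mem_relInt.1 hq).1
      have he : x₁ - x' = y₁ - y'' := by
        rw [sub_eq_sub_iff_sub_eq_sub, hxy₁, e']
      have hh : x₁ - x' ∈ vectorSpan ℝ (σ ∩ τ) := by
        rw [hspan]
        refine ⟨Submodule.sub_mem _ hx₁ (mem_vectorSpan_of_feasible hqm.1 hx'), ?_⟩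
        rw [he]
        exact Submodule.sub_mem _ hy₁ (mem_vectorSpan_of_feasible hqm.2 hy''')
      refine ⟨?_, ?_, ?_⟩
      · rw [← e3]
        have := add_mem_feasible_of_relInt pσ.convex Set.inter_subset_left hq hx' hh
        rwa [add_sub_cancel] at this
      · rw [← e4]
        rw [he] at hh
        have := add_mem_feasible_of_relInt pτ.convex Set.inter_subset_right hq hy''' hh
        rwa [add_sub_cancel] at this
      -- Since z₀ points into the relative interior of ρ, every direction in the span of ρ is
      -- feasible there.
      · rw [← e5]
        exact (mem_relInt.1 hq').2 y₁ hy₁ρ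
  filter_upwards [eventually_mem_iff_feasible (convex_feasible pσ.convex ω)
      (pσ.isClosed_feasible ω) y₀ x₁, eventually_mem_iff_feasible (convex_feasible pτ.convex ω)
      (pτ.isClosed_feasible ω) y₀ y₁, eventually_mem_iff_feasible (convex_feasible pρ.convex ω)
      (pρ.isClosed_feasible ω) z₀ y₁] with ε h1 h2 h3
  rw [hT, h1, h2, h3, hstatic]

-- At most one δ can contribute with non-zero index, namely σ ∩ τ, where N_δ = N_σ ∩ N_τ; its
-- condition is that of `eventually_tripleDiff_iff`. If the product of the indices is zero, both
-- sides vanish.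
open Classical in
theorem eventually_sum_eq_tripleTerm (hΛ : Submodule.span ℝ (Λ : Set V) = ⊤)
    {X Y Z : WeightedComplex Λ} {γ σ τ ρ : Set V}
    (hγ : γ ∈ ((X.refine Y.toPolyComplex).refine Z.toPolyComplex).cells) {ω : V}
    (hω : ω ∈ relInt γ) (hd : dim γ + (X.codim + Y.codim + Z.codim) = finrank ℝ V)
    (hσ : σ ∈ X.facets) (hτ : τ ∈ Y.facets) (hρ : ρ ∈ Z.facets)
    (hγσ : γ ⊆ σ) (hγτ : γ ⊆ τ) (hγρ : γ ⊆ ρ) {v w : V}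
    (hw : ∀ κ ∈ (X.refine Y.toPolyComplex).cells, ∀ ρ ∈ Z.cells,
      vectorSpan ℝ κ ⊔ vectorSpan ℝ ρ ≠ ⊤ → w ∉ vectorSpan ℝ κ ⊔ vectorSpan ℝ ρ) (a : ℚ) :
    ∀ᶠ ε in 𝓝[>] (0 : ℝ),
      (∑ δ ∈ (X.refine Y.toPolyComplex).cells.filter (fun δ =>
          dim δ + (X.codim + Y.codim) = finrank ℝ V ∧ γ ⊆ δ),
        if δ ⊆ σ ∧ δ ⊆ τ ∧ v ∈ link δ σ - link δ τ ∧ w ∈ feasible ω δ - feasible ω ρ then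
          a * ((latticeOf Λ σ ⊔ latticeOf Λ τ).relIndex Λ.toAddSubgroup *
            (latticeOf Λ δ ⊔ latticeOf Λ ρ).relIndex Λ.toAddSubgroup : ℕ) else 0) =
      if ∃ x ∈ feasible ω σ, ∃ y ∈ feasible ω τ, ∃ z ∈ feasible ω ρ,
          x - y = ε • v ∧ y - z = w then
        a * ((latticeOf Λ σ ⊔ latticeOf Λ τ).relIndex Λ.toAddSubgroup *
            (latticeOf Λ σ ⊓ latticeOf Λ τ ⊔ latticeOf Λ ρ).relIndex Λ.toAddSubgroup : ℕ)
      else 0 := by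
  set i₁ := (latticeOf Λ σ ⊔ latticeOf Λ τ).relIndex Λ.toAddSubgroup with hi₁
  set i₂ := (latticeOf Λ σ ⊓ latticeOf Λ τ ⊔ latticeOf Λ ρ).relIndex Λ.toAddSubgroup with hi₂
  have hδ : ∀ δ ∈ (X.refine Y.toPolyComplex).cells.filter (fun δ =>
      dim δ + (X.codim + Y.codim) = finrank ℝ V ∧ γ ⊆ δ), i₁ ≠ 0 → δ ⊆ σ → δ ⊆ τ →
      δ = σ ∩ τ ∧ latticeOf Λ δ = latticeOf Λ σ ⊓ latticeOf Λ τ := by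
    intro δ hδ h0 h1 h2
    obtain ⟨hδ, hdδ, -⟩ := Finset.mem_filter.1 hδ
    obtain ⟨e1, e2⟩ := eq_inter_of_transversal hΛ hσ hτ h0 hδ hdδ h1 h2
    exact ⟨e1, latticeOf_eq_inf e2⟩
  by_cases h0 : i₁ * i₂ = 0
  · refine Eventually.of_forall fun ε => ?_
    rw [h0, Nat.cast_zero, mul_zero, ite_self]
    refine Finset.sum_eq_zero fun δ hδ' => ?_
    split_ifs with h
    · by_cases h1 : i₁ = 0
      · simp [h1]
      · rw [(hδ δ hδ' h1 h.1 h.2.1).2, ← hi₂, h0, Nat.cast_zero, mul_zero]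
    · rfl
  · obtain ⟨h1, h2⟩ : i₁ ≠ 0 ∧ i₂ ≠ 0 := by
      rw [Nat.mul_eq_zero] at h0
      tauto
    have hsup : vectorSpan ℝ σ ⊔ vectorSpan ℝ τ = ⊤ := sup_vectorSpan_eq_top hΛ h1
      (fun x hx => (mem_latticeOf.1 hx).2) fun x hx => (mem_latticeOf.1 hx).2
    have hsup' : vectorSpan ℝ σ ⊓ vectorSpan ℝ τ ⊔ vectorSpan ℝ ρ = ⊤ :=
      sup_vectorSpan_eq_top hΛ h2
        (fun x hx => ⟨(mem_latticeOf.1 hx.1).2, (mem_latticeOf.1 hx.2).2⟩)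
        fun x hx => (mem_latticeOf.1 hx).2
    filter_upwards [eventually_tripleDiff_iff hγ hω hd hσ hτ hρ hγσ hγτ hγρ hsup hsup' (v := v) hw]
      with ε hε
    simp only [hε]
    by_cases hdim : dim (σ ∩ τ) + (X.codim + Y.codim) = finrank ℝ V
    · have hne : (σ ∩ τ).Nonempty := ⟨ω, hγσ (mem_relInt.1 hω).1, hγτ (mem_relInt.1 hω).1⟩
      have hmem : σ ∩ τ ∈ (X.refine Y.toPolyComplex).cells.filter (fun δ =>
          dim δ + (X.codim + Y.codim) = finrank ℝ V ∧ γ ⊆ δ) :=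
        Finset.mem_filter.2 ⟨PolyComplex.mem_refine.2 ⟨σ, (WeightedComplex.mem_facets.1 hσ).1, τ,
          (WeightedComplex.mem_facets.1 hτ).1, rfl, hne⟩, hdim, Set.subset_inter hγσ hγτ⟩
      rw [Finset.sum_eq_single_of_mem _ hmem]
      · simp only [Set.inter_subset_left, Set.inter_subset_right, hdim, true_and,
          (hδ _ hmem h1 Set.inter_subset_left Set.inter_subset_right).2, ← hi₂]
      · intro δ hδ' hne
        rw [if_neg]
        rintro ⟨h3, h4, -⟩
        exact hne (hδ δ hδ' h1 h3 h4).1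
    · rw [if_neg (by tauto)]
      refine Finset.sum_eq_zero fun δ hδ' => ?_
      rw [if_neg]
      rintro ⟨h3, h4, -⟩
      rw [← (hδ δ hδ' h1 h3 h4).1] at hdim
      exact hdim (Finset.mem_filter.1 hδ').2.1

end

/-! ### Multiplicities of an iterated stable intersection -/

section

variable {V : Type*} [NormedAddCommGroup V] [NormedSpace ℝ V] {Λ : Submodule ℤ V}

-- Re-indexes by the facets containing the smaller cell γ, so that the sums for all δ containing γ
-- have a common range and can be interchanged.
open Classical in
theorem linkDiffMult_eq_sum_of_subset (X Y : WeightedComplex Λ) {γ δ : Set V} (h : γ ⊆ δ) (v : V) :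
    linkDiffMult X Y δ v = ∑ σ ∈ X.facets.filter (fun σ => γ ⊆ σ),
      ∑ τ ∈ Y.facets.filter (fun τ => γ ⊆ τ),
        if δ ⊆ σ ∧ δ ⊆ τ ∧ v ∈ link δ σ - link δ τ then
          X.mult σ * Y.mult τ * ((latticeOf Λ σ ⊔ latticeOf Λ τ).relIndex Λ.toAddSubgroup : ℚ)
        else 0 := by
  unfold linkDiffMult
  rw [Finset.sum_filter, Finset.sum_filter]
  refine Finset.sum_congr rfl fun σ _ => ?_
  by_cases hσ : δ ⊆ σ
  · rw [if_pos hσ, if_pos (h.trans hσ), Finset.sum_filter, Finset.sum_filter]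
    refine Finset.sum_congr rfl fun τ _ => ?_
    by_cases hτ : δ ⊆ τ
    · rw [if_pos hτ, if_pos (h.trans hτ)]
      simp only [hσ, hτ, true_and]
    · simp [hτ]
  · simp [hσ]

variable [FiniteDimensional ℝ V]

/-- The multiplicities of an iterated stable intersection are those of the push-forward of the
link of `X × Y × Z`, at points `(ε v, w)` with `ε` small. -/
theorem eventually_linkDiffMult_stableInter (hΛ : Submodule.span ℝ (Λ : Set V) = ⊤)
    {X Y Z : WeightedComplex Λ} (hX : X.IsTropicalCycle) (hY : Y.IsTropicalCycle) {γ : Set V}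
    (hγ : γ ∈ ((X.refine Y.toPolyComplex).refine Z.toPolyComplex).cells) {ω : V}
    (hω : ω ∈ relInt γ) (hd : dim γ + (X.codim + Y.codim + Z.codim) = finrank ℝ V) :
    ∀ᶠ w in generic V, ∀ᶠ v in generic V, ∀ᶠ ε in 𝓝[>] (0 : ℝ),
      linkDiffMult (X.stableInter Y) Z γ w = tripleMult X Y Z γ ω (ε • v, w) := by
  classical
  set R := X.refine Y.toPolyComplex with hR
  have hγc : Convex ℝ γ := (PolyComplex.polyhedron _ γ hγ).convex
  have hwgen : ∀ᶠ w in generic V, ∀ κ ∈ R.cells, ∀ ρ ∈ Z.cells,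
      vectorSpan ℝ κ ⊔ vectorSpan ℝ ρ ≠ ⊤ → w ∉ vectorSpan ℝ κ ⊔ vectorSpan ℝ ρ := by
    rw [eventually_all_finset]
    intro κ _
    rw [eventually_all_finset]
    intro ρ _
    by_cases h : vectorSpan ℝ κ ⊔ vectorSpan ℝ ρ = ⊤
    · simp [h]
    · filter_upwards [eventually_notMem h] with w hw _ using hw
  filter_upwards [hwgen] with w hw
  set 𝒟 := R.cells.filter fun δ => dim δ + (X.codim + Y.codim) = finrank ℝ V ∧ γ ⊆ δ with h𝒟
  have hmem : ∀ δ, δ ∈ 𝒟 ↔ δ ∈ R.cells ∧ dim δ + (X.codim + Y.codim) = finrank ℝ V ∧ γ ⊆ δ :=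
    fun δ => Finset.mem_filter
  -- A single v is generic for the finitely many δ at once, so all multiplicities of X·Y are
  -- expanded at the same v.
  have hvgen : ∀ᶠ v in generic V, ∀ δ ∈ 𝒟, linkDiffMult X Y δ v = stableMult X Y δ := by
    rw [eventually_all_finset]
    intro δ hδ
    obtain ⟨h1, h2, -⟩ := (hmem δ).1 hδ
    exact (eventually_linkDiffMult_eq_stableMult hΛ hX hY h1 h2).1
  filter_upwards [hvgen] with v hv
  have hterm : ∀ᶠ ε in 𝓝[>] (0 : ℝ), ∀ σ ∈ X.facets.filter (fun σ => γ ⊆ σ),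
      ∀ τ ∈ Y.facets.filter (fun τ => γ ⊆ τ), ∀ ρ ∈ Z.facets.filter (fun ρ => γ ⊆ ρ),
      (∑ δ ∈ 𝒟,
        if δ ⊆ σ ∧ δ ⊆ τ ∧ v ∈ link δ σ - link δ τ ∧ w ∈ feasible ω δ - feasible ω ρ then
          X.mult σ * Y.mult τ * Z.mult ρ *
            ((latticeOf Λ σ ⊔ latticeOf Λ τ).relIndex Λ.toAddSubgroup *
            (latticeOf Λ δ ⊔ latticeOf Λ ρ).relIndex Λ.toAddSubgroup : ℕ) else 0) =
      if ∃ x ∈ feasible ω σ, ∃ y ∈ feasible ω τ, ∃ z ∈ feasible ω ρ,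
          x - y = ε • v ∧ y - z = w then
        X.mult σ * Y.mult τ * Z.mult ρ *
          ((latticeOf Λ σ ⊔ latticeOf Λ τ).relIndex Λ.toAddSubgroup *
            (latticeOf Λ σ ⊓ latticeOf Λ τ ⊔ latticeOf Λ ρ).relIndex Λ.toAddSubgroup : ℕ)
      else 0 := by
    rw [eventually_all_finset]
    intro σ hσ
    rw [eventually_all_finset]
    intro τ hτ
    rw [eventually_all_finset]
    intro ρ hρ
    rw [Finset.mem_filter] at hσ hτ hρ
    exact eventually_sum_eq_tripleTerm hΛ hγ hω hd hσ.1 hτ.1 hρ.1 hσ.2 hτ.2 hρ.2 hw _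
  filter_upwards [hterm] with ε hε
  have hR : tripleMult X Y Z γ ω (ε • v, w) = ∑ σ ∈ X.facets.filter (fun σ => γ ⊆ σ),
      ∑ τ ∈ Y.facets.filter (fun τ => γ ⊆ τ), ∑ ρ ∈ Z.facets.filter (fun ρ => γ ⊆ ρ), ∑ δ ∈ 𝒟,
        if δ ⊆ σ ∧ δ ⊆ τ ∧ v ∈ link δ σ - link δ τ ∧ w ∈ feasible ω δ - feasible ω ρ then
          X.mult σ * Y.mult τ * Z.mult ρ *
            ((latticeOf Λ σ ⊔ latticeOf Λ τ).relIndex Λ.toAddSubgroup *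
            (latticeOf Λ δ ⊔ latticeOf Λ ρ).relIndex Λ.toAddSubgroup : ℕ) else 0 :=
    Finset.sum_congr rfl fun σ hσ => Finset.sum_congr rfl fun τ hτ =>
      Finset.sum_congr rfl fun ρ hρ => (hε σ hσ τ hτ ρ hρ).symm
  have hL : linkDiffMult (X.stableInter Y) Z γ w = ∑ δ ∈ 𝒟,
      ∑ ρ ∈ Z.facets.filter (fun ρ => γ ⊆ ρ), if w ∈ feasible ω δ - feasible ω ρ then
        stableMult X Y δ * Z.mult ρ *
          ((latticeOf Λ δ ⊔ latticeOf Λ ρ).relIndex Λ.toAddSubgroup : ℚ) else 0 := by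
    rw [linkDiffMult_eq_feasible _ _ hγc hω]
    refine Finset.sum_subset (fun δ hδ => ?_) fun δ hδ hδ' => ?_
    · obtain ⟨h1, h2⟩ := Finset.mem_filter.1 hδ
      obtain ⟨h3, h4, -⟩ := mem_facets_stableInter.1 h1
      exact (hmem δ).2 ⟨h3, h4, h2⟩
    · obtain ⟨h1, h2, h3⟩ := (hmem δ).1 hδ
      have h0 := (eventually_linkDiffMult_eq_stableMult hΛ hX hY h1 h2).2
        fun h => hδ' (Finset.mem_filter.2 ⟨h, h3⟩)
      refine Finset.sum_eq_zero fun ρ _ => ?_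
      change (if _ then stableMult X Y δ * _ * _ else _) = (0 : ℚ)
      simp [h0]
  rw [hL, hR]
  have hterm' : ∀ δ ∈ 𝒟, ∀ ρ, (if w ∈ feasible ω δ - feasible ω ρ then
        stableMult X Y δ * Z.mult ρ *
          ((latticeOf Λ δ ⊔ latticeOf Λ ρ).relIndex Λ.toAddSubgroup : ℚ) else 0) =
      ∑ σ ∈ X.facets.filter (fun σ => γ ⊆ σ), ∑ τ ∈ Y.facets.filter (fun τ => γ ⊆ τ),
        if δ ⊆ σ ∧ δ ⊆ τ ∧ v ∈ link δ σ - link δ τ ∧ w ∈ feasible ω δ - feasible ω ρ then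
          X.mult σ * Y.mult τ * Z.mult ρ *
            ((latticeOf Λ σ ⊔ latticeOf Λ τ).relIndex Λ.toAddSubgroup *
            (latticeOf Λ δ ⊔ latticeOf Λ ρ).relIndex Λ.toAddSubgroup : ℕ) else 0 := by
    intro δ hδ ρ
    rw [← hv δ hδ, linkDiffMult_eq_sum_of_subset X Y ((hmem δ).1 hδ).2.2]
    by_cases hW : w ∈ feasible ω δ - feasible ω ρ
    · simp only [hW, and_true, if_true]
      rw [Finset.sum_mul, Finset.sum_mul]
      refine Finset.sum_congr rfl fun σ _ => ?_
      rw [Finset.sum_mul, Finset.sum_mul]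
      refine Finset.sum_congr rfl fun τ _ => ?_
      split_ifs
      · push_cast
        ring
      · simp
    · simp [hW]
  rw [Finset.sum_congr rfl fun δ hδ => Finset.sum_congr rfl fun ρ _ => hterm' δ hδ ρ]
  rw [Finset.sum_comm]
  simp_rw [Finset.sum_comm (s := 𝒟)]
  rw [Finset.sum_comm]
  refine Finset.sum_congr rfl fun σ _ => ?_
  rw [Finset.sum_comm]

end

section

variable {V : Type*} [NormedAddCommGroup V] [NormedSpace ℝ V] {Λ : Submodule ℤ V}

/-! ### Complexes with a single cell -/

/-- The complex whose only cell is a rational affine subspace. -/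
def singleCell (P : Set V) (hP : IsRationalPolyhedron Λ P)
    (hflat : ∀ x ∈ P, ∀ y ∈ P, x + (x - y) ∈ P) : PolyComplex Λ where
  cells := {P}
  polyhedron := by
    intro σ hσ
    obtain rfl := Finset.mem_singleton.1 hσ
    exact hP
  face_mem := by
    intro σ hσ τ hτ
    obtain rfl := Finset.mem_singleton.1 hσ
    refine Finset.mem_singleton.2 (Set.Subset.antisymm hτ.2.2.1 fun y hy => ?_)
    obtain ⟨x, hx⟩ := hτ.1
    refine hτ.2.2.2 hy (hflat x (hτ.2.2.1 hx) y hy) hx ⟨1 / 2, 1 / 2, by norm_num, by norm_num,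
      by norm_num, by module⟩
  inter_face := by
    intro σ hσ τ hτ h
    obtain rfl := Finset.mem_singleton.1 hσ
    obtain rfl := Finset.mem_singleton.1 hτ
    rw [Set.inter_self]
    exact ⟨hP.1, hP.convex, IsExtreme.rfl⟩

theorem isRationalPolyhedron_univ : IsRationalPolyhedron Λ (Set.univ : Set V) :=
  ⟨Set.univ_nonempty, ∅, by simp, by ext; simp⟩

theorem isRationalPolyhedron_hyperplane {l : Module.Dual ℝ V}
    (hl : ∀ x ∈ Λ, ∃ z : ℤ, l x = z) (ω : V) : IsRationalPolyhedron Λ {x | l x = l ω} := by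
  classical
  refine ⟨⟨ω, rfl⟩, {(l, l ω), (-l, -l ω)}, ?_, ?_⟩
  · intro p hp x hx
    obtain ⟨z, hz⟩ := hl x hx
    rcases Finset.mem_insert.1 hp with rfl | hp
    · exact ⟨z, hz⟩
    · obtain rfl := Finset.mem_singleton.1 hp
      exact ⟨-z, by simp [hz]⟩
  · ext x
    simp [le_antisymm_iff]

theorem vectorSpan_hyperplane (l : Module.Dual ℝ V) (ω : V) :
    vectorSpan ℝ {x | l x = l ω} = LinearMap.ker l := by
  apply le_antisymm
  · rw [vectorSpan_eq_span_vsub_set_right ℝ (show ω ∈ {x | l x = l ω} from rfl), Submodule.span_le]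
    rintro _ ⟨y, hy, rfl⟩
    have hy : l y = l ω := hy
    simp [hy]
  · intro x hx
    have h1 : ω + x ∈ {x | l x = l ω} := by
      have hx : l x = 0 := hx
      simp [hx]
    have := vsub_mem_vectorSpan ℝ h1 (show ω ∈ {x | l x = l ω} from rfl)
    simpa using this

theorem feasible_hyperplane (l : Module.Dual ℝ V) (ω : V) :
    feasible ω {x | l x = l ω} = LinearMap.ker l := by
  ext u
  constructor
  · intro hu
    obtain ⟨ε, h1, hε : 0 < ε⟩ := ((mem_feasible.1 hu).and self_mem_nhdsWithin).exists
    have h1 : l (ω + ε • u) = l ω := h1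
    rw [map_add, map_smul, add_eq_left, smul_eq_mul, mul_eq_zero] at h1
    exact h1.resolve_left hε.ne'
  · intro hu
    have hu : l u = 0 := hu
    exact mem_feasible.2 (Eventually.of_forall fun ε => by simp [hu])

variable [FiniteDimensional ℝ V]

theorem dim_hyperplane {l : Module.Dual ℝ V} (hl : l ≠ 0) (ω : V) :
    dim {x | l x = l ω} + 1 = finrank ℝ V := by
  unfold dim
  rw [vectorSpan_hyperplane]
  exact Module.Dual.finrank_ker_add_one_of_ne_zero hl

/-- A rational affine hyperplane, as a weighted complex. -/
def hyperplane {l : Module.Dual ℝ V} (hl : ∀ x ∈ Λ, ∃ z : ℤ, l x = z) (hl0 : l ≠ 0) (ω : V) :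
    WeightedComplex Λ where
  toPolyComplex := singleCell {x | l x = l ω} (isRationalPolyhedron_hyperplane hl ω) (by
    intro x hx y hy
    have hx : l x = l ω := hx
    have hy : l y = l ω := hy
    simp [hx, hy])
  codim := 1
  pure := by
    intro τ hτ
    obtain rfl := Finset.mem_singleton.1 hτ
    exact ⟨_, hτ, subset_rfl, dim_hyperplane hl0 ω⟩
  mult := fun _ => 1

/-- Vacuous: the only cell has codimension 1, so there are no ridges. -/
theorem isTropicalCycle_hyperplane {l : Module.Dual ℝ V} (hl : ∀ x ∈ Λ, ∃ z : ℤ, l x = z)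
    (hl0 : l ≠ 0) (ω : V) : (hyperplane hl hl0 ω).IsTropicalCycle := by
  intro τ hτ hd
  obtain rfl := Finset.mem_singleton.1 hτ
  have := dim_hyperplane hl0 ω
  have hd : dim {x | l x = l ω} + 1 + 1 = finrank ℝ V := hd
  omega

theorem facets_hyperplane {l : Module.Dual ℝ V} (hl : ∀ x ∈ Λ, ∃ z : ℤ, l x = z)
    (hl0 : l ≠ 0) (ω : V) : (hyperplane hl hl0 ω).facets = {{x | l x = l ω}} := by
  ext σ
  rw [WeightedComplex.mem_facets]
  constructor
  · exact fun h => h.1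
  · intro h
    refine ⟨h, ?_⟩
    obtain rfl := Finset.mem_singleton.1 h
    exact dim_hyperplane hl0 ω

/-- The index of `N_H + ℤ u` is proportional to `|l u|`, where `N_H` is the lattice of `ker l`. -/
theorem exists_relIndex_eq_mul_abs (hΛ : Submodule.span ℝ (Λ : Set V) = ⊤) {l : Module.Dual ℝ V}
    (hl : ∀ x ∈ Λ, ∃ z : ℤ, l x = z) (hl0 : l ≠ 0) (ω : V) :
    ∃ r : ℝ, r ≠ 0 ∧ ∀ u ∈ Λ,
      ((latticeOf Λ {x | l x = l ω} ⊔ AddSubgroup.zmultiples u).relIndex Λ.toAddSubgroup : ℝ) =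
        r * |l u| := by
  have hp := isRationalPolyhedron_hyperplane hl ω
  have hsp : Submodule.span ℝ (latticeOf Λ {x | l x = l ω} : Set V) = LinearMap.ker l := by
    rw [hp.span_latticeOf hΛ, vectorSpan_hyperplane]
  obtain ⟨D, hD0, hD⟩ := exists_linear_relIndex (Λ := Λ.toAddSubgroup) hΛ (by
    rw [hsp]
    exact fun h => hl0 (LinearMap.ker_eq_top.1 h)) (latticeOf_le {x | l x = l ω})
  have hDker : ∀ x, l x = 0 → D x = 0 := fun x hx =>
    linearMap_zero_on_span hD0 (by rw [hsp]; exact hx)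
  obtain ⟨u₀, hu₀, hgen⟩ := exists_generator (L := Λ.toAddSubgroup) (l := l) hl
  have hlu₀ : l u₀ ≠ 0 := by
    intro h0
    refine hl0 (LinearMap.ext fun x => linearMap_zero_on_span (M := (Λ : Set V)) (fun y hy => ?_)
      (hΛ ▸ Submodule.mem_top))
    obtain ⟨j, hj⟩ := hgen y hy
    rw [hj, h0, mul_zero]
  have hDl : ∀ x, D x = D u₀ / l u₀ * l x := by
    intro x
    have := hDker (x - (l x / l u₀) • u₀) (by
      rw [map_sub, map_smul, smul_eq_mul, div_mul_cancel₀ _ hlu₀, sub_self])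
    rw [map_sub, map_smul, smul_eq_mul, sub_eq_zero] at this
    rw [this]
    ring
  have htop : latticeOf Λ {x | l x = l ω} ⊔ AddSubgroup.zmultiples u₀ = Λ.toAddSubgroup := by
    refine le_antisymm (sup_le (latticeOf_le _) (by rwa [AddSubgroup.zmultiples_le])) fun x hx => ?_
    obtain ⟨j, hj⟩ := hgen x hx
    refine AddSubgroup.mem_sup.2 ⟨x - j • u₀, mem_latticeOf.2 ⟨Λ.sub_mem hx (Λ.smul_mem j hu₀), ?_⟩,
      j • u₀, ⟨j, rfl⟩, by abel⟩
    rw [vectorSpan_hyperplane]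
    change l (x - j • u₀) = 0
    rw [map_sub, map_zsmul, hj, zsmul_eq_mul, sub_self]
  -- u₀ generates Λ modulo the lattice of the hyperplane, so the index is 1 and |D u₀| = 1; hence
  -- the factor |D u₀ / l u₀| is non-zero.
  have hDu₀ := hD u₀ hu₀
  rw [htop, AddSubgroup.relIndex_self, Nat.cast_one] at hDu₀
  refine ⟨|D u₀ / l u₀|, ?_, fun u hu => ?_⟩
  · rw [abs_div, ← hDu₀]
    positivity
  · rw [hD u hu, hDl u, abs_mul]

/-! ### Stable intersections are balanced -/

/-- For generic w, then generic v, then small ε, the value at (εv, w) is both the generic constant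
and the multiplicity at w. No balancing of X·Y enters, which is what makes the use in
`isTropicalCycle_stableInter` legitimate. -/
theorem exists_tripleMult_and_linkDiffMult_eq (hΛ : Submodule.span ℝ (Λ : Set V) = ⊤)
    {X Y Z : WeightedComplex Λ} (hX : X.IsTropicalCycle) (hY : Y.IsTropicalCycle)
    (hZ : Z.IsTropicalCycle) {γ : Set V}
    (hγ : γ ∈ ((X.refine Y.toPolyComplex).refine Z.toPolyComplex).cells) {ω : V}
    (hω : ω ∈ relInt γ) (hd : dim γ + (X.codim + Y.codim + Z.codim) = finrank ℝ V) :
    ∃ c : ℚ, (∀ᶠ f in generic (V × V), tripleMult X Y Z γ ω f = c) ∧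
      ∀ᶠ w in generic V, linkDiffMult (X.stableInter Y) Z γ w = c := by
  obtain ⟨δ₀, hδ₀, ρ₀, hρ₀, hγ₁, -⟩ := PolyComplex.mem_refine.1 hγ
  obtain ⟨σ₀, hσ₀, τ₀, hτ₀, hγ₂, -⟩ := PolyComplex.mem_refine.1 hδ₀
  have h1 : γ ⊆ δ₀ := hγ₁ ▸ Set.inter_subset_left
  obtain ⟨c, hc⟩ := exists_tripleMult_eq hΛ hX hY hZ hω hσ₀
    (h1.trans (hγ₂ ▸ Set.inter_subset_left)) hτ₀ (h1.trans (hγ₂ ▸ Set.inter_subset_right)) hρ₀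
    (hγ₁ ▸ Set.inter_subset_right) hd
  refine ⟨c, hc, ?_⟩
  filter_upwards [eventually_generic_prod_smul hc,
    eventually_linkDiffMult_stableInter hΛ hX hY hγ hω hd] with w hw1 hw2
  obtain ⟨v, hv1, hv2⟩ := (hw1.and hw2).exists
  obtain ⟨ε, h2, h3⟩ := (hv1.and hv2).exists
  rw [h3, h2]

/-- If the balancing sum at τ left the span of τ, some integral l would vanish on that span but not
on the sum. Intersecting with the hyperplane H = {l = l ω} gives a generically constant multiplicity
at τ. At w it collects mult σ · r|l (u σ)| over the σ whose normal lies on the same side of H as w,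
so the difference between w and −w is ±r times l of the sum. This forces l to vanish on the sum. -/
theorem isTropicalCycle_stableInter (hΛ : Submodule.span ℝ (Λ : Set V) = ⊤)
    {X Y : WeightedComplex Λ} (hX : X.IsTropicalCycle) (hY : Y.IsTropicalCycle) :
    (X.stableInter Y).IsTropicalCycle := by
  classical
  set W := X.stableInter Y with hW
  intro τ hτ hd
  have pτ := W.polyhedron τ hτ
  obtain ⟨ω, hω⟩ := pτ.relInt_nonempty
  have hdata : ∀ σ, ∃ u, σ ∈ W.facets → τ ⊆ σ → u ∈ Λ ∧ u ∈ link τ σ ∧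
      latticeOf Λ τ ⊔ AddSubgroup.zmultiples u = latticeOf Λ σ := by
    intro σ
    by_cases h : σ ∈ W.facets ∧ τ ⊆ σ
    · obtain ⟨hσ, hσd⟩ := WeightedComplex.mem_facets.1 h.1
      obtain ⟨u, hu⟩ := pτ.exists_normal hΛ (W.polyhedron σ hσ) (W.isFace_of_subset hσ hτ h.2)
        (by omega)
      exact ⟨u, fun _ _ => hu⟩
    · exact ⟨0, fun h1 h2 => absurd ⟨h1, h2⟩ h⟩
  choose u hu using hdata
  refine ⟨u, hu, ?_⟩
  rw [pτ.span_latticeOf hΛ]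
  by_contra hsum
  obtain ⟨l, hl, hlτ, hls⟩ := pτ.exists_integral hsum
  have hl0 : l ≠ 0 := by
    rintro rfl
    exact hls rfl
  set H := hyperplane hl hl0 ω with hH
  have hτH : τ ⊆ {x | l x = l ω} := by
    intro y hy
    have := hlτ (y - ω) (vsub_mem_vectorSpan ℝ hy (mem_relInt.1 hω).1)
    rw [map_sub, sub_eq_zero] at this
    exact this
  have hγ : τ ∈ ((X.refine Y.toPolyComplex).refine H.toPolyComplex).cells :=
    PolyComplex.mem_refine.2 ⟨τ, (mem_cells_stableInter.1 hτ).1, _, Finset.mem_singleton_self _,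
      Set.inter_eq_left.2 hτH, pτ.1⟩
  obtain ⟨c, -, hc⟩ := exists_tripleMult_and_linkDiffMult_eq hΛ hX hY
    (isTropicalCycle_hyperplane hl hl0 ω) hγ hω (by
      change dim τ + (X.codim + Y.codim + 1) = _
      have hd : dim τ + (X.codim + Y.codim) + 1 = finrank ℝ V := hd
      omega)
  obtain ⟨r, hr, hri⟩ := exists_relIndex_eq_mul_abs hΛ hl hl0 ω
  -- the contribution of a facet
  have hmem : ∀ σ ∈ W.facets.filter (fun σ => τ ⊆ σ), ∀ w, l w ≠ 0 →
      (w ∈ feasible ω σ - feasible ω {x | l x = l ω} ↔ 0 < l w * l (u σ)) := by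
    intro σ hσ w hw
    obtain ⟨hσf, hτσ⟩ := Finset.mem_filter.1 hσ
    obtain ⟨hσc, hσd⟩ := WeightedComplex.mem_facets.1 hσf
    have pσ := W.polyhedron σ hσc
    obtain ⟨huΛ, hul, hus⟩ := hu σ hσf hτσ
    have hface := W.isFace_of_subset hσc hτ hτσ
    rw [feasible_hyperplane]
    constructor
    · intro h
      obtain ⟨x, hx, k, hk, rfl⟩ := Set.mem_sub.1 h
      have hk : l k = 0 := hk
      have hxσ := mem_vectorSpan_of_feasible (hτσ (mem_relInt.1 hω).1) hx
      have hle : vectorSpan ℝ σ ≤ vectorSpan ℝ τ ⊔ Submodule.span ℝ {u σ} := by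
        rw [← pσ.span_latticeOf hΛ, Submodule.span_le, ← hus]
        intro y hy
        obtain ⟨m, hm, _, ⟨a, rfl⟩, rfl⟩ := AddSubgroup.mem_sup.1 hy
        exact Submodule.add_mem _ (Submodule.mem_sup_left (mem_latticeOf.1 hm).2)
          (Submodule.mem_sup_right (zsmul_mem (Submodule.mem_span_singleton_self _) a))
      obtain ⟨κ, hκ, y, hy, e⟩ := Submodule.mem_sup.1 (hle hxσ)
      obtain ⟨b, rfl⟩ := Submodule.mem_span_singleton.1 hy
      have hlx : l (x - k) = b * l (u σ) := by
        rw [map_sub, hk, ← e, map_add, hlτ κ hκ, map_smul, smul_eq_mul]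
        ring
      rw [hlx] at hw ⊢
      have hb : ¬ b < 0 := fun hb =>
        (pτ.add_smul_mem_feasible hΛ pσ hface (by omega) hul hus hω hκ).2 hb (e ▸ hx)
      have hb0 : b ≠ 0 := left_ne_zero_of_mul hw
      have hb' : 0 < b := lt_of_le_of_ne (not_lt.1 hb) hb0.symm
      rw [mul_assoc]
      exact mul_pos hb' (mul_self_pos.2 (right_ne_zero_of_mul hw))
    · intro h
      have hlu : l (u σ) ≠ 0 := right_ne_zero_of_mul h.ne'
      rw [link_eq_feasible pτ.convex pσ.convex hτσ hω] at hul
      have hpos : 0 < l w / l (u σ) := by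
        rw [← mul_div_mul_right _ _ hlu]
        exact div_pos h (mul_self_pos.2 hlu)
      refine Set.mem_sub.2 ⟨_, smul_mem_feasible hpos hul, (l w / l (u σ)) • u σ - w, ?_, by abel⟩
      change l _ = 0
      rw [map_sub, map_smul, smul_eq_mul, div_mul_cancel₀ _ hlu, sub_self]
  have hidx : ∀ σ ∈ W.facets.filter (fun σ => τ ⊆ σ),
      ((latticeOf Λ σ ⊔ latticeOf Λ {x | l x = l ω}).relIndex Λ.toAddSubgroup : ℝ) =
        r * |l (u σ)| := by
    intro σ hσ
    obtain ⟨hσf, hτσ⟩ := Finset.mem_filter.1 hσ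
    obtain ⟨huΛ, -, hus⟩ := hu σ hσf hτσ
    rw [← hri _ huΛ, ← hus, sup_right_comm, sup_eq_right.2 (latticeOf_mono hτH)]
  have hval : ∀ w, l w ≠ 0 → (linkDiffMult W H τ w : ℝ) =
      ∑ σ ∈ W.facets.filter (fun σ => τ ⊆ σ),
        if 0 < l w * l (u σ) then (W.mult σ : ℝ) * (r * |l (u σ)|) else 0 := by
    intro w hw
    have hfil : H.facets.filter (fun ρ => τ ⊆ ρ) = {{x | l x = l ω}} := by
      rw [facets_hyperplane, Finset.filter_singleton, if_pos hτH]
    rw [linkDiffMult_eq_feasible _ _ pτ.convex hω, hfil]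
    push_cast
    refine Finset.sum_congr rfl fun σ hσ => ?_
    rw [Finset.sum_singleton, ← hidx σ hσ]
    simp only [hmem σ hσ w hw]
    have : H.mult {x | l x = l ω} = 1 := rfl
    rw [this]
    split_ifs <;> simp
  have hneg : ∀ᶠ w in generic V, linkDiffMult W H τ (-w) = c :=
    (tendsto_generic (-LinearMap.id : V →ₗ[ℝ] V) fun y => ⟨-y, by simp⟩).eventually hc
  obtain ⟨w, ⟨h1, h2⟩, h3⟩ := ((hc.and hneg).and
    (eventually_notMem (S := LinearMap.ker l) fun h => hl0 (LinearMap.ker_eq_top.1 h))).exists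
  have hlw : l w ≠ 0 := h3
  have e1 := hval w hlw
  have e2 := hval (-w) (by rw [map_neg]; exact neg_ne_zero.2 hlw)
  rw [h1] at e1
  rw [h2, e1, ← sub_eq_zero, ← Finset.sum_sub_distrib] at e2
  have e3 : ∀ σ ∈ W.facets.filter (fun σ => τ ⊆ σ),
      ((if 0 < l w * l (u σ) then (W.mult σ : ℝ) * (r * |l (u σ)|) else 0) -
        if 0 < l (-w) * l (u σ) then (W.mult σ : ℝ) * (r * |l (u σ)|) else 0) =
      (r * SignType.sign (l w)) * ((W.mult σ : ℝ) * l (u σ)) := by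
    intro σ _
    rw [map_neg]
    rcases lt_or_gt_of_ne hlw with h | h <;> rcases lt_trichotomy (l (u σ)) 0 with h' | h' | h'
    · rw [if_pos (mul_pos_of_neg_of_neg h h'), if_neg (by nlinarith), abs_of_neg h', sign_neg h]
      simp
      ring
    · simp [h']
    · rw [if_neg (by nlinarith), if_pos (mul_pos (neg_pos.2 h) h'), abs_of_pos h', sign_neg h]
      simp
      ring
    · rw [if_neg (by nlinarith), if_pos (mul_pos_of_neg_of_neg (neg_neg_iff_pos.2 h) h'),
        abs_of_neg h', sign_pos h]
      simp
      ring
    · simp [h']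
    · rw [if_pos (mul_pos h h'), if_neg (by nlinarith), abs_of_pos h', sign_pos h]
      simp
      ring
  rw [Finset.sum_congr rfl e3, ← Finset.mul_sum] at e2
  have hs : (SignType.sign (l w) : ℝ) ≠ 0 := by
    rcases lt_or_gt_of_ne hlw with h | h
    · simp [sign_neg h]
    · simp [sign_pos h]
  refine hls ?_
  have e4 := (mul_eq_zero.1 e2).resolve_left (mul_ne_zero hr hs)
  simpa [map_sum] using e4

end

section

variable {V : Type*} [NormedAddCommGroup V] [NormedSpace ℝ V] {Λ : Submodule ℤ V}

/-! ### Symmetry -/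

theorem linkDiffMult_comm (X Y : WeightedComplex Λ) (γ : Set V) (v : V) :
    linkDiffMult Y X γ v = linkDiffMult X Y γ (-v) := by
  classical
  unfold linkDiffMult
  rw [Finset.sum_comm]
  refine Finset.sum_congr rfl fun σ _ => Finset.sum_congr rfl fun τ _ => ?_
  have h : -v ∈ link γ σ - link γ τ ↔ v ∈ link γ τ - link γ σ := by
    rw [← neg_sub (link γ τ) (link γ σ), Set.neg_mem_neg]
  rw [if_congr h rfl rfl, mul_comm (Y.mult τ), sup_comm]

theorem linkDiffMult_congr {X X' : WeightedComplex Λ} (hf : X.facets = X'.facets)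
    (hm : ∀ σ ∈ X.facets, X.mult σ = X'.mult σ) (Y : WeightedComplex Λ) (γ : Set V) (v : V) :
    linkDiffMult X Y γ v = linkDiffMult X' Y γ v := by
  classical
  unfold linkDiffMult
  rw [← hf]
  refine Finset.sum_congr rfl fun σ hσ => Finset.sum_congr rfl fun τ _ => ?_
  rw [hm σ (Finset.mem_filter.1 hσ).1]

theorem exists_facets_of_linkDiffMult_ne_zero {X Y : WeightedComplex Λ} {γ : Set V} {v : V}
    (h : linkDiffMult X Y γ v ≠ 0) : ∃ σ ∈ X.facets, ∃ τ ∈ Y.facets, γ ⊆ σ ∧ γ ⊆ τ := by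
  classical
  obtain ⟨σ, hσ, h⟩ := Finset.exists_ne_zero_of_sum_ne_zero h
  obtain ⟨τ, hτ, -⟩ := Finset.exists_ne_zero_of_sum_ne_zero h
  exact ⟨σ, (Finset.mem_filter.1 hσ).1, τ, (Finset.mem_filter.1 hτ).1, (Finset.mem_filter.1 hσ).2,
    (Finset.mem_filter.1 hτ).2⟩

theorem PolyComplex.mem_refine_comm {A B : PolyComplex Λ} {δ : Set V} :
    δ ∈ (A.refine B).cells ↔ δ ∈ (B.refine A).cells := by
  simp only [mem_refine]
  constructor <;>
  · rintro ⟨σ, hσ, τ, hτ, rfl, hne⟩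
    exact ⟨τ, hτ, σ, hσ, Set.inter_comm _ _, hne⟩

theorem PolyComplex.mem_refine_assoc {A B C : PolyComplex Λ} {δ : Set V} :
    δ ∈ ((A.refine B).refine C).cells ↔ δ ∈ (A.refine (B.refine C)).cells := by
  simp only [mem_refine]
  constructor
  · rintro ⟨_, ⟨σ, hσ, τ, hτ, rfl, h1⟩, ρ, hρ, rfl, hne⟩
    exact ⟨σ, hσ, τ ∩ ρ, ⟨τ, hτ, ρ, hρ, rfl, hne.mono fun x hx => ⟨hx.1.2, hx.2⟩⟩,
      (Set.inter_assoc _ _ _).symm, hne⟩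
  · rintro ⟨σ, hσ, _, ⟨τ, hτ, ρ, hρ, rfl, h1⟩, rfl, hne⟩
    exact ⟨σ ∩ τ, ⟨σ, hσ, τ, hτ, rfl, hne.mono fun x hx => ⟨hx.1, hx.2.1⟩⟩, ρ, hρ,
      Set.inter_assoc _ _ _, hne⟩

theorem tendsto_neg_generic : Tendsto (fun v : V => -v) (generic V) (generic V) :=
  tendsto_generic (-LinearMap.id : V →ₗ[ℝ] V) fun v => ⟨-v, by simp⟩

/-- A stable intersection keeps only part of a refinement, so a cell of the triple refinement may be
absent from the complex at hand. A non-zero multiplicity supplies facets σ and τ containing γ, and γ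
is then a face of the cell σ ∩ τ. -/
theorem mem_refine_of_linkDiffMult_ne_zero {X Y : WeightedComplex Λ} {T : PolyComplex Λ}
    {γ : Set V} {v : V} (hγ : γ ∈ T.cells)
    (hT : ∀ δ ∈ (X.refine Y.toPolyComplex).cells, δ ∈ T.cells)
    (h : linkDiffMult X Y γ v ≠ 0) : γ ∈ (X.refine Y.toPolyComplex).cells := by
  obtain ⟨σ, hσ, τ, hτ, hγσ, hγτ⟩ := exists_facets_of_linkDiffMult_ne_zero h
  have hs : γ ⊆ σ ∩ τ := Set.subset_inter hγσ hγτ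
  have hm : σ ∩ τ ∈ (X.refine Y.toPolyComplex).cells :=
    PolyComplex.mem_refine.2 ⟨σ, (WeightedComplex.mem_facets.1 hσ).1, τ,
      (WeightedComplex.mem_facets.1 hτ).1, rfl, (T.polyhedron γ hγ).1.mono hs⟩
  exact PolyComplex.face_mem _ _ hm _ (T.isFace_of_subset (hT _ hm) hγ hs)

/-- No subdivision is needed: the complete complex with the whole space as its only cell serves. -/
theorem WeightedComplex.sameCycle_of_facets_eq {X Y : WeightedComplex Λ}
    (hc : X.codim = Y.codim) (hf : X.facets = Y.facets)
    (hm : ∀ σ ∈ X.facets, X.mult σ = Y.mult σ) : X.SameCycle Y := by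
  refine ⟨hc, singleCell Set.univ isRationalPolyhedron_univ (by simp),
    fun x => ⟨Set.univ, Finset.mem_singleton_self _, trivial⟩, ?_⟩
  ext p
  unfold refinedFacets
  rw [← hf, ← hc]
  constructor
  · rintro ⟨σ, hσ, τ, hτ, h⟩
    exact ⟨σ, hσ, τ, hτ, hm σ hσ ▸ h⟩
  · rintro ⟨σ, hσ, τ, hτ, h⟩
    exact ⟨σ, hσ, τ, hτ, (hm σ hσ).symm ▸ h⟩

variable [FiniteDimensional ℝ V]

theorem stableMult_comm (hΛ : Submodule.span ℝ (Λ : Set V) = ⊤) {X Y : WeightedComplex Λ}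
    (hX : X.IsTropicalCycle) (hY : Y.IsTropicalCycle) {γ : Set V}
    (hγ : γ ∈ (X.refine Y.toPolyComplex).cells)
    (hd : dim γ + (X.codim + Y.codim) = finrank ℝ V) :
    stableMult X Y γ = stableMult Y X γ ∧ (LinkDiffComplete X Y γ ↔ LinkDiffComplete Y X γ) := by
  have h := (eventually_linkDiffMult_eq_stableMult hΛ hX hY hγ hd).1
  have h' : ∀ᶠ v in generic V, linkDiffMult Y X γ v = stableMult X Y γ := by
    filter_upwards [tendsto_neg_generic.eventually h] with v hv
    rwa [linkDiffMult_comm]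
  exact ⟨(stableMult_eq h').symm, (linkDiffComplete_iff h).trans (linkDiffComplete_iff h').symm⟩

theorem linkDiffMult_stableInter_comm (hΛ : Submodule.span ℝ (Λ : Set V) = ⊤)
    {X Y : WeightedComplex Λ} (hX : X.IsTropicalCycle) (hY : Y.IsTropicalCycle)
    (Z : WeightedComplex Λ) (γ : Set V) (v : V) :
    linkDiffMult (X.stableInter Y) Z γ v = linkDiffMult (Y.stableInter X) Z γ v := by
  refine linkDiffMult_congr ?_ ?_ Z γ v
  · ext δ
    rw [mem_facets_stableInter, mem_facets_stableInter, PolyComplex.mem_refine_comm,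
      add_comm Y.codim]
    refine and_congr_right fun h1 => and_congr_right fun h2 => ?_
    exact (stableMult_comm hΛ hX hY (PolyComplex.mem_refine_comm.1 h1) h2).2
  · intro δ hδ
    obtain ⟨h1, h2, -⟩ := mem_facets_stableInter.1 hδ
    exact (stableMult_comm hΛ hX hY h1 h2).1

/-! ### Associativity -/

/-- The constant for (X·Y)·Z and the one for (Z·Y)·X are generic values of the same push-forward up
to `tripleMult_symm`. Commutativity then turns (Z·Y)·X into X·(Y·Z). -/
theorem exists_linkDiffMult_stableInter_eq (hΛ : Submodule.span ℝ (Λ : Set V) = ⊤)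
    {X Y Z : WeightedComplex Λ} (hX : X.IsTropicalCycle) (hY : Y.IsTropicalCycle)
    (hZ : Z.IsTropicalCycle) {γ : Set V}
    (hγ : γ ∈ ((X.refine Y.toPolyComplex).refine Z.toPolyComplex).cells)
    (hd : dim γ + (X.codim + Y.codim + Z.codim) = finrank ℝ V) :
    ∃ c : ℚ, (∀ᶠ w in generic V, linkDiffMult (X.stableInter Y) Z γ w = c) ∧
      ∀ᶠ v in generic V, linkDiffMult X (Y.stableInter Z) γ v = c := by
  obtain ⟨ω, hω⟩ := (PolyComplex.polyhedron _ γ hγ).relInt_nonempty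
  have hγ' : γ ∈ ((Z.refine Y.toPolyComplex).refine X.toPolyComplex).cells := by
    obtain ⟨σ, hσ, δ, hδ, h⟩ := PolyComplex.mem_refine.1 (PolyComplex.mem_refine_assoc.1 hγ)
    exact PolyComplex.mem_refine_comm.1 (PolyComplex.mem_refine.2
      ⟨σ, hσ, δ, PolyComplex.mem_refine_comm.1 hδ, h⟩)
  obtain ⟨c, hc, hcl⟩ := exists_tripleMult_and_linkDiffMult_eq hΛ hX hY hZ hγ hω hd
  obtain ⟨c', hc', hcl'⟩ := exists_tripleMult_and_linkDiffMult_eq hΛ hZ hY hX hγ' hω (by omega)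
  -- The map (v, w) ↦ (−w, −v) is invertible, so one point can be generic for both triples
  -- simultaneously.
  set e : V × V →ₗ[ℝ] V × V := (-LinearMap.snd ℝ V V).prod (-LinearMap.fst ℝ V V) with he
  have he' : Tendsto e (generic (V × V)) (generic (V × V)) :=
    tendsto_generic e fun p => ⟨(-p.2, -p.1), by simp [he]⟩
  obtain ⟨⟨v, w⟩, h1, h2⟩ := (hc.and (he'.eventually hc')).exists
  have h2 : tripleMult Z Y X γ ω (-w, -v) = c' := h2
  rw [tripleMult_symm, h1] at h2
  subst h2
  refine ⟨c, hcl, ?_⟩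
  filter_upwards [tendsto_neg_generic.eventually hcl'] with v hv
  rw [linkDiffMult_comm, linkDiffMult_stableInter_comm hΛ hY hZ, hv]

theorem mem_facets_stableInter_of_linkDiffMult {X Y : WeightedComplex Λ} {T : PolyComplex Λ}
    {γ : Set V} (hγ : γ ∈ T.cells)
    (hT : ∀ δ ∈ (X.refine Y.toPolyComplex).cells, δ ∈ T.cells)
    (hd : dim γ + (X.codim + Y.codim) = finrank ℝ V) {c : ℚ}
    (h : ∀ᶠ v in generic V, linkDiffMult X Y γ v = c) :
    (γ ∈ (X.stableInter Y).facets ↔ c ≠ 0) ∧ (X.stableInter Y).mult γ = c := by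
  refine ⟨?_, stableMult_eq h⟩
  rw [mem_facets_stableInter, linkDiffComplete_iff h]
  refine ⟨fun h => h.2.2, fun hc => ⟨?_, hd, hc⟩⟩
  obtain ⟨v, hv⟩ := h.exists
  exact mem_refine_of_linkDiffMult_ne_zero hγ hT (v := v) (by rwa [hv])

/-- The cells of both iterated refinements lie in the triple refinement `T`. On its cells of the
expected dimension, being a facet and the weight are decided on both sides by the same constant. -/
theorem facets_and_mult_stableInter_assoc (hΛ : Submodule.span ℝ (Λ : Set V) = ⊤)
    {X Y Z : WeightedComplex Λ} (hX : X.IsTropicalCycle) (hY : Y.IsTropicalCycle)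
    (hZ : Z.IsTropicalCycle) :
    ((X.stableInter Y).stableInter Z).facets = (X.stableInter (Y.stableInter Z)).facets ∧
      ∀ γ ∈ ((X.stableInter Y).stableInter Z).facets,
        ((X.stableInter Y).stableInter Z).mult γ = (X.stableInter (Y.stableInter Z)).mult γ := by
  set T := (X.refine Y.toPolyComplex).refine Z.toPolyComplex with hTdef
  have hT₁ : ∀ δ ∈ ((X.stableInter Y).refine Z.toPolyComplex).cells, δ ∈ T.cells := by
    intro δ hδ
    obtain ⟨σ, hσ, h⟩ := PolyComplex.mem_refine.1 hδ
    exact PolyComplex.mem_refine.2 ⟨σ, (mem_cells_stableInter.1 hσ).1, h⟩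
  have hT₂ : ∀ δ ∈ (X.refine (Y.stableInter Z).toPolyComplex).cells, δ ∈ T.cells := by
    intro δ hδ
    obtain ⟨σ, hσ, τ, hτ, h⟩ := PolyComplex.mem_refine.1 hδ
    exact PolyComplex.mem_refine_assoc.2 (PolyComplex.mem_refine.2
      ⟨σ, hσ, τ, (mem_cells_stableInter.1 hτ).1, h⟩)
  have key : ∀ γ ∈ T.cells, dim γ + (X.codim + Y.codim + Z.codim) = finrank ℝ V →
      (γ ∈ ((X.stableInter Y).stableInter Z).facets ↔
        γ ∈ (X.stableInter (Y.stableInter Z)).facets) ∧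
      ((X.stableInter Y).stableInter Z).mult γ = (X.stableInter (Y.stableInter Z)).mult γ := by
    intro γ hγ hd
    obtain ⟨c, h1, h2⟩ := exists_linkDiffMult_stableInter_eq hΛ hX hY hZ hγ hd
    obtain ⟨f1, m1⟩ := mem_facets_stableInter_of_linkDiffMult hγ hT₁ hd h1
    obtain ⟨f2, m2⟩ := mem_facets_stableInter_of_linkDiffMult hγ hT₂
      (by rw [← hd, add_assoc X.codim]; rfl) h2
    exact ⟨f1.trans f2.symm, m1.trans m2.symm⟩
  constructor
  · ext γ
    constructor
    · intro h
      obtain ⟨h1, h2, -⟩ := mem_facets_stableInter.1 h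
      exact (key γ (hT₁ γ h1) h2).1.1 h
    · intro h
      obtain ⟨h1, h2, -⟩ := mem_facets_stableInter.1 h
      refine (key γ (hT₂ γ h1) ?_).1.2 h
      rw [← h2, add_assoc X.codim]
      rfl
  · intro γ h
    obtain ⟨h1, h2, -⟩ := mem_facets_stableInter.1 h
    exact (key γ (hT₁ γ h1) h2).2

end

end Trop

theorem mainTheorem2 {V : Type*} [NormedAddCommGroup V] [NormedSpace ℝ V] [FiniteDimensional ℝ V]
    (Λ : Submodule ℤ V) [DiscreteTopology Λ] [IsZLattice ℝ Λ]
    (X Y Z : Trop.WeightedComplex Λ)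
    (hX : X.IsTropicalCycle) (hY : Y.IsTropicalCycle) (hZ : Z.IsTropicalCycle) :
    (X.stableInter Y).IsTropicalCycle ∧ (Y.stableInter Z).IsTropicalCycle ∧
      ((X.stableInter Y).stableInter Z).SameCycle (X.stableInter (Y.stableInter Z)) := by
  have hΛ : Submodule.span ℝ (Λ : Set V) = ⊤ := IsZLattice.span_top
  have h := Trop.facets_and_mult_stableInter_assoc hΛ hX hY hZ
  exact ⟨Trop.isTropicalCycle_stableInter hΛ hX hY, Trop.isTropicalCycle_stableInter hΛ hY hZ,
    Trop.WeightedComplex.sameCycle_of_facets_eq (add_assoc _ _ _) h.1 h.2⟩
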